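/- Let $R$ be a commutative noetherian local domain of Krull dimension $1$ with maximal ideal $\mathfrak m$ whose $\mathfrak m$-adic completion $\widehat R$ is reduced. Let $M$ be a finitely generated torsion-free $R$-module, and write $$\widehat M = M\otimes_R\widehat R \cong L_1^{n_1}\oplus\cdots\oplus L_s^{n_s},$$ where $L_1,\dots,L_s$ are pairwise non-isomorphic indecomposable $\widehat R$-modules and $n_i\ge 1$ for all $i$. Let $\mathbb N_0^*=\mathbb N_0\cup\{\infty\}$, with $0\cdot\infty=0$, $a\cdot\infty=\infty$ for $a\neq0$, and $a+\infty=\infty$. Let $V^*(M)$ be the set of isomorphism classes of countably generated $R$-modules that are isomorphic to direct summands of direct sums of copies of $M$. Put $S=\operatorname{End}_R(M)$ and $\widehat S=\operatorname{End}_{\widehat R}(\widehat M)$, with Jacobson radicals $J(S)$ and $J(\widehat S)$. For $i=1,\dots,s$ let $V_i$ be the simple right $S$-module $Q_i/Q_iJ(\widehat S)$, where $Q_i=\operatorname{Hom}_{\widehat R}(\widehat M,L_i)$ and $S$ acts through the canonical map $S\to\widehat S$; let $D_i=\operatorname{End}_S(V_i)$. Let $\mathbf D_M\colon V^*(M)\to(\mathbb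 N_0^*)^s$ be the map $$\mathbf D_M([X])=\bigl(\dim_{D_i}\operatorname{Hom}_S(V_i,\,P/PJ(S))\bigr)_{i=1,\dots,s},\qquad P=\operatorname{Hom}_R(M,X),$$ where every infinite dimension is recorded as $\infty$. Let $P_1,\dots,P_\ell$ be the minimal prime ideals of $\widehat R$ (so each $\widehat R_{P_j}$ is a field), and let $a_{ji}=\dim_{\widehat R_{P_j}}\bigl(L_i\otimes_{\widehat R}\widehat R_{P_j}\bigr)$. Then $\mathbf x=(x_1,\dots,x_s)\in(\mathbb N_0^*)^s$ lies in $\mathbf D_M(V^*(M))$ if and only if $$\sum_{i=1}^s a_{ji}x_i=\sum_{i=1}^s a_{ki}x_i\qquad\text{for all } j,k\in\{1,\dots,\ell\}.$$ -/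

import Mathlib

universe u v w

open scoped TensorProduct

noncomputable section

namespace LocalAdd

/-! ### Modules over a ring -/

/-- A module is indecomposable if it is nonzero and is not the direct sum of two nonzero
submodules. -/
def IsIndecomposable (A : Type u) (L : Type w) [Ring A] [AddCommGroup L] [Module A L] : Prop :=
  Nontrivial L ∧ ∀ p q : Submodule A L, IsCompl p q → p = ⊥ ∨ q = ⊥

/-- `X` has a countable generating set. -/
def IsCountablyGenerated (A : Type u) (X : Type v) [Ring A] [AddCommGroup X] [Module A X] : Prop :=
  ∃ t : Set X, t.Countable ∧ Submodule.span A t = ⊤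

/-- `X` belongs to `Add M`: it is isomorphic to a direct summand of a direct sum of copies
of `M`. -/
def InAdd (A : Type u) (M X : Type v) [Ring A] [AddCommGroup M] [Module A M]
    [AddCommGroup X] [Module A X] : Prop :=
  ∃ (ι : Type v) (e : X →ₗ[A] (ι →₀ M)) (p : (ι →₀ M) →ₗ[A] X), p ∘ₗ e = LinearMap.id

/-- Two countably generated modules in `Add M` are identified if they are isomorphic. -/
instance vStarSetoid (A : Type u) (M : Type v) [Ring A] [AddCommGroup M] [Module A M] :
    Setoid {X : ModuleCat.{v} A // IsCountablyGenerated A X ∧ InAdd A M X} where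
  r X Y := Nonempty (X.1 ≃ₗ[A] Y.1)
  iseqv :=
    ⟨fun _ => ⟨LinearEquiv.refl _ _⟩, fun ⟨e⟩ => ⟨e.symm⟩, fun ⟨e⟩ ⟨f⟩ => ⟨e.trans f⟩⟩

/-- `V*(M)`: the set of isomorphism classes of countably generated modules in `Add M`. -/
def VStar (A : Type u) (M : Type v) [Ring A] [AddCommGroup M] [Module A M] : Type _ :=
  Quotient (vStarSetoid A M)

/-! ### Radical factors of Hom modules

For a ring `S`, a right `S`-module is a module over the opposite ring `Sᵐᵒᵖ`. -/

/-- `Hom_A(N, X)`, regarded as a right module over `S = End_A(N)` by precomposition. -/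
def HomMod (A : Type u) (N : Type v) (X : Type w) [Ring A] [AddCommGroup N] [Module A N]
    [AddCommGroup X] [Module A X] : Type (max v w) :=
  N →ₗ[A] X

section

variable (A : Type u) (N : Type v) (X : Type w) [Ring A] [AddCommGroup N] [Module A N]
    [AddCommGroup X] [Module A X]

instance : AddCommGroup (HomMod A N X) :=
  inferInstanceAs (AddCommGroup (N →ₗ[A] X))

instance : Module (Module.End A N)ᵐᵒᵖ (HomMod A N X) where
  smul c f := LinearMap.comp (f : N →ₗ[A] X) (MulOpposite.unop c)
  one_smul f := LinearMap.comp_id (f : N →ₗ[A] X)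
  mul_smul _ _ _ := rfl
  smul_zero c := LinearMap.zero_comp (MulOpposite.unop c)
  smul_add c f g := LinearMap.add_comp (MulOpposite.unop c) (g : N →ₗ[A] X) f
  add_smul c d f := LinearMap.comp_add (MulOpposite.unop c) (MulOpposite.unop d) (f : N →ₗ[A] X)
  zero_smul f := LinearMap.comp_zero (f : N →ₗ[A] X)

end

/-- The right `S`-module `Q / Q J(S)`, where `S = End_A(N)`, `Q = Hom_A(N, X)` and `J(S)` is the
Jacobson radical of `S`. -/
abbrev HomTop (A : Type u) (N : Type v) (X : Type w) [Ring A] [AddCommGroup N] [Module A N]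
    [AddCommGroup X] [Module A X] : Type (max v w) :=
  HomMod A N X ⧸
    (Ring.jacobson (Module.End A N)ᵐᵒᵖ • (⊤ : Submodule (Module.End A N)ᵐᵒᵖ (HomMod A N X)))

/-- The dimension of `Hom_T(V, W)` over the endomorphism ring of `V` (which acts from the right,
by precomposition), with all infinite values identified with `⊤ = ∞`. -/
def homDim (T : Type u) (V : Type v) (W : Type w) [Ring T] [AddCommGroup V] [Module T V]
    [AddCommGroup W] [Module T W] : ℕ∞ :=
  Cardinal.toENat (Module.rank (Module.End T V)ᵐᵒᵖ (HomMod T V W))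

/-! ### Completion of a local ring -/

/-- The completion of a local ring with respect to its maximal ideal. -/
abbrev RHat (R : Type u) [CommRing R] [IsLocalRing R] : Type u :=
  AdicCompletion (IsLocalRing.maximalIdeal R) R

/-- The extension of scalars of `M` to the completion of `R`. -/
abbrev MHat (R : Type u) (M : Type v) [CommRing R] [IsLocalRing R] [AddCommGroup M]
    [Module R M] : Type (max u v) :=
  RHat R ⊗[R] M

/-- The ring homomorphism from the opposite ring of `S = End_R(M)` to the opposite ring of
the endomorphism ring of the completion of `M`, sending `f` to `id ⊗ f`. -/
def endToCompl (R : Type u) (M : Type v) [CommRing R] [IsLocalRing R] [AddCommGroup M]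
    [Module R M] :
    (Module.End R M)ᵐᵒᵖ →+* (Module.End (RHat R) (MHat R M))ᵐᵒᵖ :=
  RingHom.op (Module.End.baseChangeHom R (RHat R) M).toRingHom

/-- The right `S`-module `V` attached to a direct summand `L` of the completion of `M`: the
radical factor `Q / Q J(Ŝ)` of the right `Ŝ`-module `Q = Hom(M̂, L)`, where `Ŝ = End(M̂)`,
with scalars restricted along `S → Ŝ`. -/
def SimpleMod (R : Type u) (M : Type v) (L : Type w) [CommRing R] [IsLocalRing R]
    [AddCommGroup M] [Module R M] [AddCommGroup L] [Module (RHat R) L] : Type (max u v w) :=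
  HomTop (RHat R) (MHat R M) L

section

variable (R : Type u) (M : Type v) (L : Type w) [CommRing R] [IsLocalRing R]
    [AddCommGroup M] [Module R M] [AddCommGroup L] [Module (RHat R) L]

instance : AddCommGroup (SimpleMod R M L) :=
  inferInstanceAs (AddCommGroup (HomTop (RHat R) (MHat R M) L))

instance : Module (Module.End R M)ᵐᵒᵖ (SimpleMod R M L) :=
  Module.compHom (HomTop (RHat R) (MHat R M) L) (endToCompl R M)

end

/-- The `i`-th entry is `dim_{D_i} Hom_S(V_i, Q / Q J(S))`, where `S = End_R(M)`,
`Q = Hom_R(M, X)`, `V_i` is the simple right `S`-module attached to `L i`, and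
`D_i = End_S(V_i)`. -/
def dimVec (R : Type u) (M : Type v) {s : ℕ} (L : Fin s → Type w) [CommRing R] [IsLocalRing R]
    [AddCommGroup M] [Module R M] [∀ i, AddCommGroup (L i)] [∀ i, Module (RHat R) (L i)]
    (X : Type v) [AddCommGroup X] [Module R X] : Fin s → ℕ∞ :=
  fun i => homDim (Module.End R M)ᵐᵒᵖ (SimpleMod R M (L i)) (HomTop R M X)

/-! ### Invariance under isomorphism -/

/-- Composition with an isomorphism, as an isomorphism of right `End_A(N)`-modules. -/
def homModCongr (A : Type u) (N : Type v) {X Y : Type w} [Ring A] [AddCommGroup N] [Module A N]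
    [AddCommGroup X] [Module A X] [AddCommGroup Y] [Module A Y] (e : X ≃ₗ[A] Y) :
    HomMod A N X ≃ₗ[(Module.End A N)ᵐᵒᵖ] HomMod A N Y where
  toFun f := e.toLinearMap ∘ₗ (f : N →ₗ[A] X)
  invFun f := e.symm.toLinearMap ∘ₗ (f : N →ₗ[A] Y)
  map_add' f g := LinearMap.comp_add (f : N →ₗ[A] X) g e.toLinearMap
  map_smul' _ _ := rfl
  left_inv f := LinearMap.ext fun m => e.symm_apply_apply (show X from DFunLike.coe (F := N →ₗ[A] X) f m)
  right_inv f := LinearMap.ext fun m => e.apply_symm_apply (show Y from DFunLike.coe (F := N →ₗ[A] Y) f m)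

theorem homDim_congr (T : Type u) (V : Type v) {W W' : Type w} [Ring T] [AddCommGroup V]
    [Module T V] [AddCommGroup W] [Module T W] [AddCommGroup W'] [Module T W'] (e : W ≃ₗ[T] W') :
    homDim T V W = homDim T V W' := by
  unfold homDim
  rw [(homModCongr T V e).rank_eq]

theorem nonempty_homTop_congr (A : Type u) (N : Type v) {X Y : Type w} [Ring A]
    [AddCommGroup N] [Module A N] [AddCommGroup X] [Module A X] [AddCommGroup Y] [Module A Y]
    (e : X ≃ₗ[A] Y) : Nonempty (HomTop A N X ≃ₗ[(Module.End A N)ᵐᵒᵖ] HomTop A N Y) := by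
  refine ⟨Submodule.Quotient.equiv _ _ (homModCongr A N e) ?_⟩
  rw [Submodule.map_smul'', Submodule.map_top]
  congr 1
  exact LinearEquiv.range _

/-- The map `D_M : V*(M) → (ℕ ∪ {∞})^s` sending the class of `X` to the dimension vector of
the right `S`-module `Hom_R(M, X)`. -/
def DMap (R : Type u) (M : Type v) {s : ℕ} (L : Fin s → Type w) [CommRing R] [IsLocalRing R]
    [AddCommGroup M] [Module R M] [∀ i, AddCommGroup (L i)] [∀ i, Module (RHat R) (L i)] :
    VStar R M → Fin s → ℕ∞ :=
  Quotient.lift (fun X => dimVec R M L X.1) (by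
    rintro X Y ⟨e⟩
    obtain ⟨E⟩ := nonempty_homTop_congr R M e
    exact funext fun i => homDim_congr _ _ E)

/-- The rank of `L` at the prime `P`: the dimension of `L ⊗ A_P` over `A_P`. -/
def rankAt {A : Type u} [CommRing A] (P : Ideal A) [P.IsPrime] (L : Type w) [AddCommGroup L]
    [Module A L] : ℕ :=
  Module.finrank (Localization.AtPrime P) (Localization.AtPrime P ⊗[A] L)

end LocalAdd

end

noncomputable section

namespace LocalAdd

universe w'

/-! ### The Jacobson radical through units -/

/-! Fix a nonzero `r` in the maximal ideal. Since `R` is a one-dimensional domain, `R̂ = R + r^t R̂`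
for every `t`, and an ideal of `R̂` lying in no minimal prime contains a power of `r`. Flatness
carries the first fact over to Hom modules: a map `M̂ → X̂` is a base change plus `r` times a map,
and multiples of `r` are radical. So `S` is dense in `Ŝ` modulo `J(Ŝ)`, and `Hom_R(M, X)` and
`Hom(M̂, X̂)` have the same radical factor, or top (`nonempty_homTop_linearEquiv`). The `L i` have
local endomorphism rings, so the `V_i` are simple and pairwise non-isomorphic; every top is a direct
sum of them, and the dimension vector records the multiplicities.

Necessity. Let `Y` be a direct sum of copies of the `L i` with the same top as `X̂`. The isomorphism
of tops and its inverse lift to module maps in both directions, which by Nakayama stay injective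
after every tensor product (`exists_lTensor_injective`). No isomorphism `X̂ ≅ Y` is needed: the
ranks at each minimal prime already agree. That of `Y` is the weighted sum of the `x i`, and that of
`X̂` is the rank of `X` over `R`, the same at every minimal prime (`toENat_rank_baseChange`).

Sufficiency. Let `N` be the direct sum of `x i` copies of each `L i`. Equality of the ranks lets
bases at the minimal primes be glued into one independent family `v`; the elements of `N` with a
nonzero `R`-multiple in the `R`-span of `v` form a lattice `X` with `R̂ ⊗ X = N`
(`isBaseChange_saturatedSpan`). To place `X` in `Add M`, note that each finite subset of `N` lies in
a summand that is a retract of a finite power of `M̂`. The projection to it is approximated modulo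
`r` by an `R`-map `X → M^k` (`exists_approx_hom`), a left inverse on a given finitely generated
submodule descends by faithful flatness (`exists_local_splitting`), and a countably generated module
with such local splittings is a retract of a direct sum of copies of `M`
(`exists_retract_of_locally_split`). -/

theorem mem_jacobson_iff_isUnit {A : Type*} [Ring A] {x : A} :
    x ∈ Ring.jacobson A ↔ ∀ y, IsUnit (1 + y * x) := by
  rw [← Ideal.jacobson_bot, Ideal.mem_jacobson_iff]
  constructor
  · intro h
    have key : ∀ y, ∃ z, z * (1 + y * x) = 1 := by
      intro y
      obtain ⟨z, hz⟩ := h y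
      refine ⟨z, ?_⟩
      have hz' : z * y * x + z - 1 = 0 := hz
      rw [mul_add, mul_one, ← mul_assoc, add_comm]
      exact sub_eq_zero.mp hz'
    intro y
    obtain ⟨z, hz⟩ := key y
    -- The left inverse `z = 1 - z y x` has again the form `1 + y' x`, so it has a left inverse too
    -- and is therefore a unit.
    obtain ⟨t, ht⟩ := key (-(z * y))
    have hz2 : 1 + -(z * y) * x = z := by
      have : z + z * (y * x) = 1 := by rw [← hz, mul_add, mul_one]
      rw [neg_mul, mul_assoc, ← this]; abel
    rw [hz2] at ht
    have : t = 1 + y * x := by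
      calc t = t * (z * (1 + y * x)) := by rw [hz, mul_one]
        _ = 1 + y * x := by rw [← mul_assoc, ht, one_mul]
    exact ⟨⟨1 + y * x, z, by rw [← this]; exact ht, hz⟩, rfl⟩
  · intro h y
    obtain ⟨w, hw⟩ := h y
    refine ⟨↑w⁻¹, ?_⟩
    have : (↑w⁻¹ : A) * (1 + y * x) = 1 := by rw [← hw]; simp
    rw [mul_add, mul_one, ← mul_assoc] at this
    have h0 : (↑w⁻¹ : A) * y * x + ↑w⁻¹ - 1 = 0 := by rw [← this]; abel
    rw [h0]
    exact Submodule.zero_mem _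

/-- Jacobson's formula: the inverse of `1 + yx` is `1 - y (1 + xy)⁻¹ x`. -/
theorem isUnit_one_add_mul_comm {A : Type*} [Ring A] {x y : A} (h : IsUnit (1 + x * y)) :
    IsUnit (1 + y * x) := by
  obtain ⟨u, hu⟩ := h
  have h1 : (1 + x * y) * ↑u⁻¹ = 1 := by rw [← hu]; simp
  have h2 : ↑u⁻¹ * (1 + x * y) = 1 := by rw [← hu]; simp
  refine ⟨⟨1 + y * x, 1 - y * ↑u⁻¹ * x, ?_, ?_⟩, rfl⟩
  · calc (1 + y * x) * (1 - y * ↑u⁻¹ * x)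
        = 1 + y * x - y * ((1 + x * y) * ↑u⁻¹) * x := by noncomm_ring
      _ = 1 := by rw [h1]; noncomm_ring
  · calc (1 - y * ↑u⁻¹ * x) * (1 + y * x)
        = 1 + y * x - y * (↑u⁻¹ * (1 + x * y)) * x := by noncomm_ring
      _ = 1 := by rw [h2]; noncomm_ring

/-- Left-right symmetry of the radical, needed because right `S`-modules are modules over the
opposite ring. -/
theorem op_mem_jacobson_iff {A : Type*} [Ring A] {x : A} :
    MulOpposite.op x ∈ Ring.jacobson Aᵐᵒᵖ ↔ x ∈ Ring.jacobson A := by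
  rw [mem_jacobson_iff_isUnit, mem_jacobson_iff_isUnit]
  constructor
  · intro h y
    have := h (MulOpposite.op y)
    rw [← MulOpposite.op_mul, ← MulOpposite.op_one, ← MulOpposite.op_add,
      isUnit_op] at this
    exact isUnit_one_add_mul_comm this
  · intro h y
    have := isUnit_one_add_mul_comm (h y.unop)
    rw [← isUnit_op] at this
    simpa using this

/-- Nakayama's lemma for finite systems of linear equations with coefficients in the radical. -/
theorem eq_zero_of_eq_sum_jacobson {A E : Type*} [Ring A] [AddCommGroup E] [Module A E]
    {κ : Type*} [Fintype κ] (α : κ → κ → A) (hα : ∀ i j, α i j ∈ Ring.jacobson A) (y : κ → E)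
    (h : ∀ i, y i = ∑ j, α i j • y j) (i : κ) : y i = 0 := by
  have hfg : (Submodule.span A (Set.range y)).FG := Submodule.fg_span (Set.finite_range y)
  have hbot := hfg.eq_bot_of_le_jacobson_smul (by
    rw [Submodule.span_le]
    rintro _ ⟨i, rfl⟩
    rw [h i]
    exact Submodule.sum_mem _ fun j _ =>
      Submodule.smul_mem_smul (hα i j) (Submodule.subset_span ⟨j, rfl⟩))
  have := Submodule.subset_span (R := A) (Set.mem_range_self (f := y) i)
  rw [hbot] at this
  exact this

/-! ### Functoriality of the radical factor -/

section HomMod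

variable (A : Type u) (Q : Type v) [Ring A] [AddCommGroup Q] [Module A Q]

/-- The radical of the right module `Hom_A(Q, X)`. -/
abbrev homRad (X : Type w) [AddCommGroup X] [Module A X] :
    Submodule (Module.End A Q)ᵐᵒᵖ (HomMod A Q X) :=
  Ring.jacobson (Module.End A Q)ᵐᵒᵖ • ⊤

variable {X : Type w} {Y : Type w'} [AddCommGroup X] [Module A X] [AddCommGroup Y] [Module A Y]

/-- Postcomposition as a map of right modules. -/
def homMap (f : X →ₗ[A] Y) : HomMod A Q X →ₗ[(Module.End A Q)ᵐᵒᵖ] HomMod A Q Y where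
  toFun h := f ∘ₗ (h : Q →ₗ[A] X)
  map_add' g h := LinearMap.comp_add (g : Q →ₗ[A] X) h f
  map_smul' _ _ := rfl

/-- A linear map as an element of the right module `Hom_A(Q, X)`. -/
def toHomMod : (Q →ₗ[A] X) →+ HomMod A Q X := AddMonoidHom.id _

/-- The linear map underlying an element of the right module `Hom_A(Q, X)`. -/
def ofHomMod : HomMod A Q X →+ (Q →ₗ[A] X) := AddMonoidHom.id _

variable {A Q}

theorem smul_toHomMod (s : Module.End A Q) (h : Q →ₗ[A] X) :
    MulOpposite.op s • toHomMod A Q h = toHomMod A Q (h ∘ₗ s) := rfl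

theorem homRad_le_comap (f : X →ₗ[A] Y) :
    homRad A Q X ≤ (homRad A Q Y).comap (homMap A Q f) := by
  rw [← Submodule.map_le_iff_le_comap, Submodule.map_smul'']
  exact Submodule.smul_mono le_rfl le_top

theorem comp_mem_homRad {s : Module.End A Q} (hs : s ∈ Ring.jacobson (Module.End A Q))
    (h : Q →ₗ[A] X) : toHomMod A Q (h ∘ₗ s) ∈ homRad A Q X := by
  rw [← smul_toHomMod]
  exact Submodule.smul_mem_smul (op_mem_jacobson_iff.mpr hs) trivial

theorem comp_mem_jacobson {h : Q →ₗ[A] X} (hh : toHomMod A Q h ∈ homRad A Q X) (q : X →ₗ[A] Q) :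
    q ∘ₗ h ∈ Ring.jacobson (Module.End A Q) := by
  have key : ∀ z ∈ homRad A Q X, ∀ h : Q →ₗ[A] X, z = toHomMod A Q h →
      q ∘ₗ h ∈ Ring.jacobson (Module.End A Q) := by
    intro z hz
    induction hz using Submodule.smul_induction_on' with
    | smul r hr n hn =>
      rintro h rfl
      obtain ⟨s, rfl⟩ : ∃ s, r = MulOpposite.op s := ⟨r.unop, rfl⟩
      have := op_mem_jacobson_iff.mp hr
      exact (Ring.jacobson (Module.End A Q)).mul_mem_left (q ∘ₗ (n : Q →ₗ[A] X)) this
    | add x hx y hy ihx ihy =>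
      rintro h hxy
      have hxy' : h = (show Q →ₗ[A] X from x) + (show Q →ₗ[A] X from y) := hxy.symm
      rw [hxy', LinearMap.comp_add]
      exact add_mem (ihx _ rfl) (ihy _ rfl)
  exact key _ hh _ rfl

/-- If `L` is a direct summand of `Q`, a map `Q → L` is in the radical as soon as all its
composites with maps `L → Q` are. -/
theorem mem_homRad_of_forall {L : Type*} [AddCommGroup L] [Module A L] {σ : L →ₗ[A] Q}
    {τ : Q →ₗ[A] L} (hστ : τ ∘ₗ σ = LinearMap.id) {h : Q →ₗ[A] L}
    (H : ∀ q : L →ₗ[A] Q, h ∘ₗ q ∈ Ring.jacobson (Module.End A L)) :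
    toHomMod A Q h ∈ homRad A Q L := by
  have h1 : σ ∘ₗ h ∈ Ring.jacobson (Module.End A Q) := by
    rw [mem_jacobson_iff_isUnit]
    intro y
    have hu : IsUnit (1 + (h ∘ₗ (y ∘ₗ σ) : Module.End A L)) := by
      simpa using mem_jacobson_iff_isUnit.mp (H (y ∘ₗ σ)) 1
    obtain ⟨w, hw⟩ := hu
    have hw1 : ∀ x, x = (↑w⁻¹ : Module.End A L) (x + h (y (σ x))) := by
      intro x
      have : ((↑w⁻¹ : Module.End A L) * (w : Module.End A L)) x = x := by simp
      rw [hw] at this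
      simpa using this.symm
    have hw2 : ∀ x, (↑w⁻¹ : Module.End A L) x + h (y (σ ((↑w⁻¹ : Module.End A L) x))) = x := by
      intro x
      have : ((w : Module.End A L) * (↑w⁻¹ : Module.End A L)) x = x := by simp
      rw [hw] at this
      simpa using this
    -- The same formula for the inverse, with the two factors now passing between `Q` and `L`.
    refine ⟨⟨1 + y * (σ ∘ₗ h), 1 - (y ∘ₗ σ) ∘ₗ (↑w⁻¹ : Module.End A L) ∘ₗ h, ?_, ?_⟩, rfl⟩
    · ext x
      have := hw2 (h x)
      simp only [Module.End.mul_apply, LinearMap.add_apply, LinearMap.sub_apply,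
        Module.End.one_apply, LinearMap.comp_apply, map_sub]
      have h3 := congrArg (fun z => y (σ z)) this
      simp only [map_add] at h3
      rw [← h3]; abel
    · ext x
      have := hw1 (h x)
      simp only [Module.End.mul_apply, LinearMap.add_apply, LinearMap.sub_apply,
        Module.End.one_apply, LinearMap.comp_apply, map_add]
      have h3 := congrArg (fun z => y (σ z)) this
      simp only [map_add] at h3
      rw [← sub_eq_zero] at h3 ⊢
      rw [← h3]; abel
  have := comp_mem_homRad h1 τ
  rwa [← LinearMap.comp_assoc, hστ, LinearMap.id_comp] at this

end HomMod

/-! ### The dimension vector of a semisimple module -/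

/-- By Schur, only the summands isomorphic to `V` receive nonzero maps from it; one chosen
isomorphism for each of them gives a basis of `Hom(V, W)` over the opposite of the division ring
`End V`. -/
theorem homDim_of_linearEquiv_dfinsupp {T : Type u} {V : Type v} {W : Type w} [Ring T]
    [AddCommGroup V] [Module T V] [AddCommGroup W] [Module T W] [IsSimpleModule T V]
    {Λ : Type*} {S : Λ → Type*} [∀ a, AddCommGroup (S a)] [∀ a, Module T (S a)]
    [∀ a, IsSimpleModule T (S a)] (e : W ≃ₗ[T] Π₀ a, S a) :
    homDim T V W = Cardinal.toENat (Cardinal.mk {a // Nonempty (V ≃ₗ[T] S a)}) := by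
  classical
  set Λ' := {a // Nonempty (V ≃ₗ[T] S a)} with hΛ'
  let φ : (a : Λ') → V ≃ₗ[T] S a.1 := fun a => a.2.some
  let b : Λ' → HomMod T V W := fun a =>
    toHomMod T V (e.symm.toLinearMap ∘ₗ DFinsupp.lsingle a.1 ∘ₗ (φ a).toLinearMap)
  have happ : ∀ (a : Λ') (c : (Module.End T V)ᵐᵒᵖ) (x : V),
      (ofHomMod T V (c • b a)) x = e.symm (DFinsupp.single a.1 (φ a (c.unop x))) :=
    fun _ _ _ => rfl
  have hsum : ∀ (F : Finset Λ') (c : Λ' → (Module.End T V)ᵐᵒᵖ) (x : V),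
      e ((ofHomMod T V (∑ a ∈ F, c a • b a)) x) =
        ∑ a ∈ F, DFinsupp.single a.1 (φ a ((c a).unop x)) := by
    intro F c x
    rw [map_sum, LinearMap.sum_apply, map_sum]
    exact Finset.sum_congr rfl fun a _ => by rw [happ, LinearEquiv.apply_symm_apply]
  have hcoord : ∀ (F : Finset Λ') (c : Λ' → (Module.End T V)ᵐᵒᵖ) (x : V) (a : Λ'), a ∈ F →
      e ((ofHomMod T V (∑ a ∈ F, c a • b a)) x) a.1 = φ a ((c a).unop x) := by
    intro F c x a ha
    rw [hsum, DFinsupp.finsetSum_apply, Finset.sum_eq_single a]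
    · simp
    · intro a' _ hne
      exact DFinsupp.single_eq_of_ne fun h => hne (Subtype.ext h.symm)
    · exact fun h => absurd ha h
  have hli : LinearIndependent (Module.End T V)ᵐᵒᵖ b := by
    rw [linearIndependent_iff']
    intro F c h a ha
    apply MulOpposite.unop_injective
    ext x
    have h1 := hcoord F c x a ha
    rw [h] at h1
    have h2 : e ((ofHomMod T V ((0 : HomMod T V W))) x) = 0 := e.map_zero
    rw [h2] at h1
    exact (φ a).injective (by rw [← h1]; simp)
  have hsp : ⊤ ≤ Submodule.span (Module.End T V)ᵐᵒᵖ (Set.range b) := by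
    intro f _
    -- A nonzero `x₀` generates `V`, so a map is determined by its value at `x₀`, and that value has
    -- finite support. This makes the spanning sum finite.
    obtain ⟨x₀, hx₀⟩ := @exists_ne V (IsSimpleModule.nontrivial T V) 0
    let F : Finset Λ' := (e ((ofHomMod T V f) x₀)).support.subtype _
    let c : Λ' → (Module.End T V)ᵐᵒᵖ := fun a => MulOpposite.op
      ((φ a).symm.toLinearMap ∘ₗ DFinsupp.lapply a.1 ∘ₗ e.toLinearMap ∘ₗ
        (ofHomMod T V f))
    have hf : f = ∑ a ∈ F, c a • b a := by
      have hx : (ofHomMod T V f) x₀ = (ofHomMod T V (∑ a ∈ F, c a • b a)) x₀ := by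
        apply e.injective
        ext a
        by_cases hc : e ((ofHomMod T V f) x₀) a = 0
        · rw [hc, hsum, DFinsupp.finsetSum_apply, Finset.sum_eq_zero]
          intro a' ha'
          apply DFinsupp.single_eq_of_ne
          rintro rfl
          exact (DFinsupp.mem_support_toFun _ _).mp (Finset.mem_subtype.mp ha') hc
        · have hiso : Nonempty (V ≃ₗ[T] S a) := by
            rcases LinearMap.bijective_or_eq_zero
              (DFinsupp.lapply a ∘ₗ e.toLinearMap ∘ₗ (ofHomMod T V f)) with h | h
            · exact ⟨LinearEquiv.ofBijective _ h⟩
            · exact absurd (LinearMap.congr_fun h x₀) hc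
          rw [hcoord F c x₀ ⟨a, hiso⟩
            (Finset.mem_subtype.mpr ((DFinsupp.mem_support_toFun _ _).mpr hc))]
          simp [c]
      have : (ofHomMod T V f) = (ofHomMod T V (∑ a ∈ F, c a • b a)) := by
        apply LinearMap.ext
        intro x
        obtain ⟨t, rfl⟩ := IsSimpleModule.toSpanSingleton_surjective T hx₀ x
        rw [LinearMap.toSpanSingleton_apply, map_smul, map_smul, hx]
      exact this
    rw [hf]
    exact Submodule.sum_mem _ fun a _ => Submodule.smul_mem _ _ (Submodule.subset_span ⟨a, rfl⟩)
  let B := Module.Basis.mk hli hsp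
  have : StrongRankCondition (Module.End T V)ᵐᵒᵖ := by
    let _ := Module.End.instDivisionRing (R := T) (M := V)
    infer_instance
  unfold homDim
  have := congrArg Cardinal.toENat B.mk_eq_rank
  simpa using this.symm

/-! ### Radical factors over the completion -/

section SimpleMod

variable {R : Type u} [CommRing R] [IsLocalRing R] {M : Type v} [AddCommGroup M] [Module R M]
  {X : Type w} [AddCommGroup X] [Module (RHat R) X] {Y : Type w'} [AddCommGroup Y]
  [Module (RHat R) Y]

variable (R M X) in
/-- The class of a homomorphism in the radical factor. -/
def mkTop : (MHat R M →ₗ[RHat R] X) →+ SimpleMod R M X :=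
  (Submodule.mkQ (homRad (RHat R) (MHat R M) X)).toAddMonoidHom.comp
    (toHomMod (RHat R) (MHat R M))

theorem mkTop_surjective : Function.Surjective (mkTop R M X) :=
  Submodule.mkQ_surjective (homRad (RHat R) (MHat R M) X)

theorem mkTop_eq_zero_iff {h : MHat R M →ₗ[RHat R] X} :
    mkTop R M X h = 0 ↔ toHomMod (RHat R) (MHat R M) h ∈ homRad (RHat R) (MHat R M) X :=
  Submodule.Quotient.mk_eq_zero _

theorem mkTop_eq_iff {h h' : MHat R M →ₗ[RHat R] X} :
    mkTop R M X h = mkTop R M X h' ↔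
      toHomMod (RHat R) (MHat R M) (h - h') ∈ homRad (RHat R) (MHat R M) X := by
  rw [← mkTop_eq_zero_iff, map_sub, sub_eq_zero]

theorem smul_mkTop (t : Module.End R M) (h : MHat R M →ₗ[RHat R] X) :
    MulOpposite.op t • mkTop R M X h = mkTop R M X (h ∘ₗ t.baseChange (RHat R)) := rfl

variable (R M) in
/-- Functoriality of the radical factor. -/
def topMap (f : X →ₗ[RHat R] Y) :
    SimpleMod R M X →ₗ[(Module.End R M)ᵐᵒᵖ] SimpleMod R M Y where
  toFun := Submodule.mapQ (homRad (RHat R) (MHat R M) X) (homRad (RHat R) (MHat R M) Y)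
    (homMap (RHat R) (MHat R M) f) (homRad_le_comap f)
  map_add' := map_add _
  map_smul' c x := (Submodule.mapQ (homRad (RHat R) (MHat R M) X)
    (homRad (RHat R) (MHat R M) Y) (homMap (RHat R) (MHat R M) f) (homRad_le_comap f)).map_smul
      (endToCompl R M c) x

theorem topMap_mkTop (f : X →ₗ[RHat R] Y) (h : MHat R M →ₗ[RHat R] X) :
    topMap R M f (mkTop R M X h) = mkTop R M Y (f ∘ₗ h) := rfl

variable (R M) in
/-- Every endomorphism of the completion is congruent modulo the radical to one coming from an
endomorphism of `M`. -/
def EndDense : Prop :=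
  ∀ s : Module.End (RHat R) (MHat R M), ∃ t : Module.End R M,
    s - t.baseChange (RHat R) ∈ Ring.jacobson (Module.End (RHat R) (MHat R M))

/-- On radical factors, precomposition with any endomorphism of `M̂` is the action of an element of
`S`; hence `S`-linear maps between tops respect the whole of `Ŝ`. -/
theorem mkTop_comp_of_sub_mem {s : Module.End (RHat R) (MHat R M)} {t : Module.End R M}
    (ht : s - t.baseChange (RHat R) ∈ Ring.jacobson (Module.End (RHat R) (MHat R M)))
    (h : MHat R M →ₗ[RHat R] X) :
    mkTop R M X (h ∘ₗ s) = MulOpposite.op t • mkTop R M X h := by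
  rw [smul_mkTop, mkTop_eq_iff, ← LinearMap.comp_sub]
  exact comp_mem_homRad ht h

/-- The radical factor attached to a summand with local endomorphism ring is simple. -/
theorem isSimpleModule_simpleMod (hd : EndDense R M) [IsLocalRing (Module.End (RHat R) X)]
    {σ : X →ₗ[RHat R] MHat R M} {τ : MHat R M →ₗ[RHat R] X} (hτσ : τ ∘ₗ σ = LinearMap.id) :
    IsSimpleModule (Module.End R M)ᵐᵒᵖ (SimpleMod R M X) := by
  rw [isSimpleModule_iff_toSpanSingleton_surjective]
  constructor
  · refine ⟨⟨mkTop R M X τ, 0, fun h => ?_⟩⟩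
    rw [mkTop_eq_zero_iff] at h
    -- If `τ` were radical, the idempotent `σ ∘ τ` would lie in the Jacobson radical, hence vanish.
    have h1 := mem_jacobson_iff_isUnit.mp (comp_mem_jacobson h σ) (-1)
    have h2 : (1 + -1 * (σ ∘ₗ τ) : Module.End (RHat R) (MHat R M)) * (σ ∘ₗ τ) = 0 := by
      have h3 : ∀ x, τ (σ x) = x := fun x => LinearMap.congr_fun hτσ x
      ext1
      ext x
      simp [h3]
    have h4 : σ ∘ₗ τ = 0 := h1.mul_right_eq_zero.mp h2
    have h5 : (1 : Module.End (RHat R) X) = 0 := by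
      have h3 : ∀ x, τ (σ x) = x := fun x => LinearMap.congr_fun hτσ x
      ext x
      have := congrArg τ (LinearMap.congr_fun h4 (σ x))
      simpa [h3] using this
    exact one_ne_zero h5
  · intro x hx y
    obtain ⟨h, rfl⟩ := mkTop_surjective x
    obtain ⟨h', rfl⟩ := mkTop_surjective y
    have : ∃ q : X →ₗ[RHat R] MHat R M, IsUnit (h ∘ₗ q : Module.End (RHat R) X) := by
      by_contra hcon
      push Not at hcon
      refine hx (mkTop_eq_zero_iff.mpr (mem_homRad_of_forall hτσ fun q => ?_))
      rw [mem_jacobson_iff_isUnit]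
      intro y
      refine isUnit_one_add_mul_comm (x := h ∘ₗ q) ?_
      rcases IsLocalRing.isUnit_or_isUnit_of_add_one
        (a := 1 + (h ∘ₗ q : Module.End (RHat R) X) * y)
        (b := -((h ∘ₗ q : Module.End (RHat R) X) * y)) (by abel) with hu | hu
      · exact hu
      · exact absurd ((IsUnit.neg_iff _).mp hu) (hcon (q ∘ₗ y))
    obtain ⟨q, u, hu⟩ := this
    -- This endomorphism of `M̂` carries `h` to `h'` under precomposition; density replaces it by an
    -- element of `S`.
    obtain ⟨t, ht⟩ := hd (q ∘ₗ (↑u⁻¹ : Module.End (RHat R) X) ∘ₗ h')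
    refine ⟨MulOpposite.op t, ?_⟩
    rw [LinearMap.toSpanSingleton_apply, ← mkTop_comp_of_sub_mem ht]
    congr 1
    have : (h ∘ₗ q) * (↑u⁻¹ : Module.End (RHat R) X) = 1 := by rw [← hu]; simp
    calc _ = ((h ∘ₗ q) * (↑u⁻¹ : Module.End (RHat R) X)) ∘ₗ h' := rfl
      _ = h' := by rw [this]; rfl

end SimpleMod

/-! ### Lifting morphisms of radical factors. -/

section Lift

variable {R : Type u} [CommRing R] [IsLocalRing R] {M : Type v} [AddCommGroup M] [Module R M]

theorem exists_finset_eq_sum_single {ι : Type*} [DecidableEq ι] {Y : ι → Type*}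
    [∀ i, AddCommGroup (Y i)] {κ : Type*} (S : Finset κ) (y : κ → Π₀ i, Y i) :
    ∃ F : Finset ι, ∀ a ∈ S, y a = ∑ t ∈ F, (DFinsupp.single t (y a t) : Π₀ i, Y i) := by
  classical
  refine ⟨S.biUnion fun a => (y a).support, fun a ha => ?_⟩
  ext t
  rw [DFinsupp.finsetSum_apply]
  by_cases ht : t ∈ S.biUnion fun a => (y a).support
  · rw [Finset.sum_eq_single t]
    · simp
    · intro b _ hb
      exact DFinsupp.single_eq_of_ne hb.symm
    · exact fun h => absurd ht h
  · rw [Finset.sum_eq_zero]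
    · by_contra h0
      exact ht (Finset.mem_biUnion.mpr ⟨a, ha, (DFinsupp.mem_support_toFun _ _).mpr h0⟩)
    · intro b hb
      apply DFinsupp.single_eq_of_ne
      rintro rfl
      exact ht hb

theorem exists_finset_eq_sum_lsingle {A : Type*} {Q : Type*} [Ring A] [AddCommGroup Q]
    [Module A Q] [Module.Finite A Q] {ι : Type*} [DecidableEq ι] {Y : ι → Type*}
    [∀ i, AddCommGroup (Y i)] [∀ i, Module A (Y i)] (g : Q →ₗ[A] Π₀ i, Y i) :
    ∃ F : Finset ι, g = ∑ t ∈ F, DFinsupp.lsingle t ∘ₗ DFinsupp.lapply t ∘ₗ g := by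
  obtain ⟨S, hS⟩ := Module.Finite.fg_top (R := A) (M := Q)
  obtain ⟨F, hF⟩ := exists_finset_eq_sum_single S fun x => g x
  refine ⟨F, LinearMap.ext_on hS fun x hx => ?_⟩
  rw [LinearMap.sum_apply]
  exact hF x hx

/-- `X` is a direct summand of a direct sum of copies of `Q`. -/
def IsSummandOfCopies (A : Type*) (Q X : Type*) [Ring A] [AddCommGroup Q] [Module A Q]
    [AddCommGroup X] [Module A X] (ι : Type*) : Prop :=
  ∃ (e : X →ₗ[A] Π₀ _ : ι, Q) (p : (Π₀ _ : ι, Q) →ₗ[A] X), p ∘ₗ e = LinearMap.id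

/-- Morphisms between radical factors lift. -/
theorem exists_topMap_eq [Module.Finite R M] (hd : EndDense R M)
    {X : Type w} [AddCommGroup X] [Module (RHat R) X] {Y : Type w'} [AddCommGroup Y]
    [Module (RHat R) Y] {ι : Type*} (hX : IsSummandOfCopies (RHat R) (MHat R M) X ι)
    (θ : SimpleMod R M X →ₗ[(Module.End R M)ᵐᵒᵖ] SimpleMod R M Y) :
    ∃ f : X →ₗ[RHat R] Y, topMap R M f = θ := by
  classical
  obtain ⟨e, p, hpe⟩ := hX
  -- Lift the images of the coordinate maps `M̂ → X` one at a time. They assemble on the direct sum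
  -- of copies of `M̂`, and `e` restricts the result to `X`.
  choose f' hf' using fun t : ι => mkTop_surjective (R := R) (M := M) (X := Y)
    (θ (mkTop R M X (p ∘ₗ DFinsupp.lsingle (M := fun _ => MHat R M) t)))
  refine ⟨DFinsupp.lsum ℕ f' ∘ₗ e, ?_⟩
  ext x
  obtain ⟨h, rfl⟩ := mkTop_surjective x
  obtain ⟨F, hF⟩ := exists_finset_eq_sum_lsingle (e ∘ₗ h)
  choose s hs using fun t : ι => hd (DFinsupp.lapply t ∘ₗ e ∘ₗ h)
  have h1 : h = ∑ t ∈ F, (p ∘ₗ DFinsupp.lsingle (M := fun _ => MHat R M) t) ∘ₗ (DFinsupp.lapply t ∘ₗ e ∘ₗ h) := by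
    have := congrArg (fun g => p ∘ₗ g) hF
    simp only [← LinearMap.comp_assoc, hpe, LinearMap.id_comp] at this
    conv_lhs => rw [this]
    refine LinearMap.ext fun x => ?_
    simp
  have h2 : (DFinsupp.lsum ℕ f' ∘ₗ e) ∘ₗ h =
      ∑ t ∈ F, f' t ∘ₗ (DFinsupp.lapply t ∘ₗ e ∘ₗ h) := by
    rw [LinearMap.comp_assoc]
    conv_lhs => rw [hF]
    refine LinearMap.ext fun x => ?_
    simp
  rw [topMap_mkTop, h2]
  conv_rhs => rw [h1]
  rw [map_sum, map_sum, map_sum]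
  refine Finset.sum_congr rfl fun t _ => ?_
  rw [mkTop_comp_of_sub_mem (hs t), mkTop_comp_of_sub_mem (hs t), hf', map_smul]

end Lift

/-! ### Split injectivity modulo the radical -/

/-- A map which is split injective modulo the radical of `Q` remains injective after tensoring,
if the identity of its source factors locally through powers of `Q`. -/
theorem lTensor_injective_of_jacobson {B : Type*} [CommRing B] {Q X Y F : Type*} [AddCommGroup Q]
    [Module B Q] [AddCommGroup X] [Module B X] [AddCommGroup Y] [Module B Y] [AddCommGroup F]
    [Module B F] {ι : Type*} (hX : IsSummandOfCopies B Q X ι) (f : X →ₗ[B] Y) (g : Y →ₗ[B] X)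
    (H : ∀ (h : Q →ₗ[B] X) (q : X →ₗ[B] Q),
      q ∘ₗ (h - g ∘ₗ f ∘ₗ h) ∈ Ring.jacobson (Module.End B Q)) :
    Function.Injective (f.lTensor F) := by
  classical
  obtain ⟨e, p, hpe⟩ := hX
  rw [injective_iff_map_eq_zero]
  intro z hz
  obtain ⟨S, hS⟩ := TensorProduct.exists_finset z
  obtain ⟨κ, hκ⟩ := exists_finset_eq_sum_single S fun a => e a.2
  let U : ι → (Q →ₗ[B] X) := fun t => p ∘ₗ DFinsupp.lsingle (M := fun _ => Q) t
  let V : ι → (X →ₗ[B] Q) := fun t => DFinsupp.lapply t ∘ₗ e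
  have hUV : ∀ a ∈ S, ∑ t : κ, U t (V t a.2) = a.2 := by
    intro a ha
    have h1 := (hκ a ha).symm
    have h2 := congrArg p h1
    rw [map_sum] at h2
    rw [Finset.sum_coe_sort κ fun t => U t (V t a.2)]
    exact h2.trans (LinearMap.congr_fun hpe a.2)
  have hz1 : z = ∑ t : κ, (U t).lTensor F ((V t).lTensor F z) := by
    rw [hS]
    simp only [map_sum, LinearMap.lTensor_tmul]
    rw [Finset.sum_comm]
    refine Finset.sum_congr rfl fun a ha => ?_
    rw [← TensorProduct.tmul_sum, hUV a ha]
  -- With `End Q` acting on `F ⊗ Q`, the coordinates of `z` satisfy a finite linear system with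
  -- coefficients in the radical, so Nakayama makes them vanish.
  let _ : Module (Module.End B Q) (F ⊗[B] Q) :=
    Module.compHom _ (Module.End.lTensorAlgHom B Q F).toRingHom
  have hsmul : ∀ (s : Module.End B Q) (y : F ⊗[B] Q), s • y = s.lTensor F y := fun _ _ => rfl
  have hy := eq_zero_of_eq_sum_jacobson (A := Module.End B Q)
    (fun d c : κ => V d ∘ₗ (U c - g ∘ₗ f ∘ₗ U c)) (fun d c => H _ _)
    (fun c => (V c).lTensor F z) (fun d => by
      -- Since `f` kills `z` after tensoring, `1 - g f` fixes it; this is what puts the coefficients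
      -- in the radical.
      have h3 : z = (LinearMap.id - g ∘ₗ f).lTensor F z := by
        rw [LinearMap.lTensor_sub, LinearMap.sub_apply, LinearMap.lTensor_comp,
          LinearMap.comp_apply, hz, map_zero, sub_zero, LinearMap.lTensor_id, LinearMap.id_apply]
      conv_lhs => rw [h3, hz1]
      simp only [hsmul, map_sum]
      refine Finset.sum_congr rfl fun c _ => ?_
      simp only [← LinearMap.comp_apply, ← LinearMap.lTensor_comp]
      rfl)
  rw [hz1]
  simp [hy]

/-! ### Comparison and decomposition of modules through their radical factors. -/

section Tops

variable {R : Type u} [CommRing R] [IsLocalRing R] {M : Type v} [AddCommGroup M] [Module R M]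

theorem topMap_comp {X Y Z : Type*} [AddCommGroup X] [Module (RHat R) X] [AddCommGroup Y]
    [Module (RHat R) Y] [AddCommGroup Z] [Module (RHat R) Z] (g : Y →ₗ[RHat R] Z)
    (f : X →ₗ[RHat R] Y) : topMap R M (g ∘ₗ f) = topMap R M g ∘ₗ topMap R M f := by
  ext x
  obtain ⟨h, rfl⟩ := mkTop_surjective x
  rfl

theorem IsSummandOfCopies.of_retract {A : Type*} {Q X : Type*} [Ring A] [AddCommGroup Q]
    [Module A Q] [AddCommGroup X] [Module A X] {σ : X →ₗ[A] Q} {τ : Q →ₗ[A] X}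
    (h : τ ∘ₗ σ = LinearMap.id) : IsSummandOfCopies A Q X Unit := by
  classical
  refine ⟨DFinsupp.lsingle (M := fun _ => Q) () ∘ₗ σ, τ ∘ₗ DFinsupp.lapply (), ?_⟩
  ext x
  simpa using LinearMap.congr_fun h x

theorem IsSummandOfCopies.dfinsupp {A : Type*} {Q : Type*} [Ring A] [AddCommGroup Q]
    [Module A Q] {Λ : Type*} {X : Λ → Type*} [∀ a, AddCommGroup (X a)] [∀ a, Module A (X a)]
    (σ : ∀ a, X a →ₗ[A] Q) (τ : ∀ a, Q →ₗ[A] X a)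
    (h : ∀ a, τ a ∘ₗ σ a = LinearMap.id) : IsSummandOfCopies A Q (Π₀ a, X a) Λ := by
  refine ⟨DFinsupp.mapRange.linearMap σ, DFinsupp.mapRange.linearMap τ, ?_⟩
  ext x a
  simpa using LinearMap.congr_fun (h a) (x a)

theorem sub_mem_of_topMap_comp_eq_id {X Y : Type*} [AddCommGroup X] [Module (RHat R) X]
    [AddCommGroup Y] [Module (RHat R) Y] {f : X →ₗ[RHat R] Y} {g : Y →ₗ[RHat R] X}
    (h : topMap R M g ∘ₗ topMap R M f = LinearMap.id) (k : MHat R M →ₗ[RHat R] X)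
    (q : X →ₗ[RHat R] MHat R M) :
    q ∘ₗ (k - g ∘ₗ f ∘ₗ k) ∈ Ring.jacobson (Module.End (RHat R) (MHat R M)) := by
  refine comp_mem_jacobson (mkTop_eq_iff.mp ?_) q
  exact (LinearMap.congr_fun h (mkTop R M X k)).symm

/-- Modules with isomorphic radical factors embed purely into each other. -/
theorem exists_lTensor_injective [Module.Finite R M] (hd : EndDense R M)
    {X Y : Type*} [AddCommGroup X] [Module (RHat R) X] [AddCommGroup Y] [Module (RHat R) Y]
    {ι κ : Type*} (hX : IsSummandOfCopies (RHat R) (MHat R M) X ι)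
    (hY : IsSummandOfCopies (RHat R) (MHat R M) Y κ)
    (θ : SimpleMod R M X ≃ₗ[(Module.End R M)ᵐᵒᵖ] SimpleMod R M Y) :
    ∃ f : X →ₗ[RHat R] Y, ∀ (F : Type w) [AddCommGroup F] [Module (RHat R) F],
      Function.Injective (f.lTensor F) := by
  obtain ⟨f, hf⟩ := exists_topMap_eq hd hX θ.toLinearMap
  obtain ⟨g, hg⟩ := exists_topMap_eq hd hY θ.symm.toLinearMap
  refine ⟨f, fun F _ _ => lTensor_injective_of_jacobson hX f g fun h q => ?_⟩
  refine sub_mem_of_topMap_comp_eq_id ?_ h q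
  rw [hf, hg]
  ext x
  simp

/-- Otherwise locality makes `1 - u` a unit; it would induce both an automorphism and zero on a
nonzero simple top. -/
theorem isUnit_of_topMap_eq_id (hd : EndDense R M) {X : Type*} [AddCommGroup X]
    [Module (RHat R) X] [IsLocalRing (Module.End (RHat R) X)]
    {σ : X →ₗ[RHat R] MHat R M} {τ : MHat R M →ₗ[RHat R] X} (hτσ : τ ∘ₗ σ = LinearMap.id)
    {u : Module.End (RHat R) X} (hu : topMap R M u = LinearMap.id) : IsUnit u := by
  rcases IsLocalRing.isUnit_or_isUnit_of_add_one (a := u) (b := 1 - u) (by abel) with h | ⟨w, hw⟩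
  · exact h
  · exfalso
    have := isSimpleModule_simpleMod hd hτσ
    obtain ⟨x, hx⟩ := @exists_ne _ (IsSimpleModule.nontrivial (Module.End R M)ᵐᵒᵖ
      (SimpleMod R M X)) 0
    obtain ⟨h, rfl⟩ := mkTop_surjective x
    apply hx
    have h1 : (w : Module.End (RHat R) X) * (↑w⁻¹ : Module.End (RHat R) X) = 1 := by simp
    rw [hw] at h1
    have h2 : h = (↑w⁻¹ : Module.End (RHat R) X) ∘ₗ h -
        u ∘ₗ ((↑w⁻¹ : Module.End (RHat R) X) ∘ₗ h) := by
      refine LinearMap.ext fun x => ?_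
      simpa using (LinearMap.congr_fun h1 (h x)).symm
    rw [h2, map_sub, ← topMap_mkTop u, hu, LinearMap.id_apply, sub_self]

/-- Summands of `M̂` with local endomorphism rings are determined by their radical factors. -/
theorem nonempty_linearEquiv_of_simpleMod [Module.Finite R M] (hd : EndDense R M)
    {X Y : Type*} [AddCommGroup X] [Module (RHat R) X] [AddCommGroup Y] [Module (RHat R) Y]
    [IsLocalRing (Module.End (RHat R) X)] [IsLocalRing (Module.End (RHat R) Y)]
    {σ : X →ₗ[RHat R] MHat R M} {τ : MHat R M →ₗ[RHat R] X} (hτσ : τ ∘ₗ σ = LinearMap.id)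
    {σ' : Y →ₗ[RHat R] MHat R M} {τ' : MHat R M →ₗ[RHat R] Y} (hτσ' : τ' ∘ₗ σ' = LinearMap.id)
    (θ : SimpleMod R M X ≃ₗ[(Module.End R M)ᵐᵒᵖ] SimpleMod R M Y) :
    Nonempty (X ≃ₗ[RHat R] Y) := by
  obtain ⟨f, hf⟩ := exists_topMap_eq hd (.of_retract hτσ) θ.toLinearMap
  obtain ⟨g, hg⟩ := exists_topMap_eq hd (.of_retract hτσ') θ.symm.toLinearMap
  have h1 : IsUnit (g ∘ₗ f : Module.End (RHat R) X) :=
    isUnit_of_topMap_eq_id hd hτσ (by rw [topMap_comp, hf, hg]; ext x; simp)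
  have h2 : IsUnit (f ∘ₗ g : Module.End (RHat R) Y) :=
    isUnit_of_topMap_eq_id hd hτσ' (by rw [topMap_comp, hf, hg]; ext x; simp)
  rw [Module.End.isUnit_iff] at h1 h2
  exact ⟨LinearEquiv.ofBijective f ⟨Function.Injective.of_comp (f := g) h1.1,
    Function.Surjective.of_comp (g := g) h2.2⟩⟩

/-- The radical factor of a direct sum is the direct sum of the radical factors. -/
theorem nonempty_simpleMod_dfinsupp [Module.Finite R M] {Λ : Type*} {Y : Λ → Type*}
    [∀ a, AddCommGroup (Y a)] [∀ a, Module (RHat R) (Y a)] :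
    Nonempty (SimpleMod R M (Π₀ a, Y a) ≃ₗ[(Module.End R M)ᵐᵒᵖ] Π₀ a, SimpleMod R M (Y a)) := by
  classical
  let f : (Π₀ a, SimpleMod R M (Y a)) →ₗ[(Module.End R M)ᵐᵒᵖ] SimpleMod R M (Π₀ a, Y a) :=
    DFinsupp.lsum ℕ fun a => topMap R M (DFinsupp.lsingle a)
  refine ⟨(LinearEquiv.ofBijective f ⟨?_, ?_⟩).symm⟩
  · have hf : ∀ b, topMap R M (DFinsupp.lapply b) ∘ₗ f = DFinsupp.lapply b := by
      intro b
      ext a x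
      obtain ⟨h, rfl⟩ := mkTop_surjective x
      simp only [f, LinearMap.comp_apply, DFinsupp.lapply_apply, DFinsupp.lsingle_apply]
      have : (DFinsupp.lsum ℕ fun a => topMap R M (DFinsupp.lsingle (R := RHat R) (M := Y) a))
        (DFinsupp.single a (mkTop R M (Y a) h)) = topMap R M (DFinsupp.lsingle a)
          (mkTop R M (Y a) h) := DFinsupp.lsum_single _ _ _ _
      rw [this, topMap_mkTop, topMap_mkTop]
      rcases eq_or_ne a b with rfl | hab
      · rw [DFinsupp.single_eq_same]
        congr 1
        refine LinearMap.ext fun x => ?_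
        simp
      · rw [DFinsupp.single_eq_of_ne hab.symm]
        convert map_zero (mkTop R M (Y b)) using 2
        refine LinearMap.ext fun x => ?_
        simp [DFinsupp.single_eq_of_ne hab.symm]
    rw [injective_iff_map_eq_zero]
    intro y hy
    ext b
    have := LinearMap.congr_fun (hf b) y
    rw [LinearMap.comp_apply, hy, map_zero] at this
    exact this.symm
  · intro x
    obtain ⟨h, rfl⟩ := mkTop_surjective x
    obtain ⟨F, hF⟩ := exists_finset_eq_sum_lsingle h
    refine ⟨∑ t ∈ F, DFinsupp.single t (mkTop R M (Y t) (DFinsupp.lapply t ∘ₗ h)), ?_⟩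
    conv_rhs => rw [hF]
    rw [map_sum, map_sum]
    refine Finset.sum_congr rfl fun t _ => ?_
    have : f (DFinsupp.single t (mkTop R M (Y t) (DFinsupp.lapply t ∘ₗ h))) =
        topMap R M (DFinsupp.lsingle t) (mkTop R M (Y t) (DFinsupp.lapply t ∘ₗ h)) :=
      DFinsupp.lsum_single _ _ _ _
    rw [this, topMap_mkTop]

/-- Every radical factor is a direct sum of the simple modules attached to the summands of a
decomposition of `M̂`. -/
theorem exists_simpleMod_linearEquiv {s : ℕ} {L : Fin s → Type w} [∀ i, AddCommGroup (L i)]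
    [∀ i, Module (RHat R) (L i)]
    (hs : ∀ i, IsSimpleModule (Module.End R M)ᵐᵒᵖ (SimpleMod R M (L i)))
    {κ : Type*} [Fintype κ] (col : κ → Fin s) (σ : ∀ k, L (col k) →ₗ[RHat R] MHat R M)
    (τ : ∀ k, MHat R M →ₗ[RHat R] L (col k)) (hστ : ∑ k, σ k ∘ₗ τ k = LinearMap.id)
    (Y : Type w') [AddCommGroup Y] [Module (RHat R) Y] :
    ∃ (Λ : Type (max u v w')) (c : Λ → Fin s), Nonempty (SimpleMod R M Y
      ≃ₗ[(Module.End R M)ᵐᵒᵖ] Π₀ a, SimpleMod R M (L (c a))) := by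
  let p : (Σ i : Fin s, L i →ₗ[RHat R] Y) → Submodule (Module.End R M)ᵐᵒᵖ (SimpleMod R M Y) :=
    fun a => LinearMap.range (topMap R M a.2)
  have hp : ⨆ a, p a = ⊤ := by
    rw [eq_top_iff]
    intro x _
    obtain ⟨h, rfl⟩ := mkTop_surjective x
    -- Any map out of `M̂` is a sum of maps factoring through the `L i`, so the top is a sum of
    -- images of the simple modules attached to them.
    have h1 : h = ∑ k, (h ∘ₗ σ k) ∘ₗ τ k := by
      conv_lhs => rw [← LinearMap.comp_id h, ← hστ]
      refine LinearMap.ext fun x => ?_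
      simp
    rw [h1, map_sum]
    refine Submodule.sum_mem _ fun k _ => ?_
    refine Submodule.mem_iSup_of_mem (p := p) ⟨col k, h ∘ₗ σ k⟩ ?_
    exact ⟨mkTop R M _ (τ k), rfl⟩
  have hss : IsSemisimpleModule (Module.End R M)ᵐᵒᵖ (SimpleMod R M Y) :=
    isSemisimpleModule_of_isSemisimpleModule_submodule'
      (fun a => .range _) hp
  obtain ⟨S, e, -, hS⟩ := IsSemisimpleModule.exists_linearEquiv_dfinsupp
    (Module.End R M)ᵐᵒᵖ (SimpleMod R M Y)
  have hc : ∀ m : S, ∃ i, Nonempty (m.1 ≃ₗ[(Module.End R M)ᵐᵒᵖ] SimpleMod R M (L i)) := by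
    intro m
    have := hS m
    by_contra hcon
    push Not at hcon
    -- A simple constituent isomorphic to none of these would receive only zero maps from the images
    -- that generate the top.
    have h0 : ∀ a, p a ≤ LinearMap.ker (DFinsupp.lapply m ∘ₗ e.toLinearMap) := by
      rintro ⟨i, g⟩ _ ⟨y, rfl⟩
      rcases LinearMap.bijective_or_eq_zero
        ((DFinsupp.lapply m ∘ₗ e.toLinearMap) ∘ₗ topMap R M g) with h | h
      · exact ((hcon i).false (LinearEquiv.ofBijective _ h).symm).elim
      · exact LinearMap.congr_fun h y
    have h1 := iSup_le h0
    rw [hp, top_le_iff, LinearMap.ker_eq_top] at h1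
    classical
    obtain ⟨x, hx⟩ := @exists_ne m.1 (IsSimpleModule.nontrivial (Module.End R M)ᵐᵒᵖ m.1) 0
    have h2 := LinearMap.congr_fun h1 (e.symm (DFinsupp.single m x))
    simp at h2
    exact hx h2
  choose c hc using hc
  exact ⟨S, c, ⟨e.trans (DFinsupp.mapRange.linearEquiv fun m => (hc m).some)⟩⟩

end Tops

/-! ### Base change along a flat map -/

section BaseChange

variable {R B : Type*} [CommRing R] [CommRing B] [Algebra R B]

/-- The elements of a base change are generated by the original module. -/
theorem exists_add_smul_of_isBaseChange {H Hc : Type*} [AddCommGroup H] [Module R H]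
    [AddCommGroup Hc] [Module R Hc] [Module B Hc] [IsScalarTower R B Hc] {j : H →ₗ[R] Hc}
    (hj : IsBaseChange B j) {r : R} (hr : ∀ b : B, ∃ (ρ : R) (b' : B), b = algebraMap R B ρ + r • b')
    (z : Hc) : ∃ (h : H) (z' : Hc), z = j h + r • z' := by
  induction z using hj.inductionOn with
  | zero => exact ⟨0, 0, by simp⟩
  | tmul h => exact ⟨h, 0, by simp⟩
  | smul b z ih =>
    obtain ⟨h, z', rfl⟩ := ih
    obtain ⟨ρ, b', rfl⟩ := hr b
    refine ⟨ρ • h, b' • j h + (algebraMap R B ρ + r • b') • z', ?_⟩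
    rw [map_smul, smul_add, smul_add, add_smul, algebraMap_smul, smul_comm _ r z',
      smul_assoc, add_assoc]
  | add x y hx hy =>
    obtain ⟨h, z', rfl⟩ := hx
    obtain ⟨h2, z2, rfl⟩ := hy
    exact ⟨h + h2, z' + z2, by rw [map_add, smul_add]; abel⟩

variable {H Hc H' Hc' : Type*} [AddCommGroup H] [Module R H]
    [AddCommGroup Hc] [Module R Hc] [Module B Hc] [IsScalarTower R B Hc]
    [AddCommGroup H'] [Module R H']
    [AddCommGroup Hc'] [Module R Hc'] [Module B Hc'] [IsScalarTower R B Hc']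
    {j : H →ₗ[R] Hc} {j' : H' →ₗ[R] Hc'} (φ : H →ₗ[R] H') (φc : Hc →ₗ[B] Hc')

theorem isBaseChange_equiv_baseChange (hj : IsBaseChange B j) (hj' : IsBaseChange B j')
    (hφ : ∀ h, φc (j h) = j' (φ h)) (t : B ⊗[R] H) :
    hj'.equiv (φ.baseChange B t) = φc (hj.equiv t) := by
  induction t using TensorProduct.induction_on with
  | zero => simp
  | add x y hx hy => simp [hx, hy]
  | tmul b h => simp [IsBaseChange.equiv_tmul, hφ]

/-- Solvability of a linear equation descends: if `w` dies in `B ⊗ coker φ`, it already dies in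
`coker φ` by faithful flatness. -/
theorem mem_range_of_isBaseChange [Module.FaithfullyFlat R B]
    (hj : IsBaseChange B j) (hj' : IsBaseChange B j')
    (hφ : ∀ h, φc (j h) = j' (φ h)) {w : H'} (hw : j' w ∈ LinearMap.range φc) :
    w ∈ LinearMap.range φ := by
  obtain ⟨z, hz⟩ := hw
  obtain ⟨t, rfl⟩ := hj.equiv.surjective z
  rw [← isBaseChange_equiv_baseChange φ φc hj hj' hφ] at hz
  have h1 : φ.baseChange B t = 1 ⊗ₜ w := by
    apply hj'.equiv.injective
    rw [hz, IsBaseChange.equiv_tmul, one_smul]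
  rw [← Submodule.ker_mkQ (LinearMap.range φ), LinearMap.mem_ker]
  apply Module.FaithfullyFlat.tensorProduct_mk_injective (A := R) (B := B)
  have h2 := congrArg ((LinearMap.range φ).mkQ.baseChange B) h1
  rw [← LinearMap.comp_apply, ← LinearMap.baseChange_comp] at h2
  have h3 : (LinearMap.range φ).mkQ ∘ₗ φ = 0 := by
    ext x; simp
  rw [h3] at h2
  simpa using h2.symm

/-- Two solutions over `B` differ by an element of `B ⊗ ker φ`, which agrees modulo `r` with an
element of `ker φ`. Correcting any solution over `R` by that element brings it close to the
prescribed solution `z`. -/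
theorem exists_approx_of_isBaseChange [Module.FaithfullyFlat R B]
    (hj : IsBaseChange B j) (hj' : IsBaseChange B j')
    (hφ : ∀ h, φc (j h) = j' (φ h)) {r : R}
    (hr : ∀ b : B, ∃ (ρ : R) (b' : B), b = algebraMap R B ρ + r • b')
    {w : H'} {z : Hc} (hw : φc z = j' w) :
    ∃ (y : H) (z' : Hc), φ y = w ∧ j y = z + r • z' := by
  obtain ⟨y₀, hy₀⟩ := mem_range_of_isBaseChange φ φc hj hj' hφ ⟨z, hw⟩
  obtain ⟨t, ht⟩ := hj.equiv.surjective (z - j y₀)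
  have h1 : φ.baseChange B t = 0 := by
    apply hj'.equiv.injective
    rw [isBaseChange_equiv_baseChange φ φc hj hj' hφ, ht, map_sub, hw, hφ, hy₀, sub_self, map_zero]
  have hex : Function.Exact ((LinearMap.ker φ).subtype.lTensor B) (φ.lTensor B) :=
    Module.Flat.lTensor_exact B (LinearMap.exact_subtype_ker_map φ)
  obtain ⟨k, hk⟩ := (hex t).mp h1
  obtain ⟨k₀, k', rfl⟩ := exists_add_smul_of_isBaseChange
    (TensorProduct.isBaseChange R (LinearMap.ker φ) B) hr k
  refine ⟨y₀ + k₀, -hj.equiv ((LinearMap.ker φ).subtype.lTensor B k'), ?_, ?_⟩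
  · rw [map_add, hy₀, LinearMap.mem_ker.mp k₀.2, add_zero]
  · rw [map_add, map_smul] at hk
    rw [← hk, map_add] at ht
    have h2 : hj.equiv ((LinearMap.ker φ).subtype.lTensor B
        (TensorProduct.mk R B (LinearMap.ker φ) 1 k₀)) = j k₀ := by
      simp [IsBaseChange.equiv_tmul]
    have h3 : hj.equiv (r • (LinearMap.ker φ).subtype.lTensor B k') =
        r • hj.equiv ((LinearMap.ker φ).subtype.lTensor B k') :=
      (hj.equiv.toLinearMap.restrictScalars R).map_smul r _
    rw [h2, h3] at ht
    rw [map_add, smul_neg, eq_comm, ← sub_eq_iff_eq_add', sub_eq_add_neg]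
    rw [eq_sub_iff_add_eq] at ht
    rw [← ht]; abel

/-- Homomorphisms out of a finitely generated module over a noetherian ring commute with flat
base change. -/
theorem isBaseChange_compRight [IsNoetherianRing R] [Module.Flat R B] {A X N : Type*}
    [AddCommGroup A] [Module R A] [Module.Finite R A] [AddCommGroup X] [Module R X]
    [AddCommGroup N] [Module R N] [Module B N] [IsScalarTower R B N] {ε : X →ₗ[R] N}
    (hε : IsBaseChange B ε) : IsBaseChange B (LinearMap.compRight R ε (M := A)) := by
  -- A finite presentation of `A` exhibits `Hom(A, -)` as a kernel between Hom modules of free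
  -- modules, where base change is known; flatness preserves the kernel.
  obtain ⟨n, π, hπ⟩ := Module.Finite.exists_fin' R A
  obtain ⟨m, ρ, hρ⟩ := Module.Finite.exists_fin' R (LinearMap.ker π)
  let δ : (Fin m → R) →ₗ[R] (Fin n → R) := (LinearMap.ker π).subtype ∘ₗ ρ
  have hδ : LinearMap.range δ = LinearMap.ker π := by
    rw [LinearMap.range_comp, LinearMap.range_eq_top.mpr hρ, Submodule.map_top,
      Submodule.range_subtype]
  have h0 : IsBaseChange B (LinearMap.compRight R ε (M := Fin n → R)) := hε.linearMapRight _
  have h1 : IsBaseChange B (LinearMap.compRight R ε (M := Fin m → R)) := hε.linearMapRight _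
  let γ := IsBaseChange.linearMapRightBaseChangeHom B A ε
  let πX : (A →ₗ[R] X) →ₗ[R] ((Fin n → R) →ₗ[R] X) := LinearMap.lcomp R X π
  let πN : (A →ₗ[R] N) →ₗ[B] ((Fin n → R) →ₗ[R] N) := LinearMap.lcomp B N π
  let δX : ((Fin n → R) →ₗ[R] X) →ₗ[R] ((Fin m → R) →ₗ[R] X) := LinearMap.lcomp R X δ
  let δN : ((Fin n → R) →ₗ[R] N) →ₗ[B] ((Fin m → R) →ₗ[R] N) := LinearMap.lcomp B N δ
  have hπX : Function.Injective πX := fun f g h =>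
    LinearMap.ext fun a => by obtain ⟨x, rfl⟩ := hπ a; exact LinearMap.congr_fun h x
  have hπN : Function.Injective πN := fun f g h =>
    LinearMap.ext fun a => by obtain ⟨x, rfl⟩ := hπ a; exact LinearMap.congr_fun h x
  have hexact : ∀ f : (Fin n → R) →ₗ[R] X, f ∘ₗ δ = 0 → ∃ g : A →ₗ[R] X, g ∘ₗ π = f := by
    intro f hf
    have hle : LinearMap.ker π ≤ LinearMap.ker f := by
      rw [← hδ]; rintro _ ⟨x, rfl⟩; exact LinearMap.congr_fun hf x
    refine ⟨(LinearMap.ker π).liftQ f hle ∘ₗ (π.quotKerEquivOfSurjective hπ).symm.toLinearMap,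
      LinearMap.ext fun x => ?_⟩
    have : (π.quotKerEquivOfSurjective hπ).symm (π x) = (LinearMap.ker π).mkQ x :=
      (LinearEquiv.symm_apply_eq _).mpr rfl
    simp [this]
  have hcomm : ∀ t, πN (γ t) = h0.equiv (πX.baseChange B t) := by
    intro t
    induction t using TensorProduct.induction_on with
    | zero => simp
    | add x y hx hy => simp only [map_add, hx, hy]
    | tmul b h =>
      rw [LinearMap.baseChange_tmul, IsBaseChange.equiv_tmul]
      rfl
  have hbij : Function.Bijective γ := by
    constructor
    · rw [injective_iff_map_eq_zero]
      intro t ht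
      have h2 := hcomm t
      rw [ht, map_zero, eq_comm] at h2
      have h3 := h0.equiv.injective (h2.trans (map_zero _).symm)
      exact Module.Flat.lTensor_preserves_injective_linearMap (M := B) πX hπX
        (h3.trans (map_zero _).symm)
    · intro f
      obtain ⟨t, ht⟩ := h0.equiv.surjective (πN f)
      have h2 : δX.baseChange B t = 0 := by
        apply h1.equiv.injective
        rw [isBaseChange_equiv_baseChange δX δN h0 h1 (fun _ => rfl), ht, map_zero]
        refine LinearMap.ext fun x => ?_
        have : π (δ x) = 0 := LinearMap.mem_ker.mp (hδ ▸ ⟨x, rfl⟩)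
        change f (π (δ x)) = 0
        rw [this, map_zero]
      have hex : Function.Exact (πX.lTensor B) (δX.lTensor B) := by
        refine Module.Flat.lTensor_exact B fun f => ⟨fun hf => ?_, ?_⟩
        · obtain ⟨g, hg⟩ := hexact f hf
          exact ⟨g, hg⟩
        · rintro ⟨g, rfl⟩
          refine LinearMap.ext fun x => ?_
          have : π (δ x) = 0 := LinearMap.mem_ker.mp (hδ ▸ ⟨x, rfl⟩)
          change g (π (δ x)) = 0
          rw [this, map_zero]
      obtain ⟨k, hk⟩ := (hex t).mp h2
      refine ⟨k, hπN ?_⟩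
      rw [hcomm, ← ht]
      exact congrArg _ hk
  refine IsBaseChange.of_equiv (LinearEquiv.ofBijective γ hbij) fun f => ?_
  simp [γ, IsBaseChange.linearMapRightBaseChangeHom]

end BaseChange

/-! ### Locally split modules -/

/-- A telescoping argument: the remainders `θ (n + 1) = (1 - p s) θ n` eventually kill each element,
so `y` is the finite sum of the `p s (θ n y)`. The maps `s ∘ θ n` embed `X` in a direct sum rather
than a product, and the maps `p` recover `y`. -/
theorem exists_retract_of_locally_split {R M X : Type*} [Ring R] [AddCommGroup M] [Module R M]
    [AddCommGroup X] [Module R X] (hX : IsCountablyGenerated R X)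
    (hloc : ∀ S : Finset X, ∃ (k : ℕ) (s : X →ₗ[R] (Fin k → M)) (p : (Fin k → M) →ₗ[R] X),
      ∀ x ∈ S, p (s x) = x) :
    ∃ (k : ℕ → ℕ) (e : X →ₗ[R] ((Σ n, Fin (k n)) →₀ M))
      (p : ((Σ n, Fin (k n)) →₀ M) →ₗ[R] X), p ∘ₗ e = LinearMap.id := by
  classical
  obtain ⟨G, hG, hGtop⟩ := hX
  obtain ⟨x, hx⟩ : ∃ x : ℕ → X, Submodule.span R (Set.range x) = ⊤ := by
    rcases G.eq_empty_or_nonempty with rfl | hne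
    · refine ⟨fun _ => 0, ?_⟩
      rw [Submodule.span_empty] at hGtop
      exact top_le_iff.mp (hGtop.symm.le.trans bot_le)
    · obtain ⟨x, rfl⟩ := hG.exists_eq_range hne
      exact ⟨x, hGtop⟩
  choose k₀ s₀ p₀ h₀ using hloc
  let S : ℕ → (X →ₗ[R] X) → Finset X := fun n θ => (Finset.range (n + 1)).image fun i => θ (x i)
  let θ : ℕ → (X →ₗ[R] X) := fun n => Nat.rec LinearMap.id
    (fun n θ => θ - p₀ (S n θ) ∘ₗ s₀ (S n θ) ∘ₗ θ) n
  have hθ : ∀ n, θ (n + 1) = θ n - p₀ (S n (θ n)) ∘ₗ s₀ (S n (θ n)) ∘ₗ θ n := fun _ => rfl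
  have hzero : ∀ i n, i < n → θ n (x i) = 0 := by
    intro i n hin
    induction n, hin using Nat.le_induction with
    | base =>
      rw [hθ, LinearMap.sub_apply, LinearMap.comp_apply, LinearMap.comp_apply,
        h₀ (S i (θ i)) (θ i (x i)) (Finset.mem_image.mpr ⟨i, by simp, rfl⟩), sub_self]
    | succ n _ ih => rw [hθ, LinearMap.sub_apply, LinearMap.comp_apply, LinearMap.comp_apply, ih]; simp
  have hev : ∀ y, ∃ m, ∀ n, m ≤ n → θ n y = 0 := by
    intro y
    have hy : y ∈ Submodule.span R (Set.range x) := hx ▸ Submodule.mem_top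
    induction hy using Submodule.span_induction with
    | mem y hy => obtain ⟨i, rfl⟩ := hy; exact ⟨i + 1, fun n hn => hzero i n hn⟩
    | zero => exact ⟨0, fun n _ => map_zero _⟩
    | add y z _ _ hy hz =>
      obtain ⟨m, hm⟩ := hy
      obtain ⟨m', hm'⟩ := hz
      refine ⟨max m m', fun n hn => ?_⟩
      rw [map_add, hm n (le_of_max_le_left hn), hm' n (le_of_max_le_right hn), add_zero]
    | smul a y _ hy =>
      obtain ⟨m, hm⟩ := hy
      exact ⟨m, fun n hn => by rw [map_smul, hm n hn, smul_zero]⟩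
  let k : ℕ → ℕ := fun n => k₀ (S n (θ n))
  let s : ∀ n, X →ₗ[R] (Fin (k n) → M) := fun n => s₀ (S n (θ n))
  let p : ∀ n, (Fin (k n) → M) →ₗ[R] X := fun n => p₀ (S n (θ n))
  have hsub : ∀ (y : X) (m : ℕ), (∀ n, m ≤ n → θ n y = 0) → ∀ a : Σ n, Fin (k n),
      s a.1 (θ a.1 y) a.2 ≠ 0 → a ∈ (Finset.range m).sigma fun _ => Finset.univ := by
    intro y m hm a ha
    simp only [Finset.mem_sigma, Finset.mem_range, Finset.mem_univ, and_true]
    by_contra hcon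
    exact ha (by rw [hm a.1 (not_lt.mp hcon)]; simp)
  have hfin : ∀ y, (Function.support fun a : Σ n, Fin (k n) => s a.1 (θ a.1 y) a.2).Finite := by
    intro y
    obtain ⟨m, hm⟩ := hev y
    exact (Finset.finite_toSet _).subset fun a ha => hsub y m hm a ha
  let e : X →ₗ[R] ((Σ n, Fin (k n)) →₀ M) :=
    { toFun := fun y => Finsupp.ofSupportFinite _ (hfin y)
      map_add' := fun y z => by ext a; simp [Finsupp.ofSupportFinite_coe]
      map_smul' := fun c y => by ext a; simp [Finsupp.ofSupportFinite_coe] }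
  refine ⟨k, e, Finsupp.lsum ℕ fun a => p a.1 ∘ₗ LinearMap.single R (fun _ => M) a.2, ?_⟩
  ext y
  obtain ⟨m, hm⟩ := hev y
  rw [LinearMap.comp_apply, Finsupp.lsum_apply, Finsupp.sum_of_support_subset _
    (s := (Finset.range m).sigma fun _ => Finset.univ)
    (fun a ha => hsub y m hm a (Finsupp.mem_support_iff.mp ha)) _ (fun a _ => map_zero _),
    Finset.sum_sigma]
  have h1 : ∀ n, ∑ i : Fin (k n), (p n ∘ₗ LinearMap.single R (fun _ => M) i) (e y ⟨n, i⟩) =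
      θ n y - θ (n + 1) y := by
    intro n
    have h2 : s n (θ n y) = ∑ i, Pi.single i (s n (θ n y) i) := (Finset.univ_sum_single _).symm
    have h3 : θ n y - θ (n + 1) y = p n (s n (θ n y)) := by
      rw [hθ, LinearMap.sub_apply, sub_sub_cancel]; rfl
    rw [h3, h2, map_sum]
    rfl
  rw [Finset.sum_congr rfl fun n _ => h1 n, Finset.sum_range_sub', hm m le_rfl, sub_zero]
  rfl

/-! ### Descent of direct summands -/

section Descent

variable {R B : Type*} [CommRing R] [CommRing B] [Algebra R B] [IsNoetherianRing R]
  [Module.FaithfullyFlat R B] {X N G Gc : Type*} [AddCommGroup X] [Module R X] [AddCommGroup N]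
  [Module R N] [Module B N] [IsScalarTower R B N] [AddCommGroup G] [Module R G]
  [AddCommGroup Gc] [Module R Gc] [Module B Gc] [IsScalarTower R B Gc] {ε : X →ₗ[R] N}
  {γ : G →ₗ[R] Gc}

/-- A homomorphism over the completion can be approximated by one over the base, provided
sufficiently divisible maps extend from finitely generated submodules. -/
theorem exists_approx_hom (hγ : IsBaseChange B γ) (hX : IsCountablyGenerated R X) {r : R}
    (hr : ∀ t : ℕ, ∀ b : B, ∃ (ρ : R) (b' : B), b = algebraMap R B ρ + r ^ t • b')
    (hext : ∀ A : Submodule R X, A.FG → ∃ t : ℕ, ∀ ψ : A →ₗ[R] Gc,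
      ∃ Ψ : N →ₗ[B] Gc, ∀ a : A, Ψ (ε a) = r ^ t • ψ a) (f : N →ₗ[B] Gc) :
    ∃ s : X →ₗ[R] G, ∀ x, ∃ z, γ (s x) = f (ε x) + r • z := by
  classical
  -- The error on a finitely generated domain must be `r` times the restriction of a map `h` defined
  -- on all of `N`; having `h` globally makes the partial map extendable.
  let Good : (X →ₗ.[R] G) → Prop := fun p => p.domain.FG ∧
    ∃ h : N →ₗ[B] Gc, ∀ x : p.domain, γ (p x) = f (ε x) + r • h (ε x)
  have hstep : ∀ p, Good p → ∀ x : X, ∃ p', Good p' ∧ p ≤ p' ∧ x ∈ p'.domain := by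
    rintro p ⟨hfg, h, hp⟩ x
    let A' : Submodule R X := p.domain ⊔ R ∙ x
    have hA' : A'.FG := hfg.sup (Submodule.fg_span_singleton x)
    have hle : p.domain ≤ A' := le_sup_left
    obtain ⟨t, ht⟩ := hext A' hA'
    have : Module.Finite R A' := Module.Finite.iff_fg.mpr hA'
    have : Module.Finite R p.domain := Module.Finite.iff_fg.mpr hfg
    let ι : p.domain →ₗ[R] A' := Submodule.inclusion hle
    -- Precision `r ^ (t + 1)`: the factor `r ^ t` is spent on extending the new error to `N`, and
    -- the remaining `r` keeps the extended map congruent to `f`.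
    obtain ⟨y, z', hy, hz'⟩ := exists_approx_of_isBaseChange
      (LinearMap.lcomp R G ι) (LinearMap.lcomp B Gc ι)
      (isBaseChange_compRight hγ) (isBaseChange_compRight hγ) (fun _ => rfl) (hr (t + 1))
      (w := p.toFun) (z := ((f + r • h).restrictScalars R ∘ₗ ε) ∘ₗ A'.subtype)
      (LinearMap.ext fun a => (hp a).symm)
    obtain ⟨Ψ, hΨ⟩ := ht z'
    refine ⟨⟨A', y⟩, ⟨hA', h + Ψ, fun a => ?_⟩, ⟨hle, ?_⟩, ?_⟩
    · have h1 := LinearMap.congr_fun hz' a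
      have h2 : γ (y a) = f (ε a) + r • h (ε a) + r ^ (t + 1) • z' a := h1
      change γ (y a) = _
      rw [h2, LinearMap.add_apply, hΨ, smul_add, pow_succ', mul_smul, add_assoc]
    · intro a b hab
      have h1 : p a = y (ι a) := (LinearMap.congr_fun hy a).symm
      rw [h1]
      congr 1
      exact Subtype.ext hab
    · exact (le_sup_right : R ∙ x ≤ A') (Submodule.mem_span_singleton_self x)
  choose! nx hnx using hstep
  obtain ⟨S, hS, hStop⟩ := hX
  obtain ⟨x, hx⟩ : ∃ x : ℕ → X, S ⊆ Set.range x := by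
    rcases S.eq_empty_or_nonempty with rfl | hne
    · exact ⟨fun _ => 0, Set.empty_subset _⟩
    · obtain ⟨x, rfl⟩ := hS.exists_eq_range hne
      exact ⟨x, le_rfl⟩
  let p₀ : X →ₗ.[R] G := ⊥
  have hp₀ : Good p₀ := by
    refine ⟨Submodule.fg_bot, 0, fun a => ?_⟩
    have ha : a = 0 := Subtype.ext ((Submodule.mem_bot R).mp a.2)
    simp [ha]
  let p : ℕ → (X →ₗ.[R] G) := fun n => Nat.rec p₀ (fun n q => nx q (x n)) n
  have hp : ∀ n, Good (p n) := by
    intro n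
    induction n with
    | zero => exact hp₀
    | succ n ih => exact (hnx _ ih (x n)).1
  have hmono : Monotone p := monotone_nat_of_le_succ fun n => (hnx _ (hp n) (x n)).2.1
  have hdir : DirectedOn (· ≤ ·) (Set.range p) :=
    hmono.directed_le.directedOn_range
  have hdom : (LinearPMap.sSup _ hdir).domain = ⊤ := by
    rw [eq_top_iff, ← hStop, Submodule.span_le]
    rintro a ha
    obtain ⟨n, rfl⟩ := hx ha
    exact (LinearPMap.le_sSup hdir ⟨n + 1, rfl⟩).1 (hnx _ (hp n) (x n)).2.2
  refine ⟨(LinearPMap.sSup _ hdir).toFun ∘ₗ (LinearMap.id.codRestrict _ fun a => by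
    rw [hdom]; trivial), fun a => ?_⟩
  have ha : a ∈ (LinearPMap.sSup _ hdir).domain := by rw [hdom]; trivial
  obtain ⟨_, ⟨n, rfl⟩, hn⟩ := (LinearPMap.mem_domain_sSup_iff (Set.range_nonempty p) hdir).mp ha
  obtain ⟨h, hh⟩ := (hp n).2
  refine ⟨h (ε a), ?_⟩
  rw [← hh ⟨a, hn⟩]
  congr 1
  exact ((LinearPMap.le_sSup hdir ⟨n, rfl⟩).2 (x := ⟨a, hn⟩) (y := ⟨a, ha⟩) rfl).symm

/-- Local splittings descend from the completion. -/
theorem exists_local_splitting [Module.Finite R G] [IsLocalRing B] [IsNoetherianRing B]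
    (hε : IsBaseChange B ε) {r : R}
    (hrm : algebraMap R B r ∈ IsLocalRing.maximalIdeal B)
    {C : Type*} [AddCommGroup C] [Module B C] [Module.Finite B C]
    (ι : C →ₗ[B] N) (κ : N →ₗ[B] C) (hκι : κ ∘ₗ ι = LinearMap.id)
    (a : C →ₗ[B] Gc) (b : Gc →ₗ[B] C) (hba : b ∘ₗ a = LinearMap.id)
    {s : X →ₗ[R] G} (hs : ∀ x, ∃ z, γ (s x) = a (κ (ε x)) + r • z)
    {A : Submodule R X} (hA : A.FG) (hAC : ∀ x ∈ A, ε x ∈ LinearMap.range ι) :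
    ∃ p : G →ₗ[R] X, ∀ x ∈ A, p (s x) = x := by
  have : Module.Finite R A := Module.Finite.iff_fg.mpr hA
  let sc : N →ₗ[B] Gc := hε.lift (γ ∘ₗ s)
  have hsc : ∀ x, sc (ε x) = γ (s x) := fun x => hε.lift_eq (γ ∘ₗ s) x
  have h1 : ∀ y : N, ∃ z, sc y = a (κ y) + algebraMap R B r • z := by
    intro y
    induction y using hε.inductionOn with
    | zero => exact ⟨0, by simp⟩
    | tmul x =>
      obtain ⟨z, hz⟩ := hs x
      exact ⟨z, by rw [hsc, hz, algebraMap_smul]⟩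
    | smul c y ih =>
      obtain ⟨z, hz⟩ := ih
      exact ⟨c • z, by rw [map_smul, hz, map_smul, map_smul, smul_add, smul_comm]⟩
    | add y y' h h' =>
      obtain ⟨z, hz⟩ := h
      obtain ⟨z', hz'⟩ := h'
      exact ⟨z + z', by rw [map_add, hz, hz', map_add, map_add, smul_add]; abel⟩
  -- Modulo `r` this is the identity of `C`, hence an automorphism by Nakayama; its inverse corrects
  -- `b` to an exact left inverse over `B`.
  let u : C →ₗ[B] C := b ∘ₗ sc ∘ₗ ι
  have hu : ∀ c, ∃ d, u c = c + algebraMap R B r • d := by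
    intro c
    obtain ⟨z, hz⟩ := h1 (ι c)
    refine ⟨b z, ?_⟩
    change b (sc (ι c)) = _
    rw [hz, map_add, map_smul]
    have h2 : κ (ι c) = c := LinearMap.congr_fun hκι c
    have h3 : b (a c) = c := LinearMap.congr_fun hba c
    rw [h2, h3]
  have husurj : Function.Surjective u := by
    rw [← LinearMap.range_eq_top]
    refine top_le_iff.mp (Submodule.le_of_le_smul_of_le_jacobson_bot
      (I := IsLocalRing.maximalIdeal B) Module.Finite.fg_top
      (IsLocalRing.maximalIdeal_le_jacobson _) ?_)
    intro c _
    obtain ⟨d, hd⟩ := hu c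
    have : c = u c - algebraMap R B r • d := by rw [hd]; abel
    rw [this]
    exact Submodule.sub_mem_sup ⟨c, rfl⟩ (Submodule.smul_mem_smul hrm trivial)
  let ue : C ≃ₗ[B] C := LinearEquiv.ofBijective u
    ⟨OrzechProperty.injective_of_surjective_endomorphism u husurj, husurj⟩
  let pc : Gc →ₗ[B] N := ι ∘ₗ ue.symm.toLinearMap ∘ₗ b
  have hpc : ∀ x ∈ A, pc (γ (s x)) = ε x := by
    intro x hx
    obtain ⟨c, hc⟩ := hAC x hx
    rw [← hsc, ← hc]
    change ι (ue.symm (ue c)) = ι c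
    rw [ue.symm_apply_apply]
  -- That the inclusion of `A` factors through `s` is a linear condition on Hom modules. It holds
  -- over `B`, hence over `R`.
  obtain ⟨p, hp⟩ := mem_range_of_isBaseChange (LinearMap.lcomp R X (s ∘ₗ A.subtype))
    (LinearMap.lcomp B N (s ∘ₗ A.subtype)) (isBaseChange_compRight hε)
    (isBaseChange_compRight hε) (fun _ => rfl) (w := A.subtype)
    ⟨pc.restrictScalars R ∘ₗ γ, LinearMap.ext fun x => hpc x x.2⟩
  exact ⟨p, fun x hx => LinearMap.congr_fun hp ⟨x, hx⟩⟩

end Descent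

/-! ### One-dimensional local domains and their completions -/

theorem exists_mem_maximalIdeal_ne_zero {R : Type*} [CommRing R] [IsLocalRing R]
    (hdim : ringKrullDim R = 1) :
    ∃ r ∈ IsLocalRing.maximalIdeal R, r ≠ 0 := by
  refine (Submodule.ne_bot_iff _).mp fun h => ?_
  have : IsField R := (IsLocalRing.isField_iff_maximalIdeal_eq).mpr h
  let _ := this.toField
  rw [ringKrullDim_eq_zero_of_field] at hdim
  exact zero_ne_one hdim

section Completion

variable {R : Type u} [CommRing R] [IsDomain R] [IsNoetherianRing R] [IsLocalRing R]

theorem exists_maximalIdeal_pow_le (hdim : ringKrullDim R = 1) {r : R} (hr : r ≠ 0) :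
    ∃ n, IsLocalRing.maximalIdeal R ^ n ≤ Ideal.span {r} := by
  have hle : Ring.KrullDimLE 1 R := (Ring.krullDimLE_iff).mpr (by rw [hdim]; rfl)
  rw [Ring.krullDimLE_one_iff_of_noZeroDivisors] at hle
  refine Ideal.exists_pow_le_of_le_radical_of_fg ?_ (IsNoetherian.noetherian _)
  rw [Ideal.radical_eq_sInf]
  refine le_sInf fun P ⟨hP, hPp⟩ => ?_
  have hP0 : P ≠ ⊥ := by
    rintro rfl
    exact hr (by simpa using hP)
  exact (IsLocalRing.eq_maximalIdeal (hle P hP0 hPp)).ge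

theorem exists_eq_smul_of_mem {A X : Type*} [CommRing A] [AddCommGroup X] [Module A X] {r : A}
    {x : X} (hx : x ∈ (Ideal.span {r} • ⊤ : Submodule A X)) : ∃ y, x = r • y := by
  rw [Submodule.ideal_span_singleton_smul, Submodule.mem_smul_pointwise_iff_exists] at hx
  obtain ⟨y, -, rfl⟩ := hx
  exact ⟨y, rfl⟩

/-- The ideal `(r)` contains a power of the maximal ideal, and `R` maps onto the quotient of its
completion by the corresponding power. -/
theorem exists_add_smul_of_completion (hdim : ringKrullDim R = 1) {r : R} (hr : r ≠ 0)
    (b : RHat R) : ∃ (ρ : R) (b' : RHat R), b = algebraMap R (RHat R) ρ + r • b' := by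
  obtain ⟨n, hn⟩ := exists_maximalIdeal_pow_le hdim hr
  obtain ⟨ρ, hρ⟩ := Submodule.mkQ_surjective _
    (AdicCompletion.eval (IsLocalRing.maximalIdeal R) R n b)
  have h1 : b - AdicCompletion.of (IsLocalRing.maximalIdeal R) R ρ ∈
      (AdicCompletion.eval (IsLocalRing.maximalIdeal R) R n).ker := by
    rw [LinearMap.mem_ker, map_sub, ← hρ, AdicCompletion.eval_of, sub_self]
  rw [← AdicCompletion.pow_smul_top_eq_ker_eval (IsNoetherian.noetherian _)] at h1
  obtain ⟨b', hb'⟩ := exists_eq_smul_of_mem (Submodule.smul_mono_left hn h1)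
  refine ⟨ρ, b', ?_⟩
  rw [← hb']
  have : algebraMap R (RHat R) ρ = AdicCompletion.of (IsLocalRing.maximalIdeal R) R ρ := rfl
  rw [this]
  abel

theorem isPrecomplete_pi {A X : Type*} [CommRing A] (I : Ideal A) [AddCommGroup X] [Module A X]
    [IsPrecomplete I X] {κ : Type*} [Finite κ] : IsPrecomplete I (κ → X) := by
  classical
  have := Fintype.ofFinite κ
  have key : ∀ (n : ℕ) (x : κ → X), x ∈ (I ^ n • ⊤ : Submodule A (κ → X)) ↔
      ∀ i, x i ∈ (I ^ n • ⊤ : Submodule A X) := by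
    intro n x
    constructor
    · intro hx i
      have h1 : LinearMap.proj (R := A) (φ := fun _ : κ => X) i x ∈
          (I ^ n • ⊤ : Submodule A (κ → X)).map (LinearMap.proj i) := ⟨x, hx, rfl⟩
      rw [Submodule.map_smul''] at h1
      exact Submodule.smul_mono le_rfl le_top h1
    · intro hx
      rw [← Finset.univ_sum_single x]
      refine Submodule.sum_mem _ fun i _ => ?_
      have h1 : LinearMap.single A (fun _ : κ => X) i (x i) ∈
          (I ^ n • ⊤ : Submodule A X).map (LinearMap.single A (fun _ => X) i) := ⟨_, hx i, rfl⟩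
      rw [Submodule.map_smul''] at h1
      exact Submodule.smul_mono le_rfl le_top h1
  rw [isPrecomplete_iff]
  intro f hf
  have h1 : ∀ i, ∃ L : X, ∀ n, f n i ≡ L [SMOD (I ^ n • ⊤ : Submodule A X)] := by
    intro i
    refine IsPrecomplete.prec ‹_› fun {m n} hmn => ?_
    have := hf hmn
    rw [SModEq.sub_mem, key] at this
    exact SModEq.sub_mem.mpr (this i)
  choose L hL using h1
  refine ⟨L, fun n => ?_⟩
  rw [SModEq.sub_mem, key]
  exact fun i => SModEq.sub_mem.mp (hL i n)

theorem IsHausdorff.submodule {A X : Type*} [CommRing A] (I : Ideal A) [AddCommGroup X]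
    [Module A X] [IsHausdorff I X] (P : Submodule A X) : IsHausdorff I P := by
  rw [isHausdorff_iff]
  intro x hx
  refine Subtype.ext (IsHausdorff.haus (I := I) ‹_› _ fun n => ?_)
  have h1 := hx n
  rw [SModEq.zero] at h1 ⊢
  have h2 : P.subtype x ∈ (I ^ n • ⊤ : Submodule A P).map P.subtype := ⟨x, h1, rfl⟩
  rw [Submodule.map_smul''] at h2
  exact Submodule.smul_mono le_rfl le_top h2

/-- By Cohen's theorem it suffices to treat prime ideals, and modulo `r` the completion is a
quotient of the noetherian ring `R`. -/
theorem isNoetherianRing_completion (hdim : ringKrullDim R = 1) : IsNoetherianRing (RHat R) := by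
  obtain ⟨r, hrm, hr0⟩ := exists_mem_maximalIdeal_ne_zero hdim
  have hcomplete : IsAdicComplete (IsLocalRing.maximalIdeal R) (RHat R) :=
    AdicCompletion.isAdicComplete (IsNoetherian.noetherian _)
  set r' : RHat R := algebraMap R (RHat R) r with hr'
  have hsmul : ∀ b : RHat R, r • b = r' * b := fun b => Algebra.smul_def r b
  have hquot : IsNoetherianRing (RHat R ⧸ Ideal.span {r'}) := by
    refine isNoetherianRing_of_surjective R _
      ((Ideal.Quotient.mk (Ideal.span {r'})).comp (algebraMap R (RHat R))) fun y => ?_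
    obtain ⟨b, rfl⟩ := Ideal.Quotient.mk_surjective y
    obtain ⟨ρ, b', hb⟩ := exists_add_smul_of_completion hdim hr0 b
    refine ⟨ρ, ?_⟩
    rw [RingHom.comp_apply, Ideal.Quotient.mk_eq_mk_iff_sub_mem, hb, hsmul, sub_add_cancel_left,
      neg_mem_iff]
    exact Ideal.mul_mem_right _ _ (Ideal.mem_span_singleton_self r')
  refine IsNoetherianRing.of_prime fun P hP => ?_
  obtain ⟨k, a, ha⟩ : ∃ (k : ℕ) (a : Fin k → P), P ≤
      Ideal.span (Set.range fun i => (a i : RHat R)) ⊔ Ideal.span {r'} := by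
    have hfg : (P.map (Ideal.Quotient.mk (Ideal.span {r'}))).FG := IsNoetherian.noetherian _
    obtain ⟨k, g, hg⟩ := Submodule.fg_iff_exists_fin_generating_family.mp hfg
    have h1 : ∀ i, ∃ a ∈ P, Ideal.Quotient.mk (Ideal.span {r'}) a = g i := fun i =>
      (Ideal.mem_map_iff_of_surjective _ Ideal.Quotient.mk_surjective).mp
        (hg.le (Submodule.subset_span ⟨i, rfl⟩))
    choose a haP hag using h1
    refine ⟨k, fun i => ⟨a i, haP i⟩, fun p hp => ?_⟩
    have h2 := hg.ge (Ideal.mem_map_of_mem (Ideal.Quotient.mk (Ideal.span {r'})) hp)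
    obtain ⟨c, hc⟩ := (Submodule.mem_span_range_iff_exists_fun _).mp h2
    choose c' hc' using fun i => Ideal.Quotient.mk_surjective (c i)
    have h3 : p - ∑ i, c' i * a i ∈ Ideal.span {r'} := by
      rw [← Ideal.Quotient.mk_eq_mk_iff_sub_mem, ← hc, map_sum]
      exact Finset.sum_congr rfl fun i _ => by rw [map_mul, hc', hag, smul_eq_mul]
    rw [← add_sub_cancel (∑ i, c' i * a i) p]
    exact Submodule.add_mem_sup (Submodule.sum_mem _ fun i _ =>
      Ideal.mul_mem_left _ _ (Submodule.subset_span ⟨i, rfl⟩)) h3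
  by_cases hrP : r' ∈ P
  · have : P = Ideal.span (Set.range fun i => (a i : RHat R)) ⊔ Ideal.span {r'} := by
      refine le_antisymm ha (sup_le ?_ ?_)
      · rw [Ideal.span_le]; rintro _ ⟨i, rfl⟩; exact (a i).2
      · rw [Ideal.span_le]; rintro _ rfl; exact hrP
    rw [this]
    exact Submodule.FG.sup (Submodule.fg_span (Set.finite_range _)) (Submodule.fg_span_singleton _)
  -- When `r'` is outside the prime `P`, the part of an element lying in `(r')` comes from `r' P`.
  -- So the `a i` generate `P` modulo `r' P`, and complete Nakayama shows that they generate `P`.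
  · let f : (Fin k → RHat R) →ₗ[RHat R] P := Fintype.linearCombination (RHat R) a
    have : IsPrecomplete (IsLocalRing.maximalIdeal R) (Fin k → RHat R) := isPrecomplete_pi _
    have : IsHausdorff (IsLocalRing.maximalIdeal R) P :=
      IsHausdorff.submodule _ (P.restrictScalars R)
    have hf : Function.Surjective (f.restrictScalars R) := by
      refine surjective_of_mkQ_comp_surjective (I := IsLocalRing.maximalIdeal R) fun y => ?_
      obtain ⟨p, rfl⟩ := Submodule.mkQ_surjective _ y
      obtain ⟨y, hy, z, hz, hyz⟩ := Submodule.mem_sup.mp (ha p.2)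
      obtain ⟨c, rfl⟩ := (Submodule.mem_span_range_iff_exists_fun _).mp hy
      obtain ⟨w, rfl⟩ := Ideal.mem_span_singleton'.mp hz
      refine ⟨c, ?_⟩
      have hfc : (f c : RHat R) = ∑ i, c i • (a i : RHat R) := by
        simp [f, Fintype.linearCombination_apply]
      have hwr : w * r' = p - f c := by rw [hfc, ← hyz]; ring
      have hw : w ∈ P := by
        refine (hP.mem_or_mem (?_ : w * r' ∈ P)).resolve_right hrP
        rw [hwr]
        exact sub_mem p.2 (f c).2
      rw [LinearMap.comp_apply, ← sub_eq_zero, ← map_sub, Submodule.mkQ_apply,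
        Submodule.Quotient.mk_eq_zero]
      have : f.restrictScalars R c - p = r • (-⟨w, hw⟩ : P) := by
        apply Subtype.ext
        change (f c : RHat R) - p = r • (-w)
        rw [hsmul]
        linear_combination hwr
      rw [this]
      exact Submodule.smul_mem_smul hrm trivial
    have h2 : LinearMap.range f = ⊤ := LinearMap.range_eq_top.mpr hf
    have h3 : (⊤ : Submodule (RHat R) P).FG := by
      rw [← h2, LinearMap.range_eq_map]
      exact Submodule.FG.map f Module.Finite.fg_top
    exact (Submodule.fg_top _).mp h3

instance faithfullyFlat_completion : Module.FaithfullyFlat R (RHat R) := by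
  have : Module.Flat R (RHat R) := AdicCompletion.flat_of_isNoetherian _
  exact Module.FaithfullyFlat.of_flat_of_isLocalHom

/-- An ideal of the completion which lies in no minimal prime contains a power of any given
element of the maximal ideal of the base. -/
theorem exists_pow_mem_of_forall_not_le (hdim : ringKrullDim R = 1) {r : R}
    (hrm : r ∈ IsLocalRing.maximalIdeal R) (hr : r ≠ 0) (I : Ideal (RHat R))
    (hI : ∀ P ∈ minimalPrimes (RHat R), ¬ I ≤ P) : ∃ t, algebraMap R (RHat R) r ^ t ∈ I := by
  have hnoeth := isNoetherianRing_completion hdim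
  set r' := algebraMap R (RHat R) r
  have hr'm : r' ∈ IsLocalRing.maximalIdeal (RHat R) := by
    rw [AdicCompletion.maximalIdeal_eq_map]
    exact Ideal.mem_map_of_mem _ hrm
  have hover : ∀ Q : Ideal (RHat R), Q.IsPrime → r' ∈ Q →
      IsLocalRing.maximalIdeal (RHat R) ≤ Q := by
    intro Q hQ hrQ
    obtain ⟨n, hn⟩ := exists_maximalIdeal_pow_le hdim hr
    rw [AdicCompletion.maximalIdeal_eq_map]
    refine Ideal.IsPrime.le_of_pow_le (n := n) ?_
    rw [← Ideal.map_pow]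
    refine (Ideal.map_mono hn).trans ?_
    rw [Ideal.map_span, Set.image_singleton, Ideal.span_le]
    rintro _ rfl
    exact hrQ
  have hmin : IsLocalRing.maximalIdeal (RHat R) ∈ (Ideal.span {r'}).minimalPrimes := by
    refine ⟨⟨inferInstance, ?_⟩, fun Q hQ _ => hover Q hQ.1 (hQ.2 (Ideal.mem_span_singleton_self _))⟩
    rw [Ideal.span_le]
    rintro _ rfl
    exact hr'm
  -- Krull's principal ideal theorem: a prime missing `r'` is strictly below the maximal ideal,
  -- hence of height zero and minimal.
  have hheight := Ideal.height_le_one_of_isPrincipal_of_mem_minimalPrimes _ _ hmin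
  suffices r' ∈ I.radical from this
  rw [Ideal.radical_eq_sInf, Ideal.mem_sInf]
  rintro Q ⟨hIQ, hQ⟩
  by_contra hrQ
  have hlt : Q < IsLocalRing.maximalIdeal (RHat R) :=
    lt_of_le_of_ne (IsLocalRing.le_maximalIdeal hQ.ne_top) fun h => hrQ (h ▸ hr'm)
  have h0 : Q.height = 0 := by
    have := (Ideal.height_strict_mono_of_isPrime hlt).trans_le hheight
    exact Order.lt_one_iff.mp this
  exact hI Q (Ideal.height_eq_zero_iff.mp h0) hIQ

end Completion

/-! ### Local endomorphism rings over complete local rings -/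

section Henselian

theorem isAdicComplete_of_finite {B C : Type*} [CommRing B] [IsNoetherianRing B] [IsLocalRing B]
    [IsAdicComplete (IsLocalRing.maximalIdeal B) B] [AddCommGroup C] [Module B C]
    [Module.Finite B C] : IsAdicComplete (IsLocalRing.maximalIdeal B) C := by
  obtain ⟨n, π, hπ⟩ := Module.Finite.exists_fin' B C
  have h1 : IsPrecomplete (IsLocalRing.maximalIdeal B) (Fin n → B) := isPrecomplete_pi _
  have h2 : IsPrecomplete (IsLocalRing.maximalIdeal B) C := by
    rw [← AdicCompletion.of_surjective_iff]
    intro y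
    obtain ⟨x, rfl⟩ := AdicCompletion.map_surjective _ hπ y
    obtain ⟨x, rfl⟩ := AdicCompletion.of_surjective _ _ x
    exact ⟨π x, (AdicCompletion.map_of _ π x).symm⟩
  constructor

/-- Idempotents lift along complete ideals. -/
theorem exists_isIdempotentElem_of_isAdicComplete {C : Type*} [CommRing C] (I : Ideal C)
    [IsAdicComplete I C] {e : C} (he : e * e - e ∈ I) :
    ∃ e', e' * e' = e' ∧ e' - e ∈ I := by
  have hH : HenselianRing C I := inferInstance
  have hmk : Ideal.Quotient.mk I e * Ideal.Quotient.mk I e = Ideal.Quotient.mk I e := by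
    rw [← map_mul, Ideal.Quotient.mk_eq_mk_iff_sub_mem]
    exact he
  rcases subsingleton_or_nontrivial C with hsub | hnt
  · exact ⟨e, Subsingleton.elim _ _, by simp⟩
  obtain ⟨a, ha, hae⟩ := hH.is_henselian (Polynomial.X ^ 2 - Polynomial.X)
    (Polynomial.monic_X_pow_sub (by rw [Polynomial.degree_X]; norm_num)) e
    (by simpa [sq] using he) (by
      -- Hensel applies to `X² - X` because its derivative `2e - 1` squares to `4(e² - e) + 1`,
      -- which is `1` modulo `I`.
      refine IsUnit.of_mul_eq_one (Ideal.Quotient.mk I (2 * e - 1)) ?_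
      simp only [Polynomial.derivative_X_pow, Polynomial.derivative_X,
        Polynomial.eval_sub, Polynomial.eval_mul, Polynomial.eval_pow, Polynomial.eval_X,
        Polynomial.eval_one, map_sub, map_mul, map_one]
      norm_num
      rw [map_ofNat]
      linear_combination 4 * hmk)
  refine ⟨a, ?_, hae⟩
  have : a ^ 2 - a = 0 := by simpa [Polynomial.IsRoot] using ha
  linear_combination this

/-- In an Artinian commutative ring, some power of every element generates an idempotent ideal. -/
theorem exists_idempotent_of_isArtinian {D : Type*} [CommRing D] [IsArtinianRing D] (f : D) :
    ∃ (e : D) (n : ℕ) (g : D), e * e = e ∧ e = f ^ (n + 1) * g ∧ f ^ (n + 1) * e = f ^ (n + 1) := by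
  obtain ⟨n, y, hy⟩ := IsArtinian.exists_pow_succ_smul_dvd f (1 : D)
  simp only [smul_eq_mul, mul_one] at hy
  have h1 : ∀ k, f ^ n = f ^ (n + k) * y ^ k := by
    intro k
    induction k with
    | zero => simp
    | succ k ih =>
      calc f ^ n = f ^ (n + k) * y ^ k := ih
        _ = (f ^ n) * f ^ k * y ^ k := by ring
        _ = (f ^ n.succ * y) * f ^ k * y ^ k := by rw [hy]
        _ = f ^ (n + (k + 1)) * y ^ (k + 1) := by rw [Nat.succ_eq_add_one]; ring
  have h2 : f ^ (n + 1) * (f ^ (n + 1) * y ^ (n + 1)) = f ^ (n + 1) := by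
    calc f ^ (n + 1) * (f ^ (n + 1) * y ^ (n + 1))
        = f * (f ^ (n + (n + 1)) * y ^ (n + 1)) := by ring
      _ = f ^ (n + 1) := by rw [← h1]; ring
  exact ⟨f ^ (n + 1) * y ^ (n + 1), n, y ^ (n + 1),
    by linear_combination y ^ (n + 1) * h2, rfl, h2⟩

/-- For `a + b = 1`, work in the commutative algebra `B[a]`, finite over `B` and hence complete. A
Fitting idempotent of the Artinian quotient lifts to an idempotent endomorphism of `L`, which
indecomposability forces to be `0` or `1`; accordingly `a` is nilpotent or invertible modulo the
maximal ideal, so `b` or `a` is a unit. -/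
theorem isLocalRing_end_of_isIndecomposable {B : Type*} [CommRing B] [IsNoetherianRing B]
    [IsLocalRing B] [IsAdicComplete (IsLocalRing.maximalIdeal B) B] {L : Type*} [AddCommGroup L]
    [Module B L] [Module.Finite B L] (hL : IsIndecomposable B L) :
    IsLocalRing (Module.End B L) := by
  have := hL.1
  have hnt : Nontrivial (Module.End B L) := inferInstance
  refine ⟨fun {a b} hab => ?_⟩
  let C := Algebra.adjoin B {a}
  have hfin : Module.Finite B C := Module.IsNoetherian.finite B (Subalgebra.toSubmodule C)
  set m := IsLocalRing.maximalIdeal B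
  have hC : IsAdicComplete m C := isAdicComplete_of_finite
  have hC' : IsAdicComplete (m.map (algebraMap B C)) C :=
    (IsAdicComplete.map_algebraMap_iff _ _).mpr hC
  set I := m.map (algebraMap B C)
  have hart : IsArtinianRing (C ⧸ I) := by
    let _ : Field (B ⧸ m) := Ideal.Quotient.field m
    have : Module.Finite (B ⧸ m) (C ⧸ I) := Module.Finite.of_restrictScalars_finite B _ _
    exact IsArtinianRing.of_finite (B ⧸ m) (C ⧸ I)
  let f : C := ⟨a, Algebra.subset_adjoin rfl⟩
  have hunit : ∀ x : C, IsUnit (Ideal.Quotient.mk I x) → IsUnit (x : Module.End B L) := by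
    intro x hx
    have hx' : IsUnit x := by
      obtain ⟨y, hy⟩ := hx.exists_right_inv
      obtain ⟨y, rfl⟩ := Ideal.Quotient.mk_surjective y
      rw [← map_mul, ← map_one (Ideal.Quotient.mk I), Ideal.Quotient.mk_eq_mk_iff_sub_mem] at hy
      exact isUnit_of_mul_isUnit_left (Ideal.isUnit_of_sub_one_mem_jacobson_bot _
        (IsAdicComplete.le_jacobson_bot I hy))
    exact hx'.map C.subtype
  obtain ⟨e, n, g, hee, heg, hfe⟩ := exists_idempotent_of_isArtinian (Ideal.Quotient.mk I f)
  obtain ⟨e₀, rfl⟩ := Ideal.Quotient.mk_surjective e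
  obtain ⟨e', he', hee'⟩ := exists_isIdempotentElem_of_isAdicComplete I (e := e₀)
    (by rw [← Ideal.Quotient.mk_eq_mk_iff_sub_mem, map_mul, hee])
  have hmk : Ideal.Quotient.mk I e' = Ideal.Quotient.mk I e₀ :=
    (Ideal.Quotient.mk_eq_mk_iff_sub_mem _ _).mpr hee'
  rw [← hmk] at heg hfe
  have hidem : IsIdempotentElem (e' : Module.End B L) := congrArg Subtype.val he'
  rcases hL.2 _ _ (LinearMap.IsIdempotentElem.isCompl hidem) with h | h
  · right
    have h0 : e' = 0 := by
      apply Subtype.ext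
      exact LinearMap.range_eq_bot.mp h
    rw [h0, map_zero, mul_zero] at hfe
    have hb : b = ((1 - f : C) : Module.End B L) := (sub_eq_of_eq_add' hab.symm).symm
    rw [hb]
    refine hunit _ ?_
    rw [map_sub, map_one]
    exact (show IsNilpotent (Ideal.Quotient.mk I f) from ⟨n + 1, hfe.symm⟩).isUnit_one_sub
  · left
    have h1 : e' = 1 := by
      apply Subtype.ext
      refine LinearMap.ext fun x => ?_
      have h2 : (e' : Module.End B L) (x - (e' : Module.End B L) x) = 0 := by
        rw [map_sub, ← Module.End.mul_apply, hidem.eq, sub_self]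
      exact (sub_eq_zero.mp (LinearMap.ker_eq_bot'.mp h _ h2)).symm
    rw [h1, map_one] at heg
    refine hunit f ?_
    rw [pow_succ', mul_assoc] at heg
    exact IsUnit.of_mul_eq_one _ heg.symm

end Henselian

/-! ### Comparison of the radical factors over the base and over the completion -/

theorem isUnit_one_add_smul {A Q : Type*} [CommRing A] [IsLocalRing A] [AddCommGroup Q]
    [Module A Q] [Module.Finite A Q] {r : A} (hr : r ∈ IsLocalRing.maximalIdeal A)
    (s : Module.End A Q) : IsUnit (1 + r • s) := by
  have hsurj : Function.Surjective (1 + r • s : Module.End A Q) := by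
    rw [← LinearMap.range_eq_top]
    refine top_le_iff.mp (Submodule.le_of_le_smul_of_le_jacobson_bot
      (I := IsLocalRing.maximalIdeal A) Module.Finite.fg_top
      (IsLocalRing.maximalIdeal_le_jacobson _) ?_)
    intro c _
    have : c = (1 + r • s : Module.End A Q) c - r • s c := by simp
    rw [this]
    exact Submodule.sub_mem_sup ⟨c, rfl⟩ (Submodule.smul_mem_smul hr trivial)
  exact (Module.End.isUnit_iff _).mpr
    ⟨OrzechProperty.injective_of_surjective_endomorphism _ hsurj, hsurj⟩

theorem smul_mem_jacobson {A Q : Type*} [CommRing A] [IsLocalRing A] [AddCommGroup Q]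
    [Module A Q] [Module.Finite A Q] {r : A} (hr : r ∈ IsLocalRing.maximalIdeal A)
    (s : Module.End A Q) : r • s ∈ Ring.jacobson (Module.End A Q) := by
  rw [mem_jacobson_iff_isUnit]
  intro y
  rw [mul_smul_comm]
  exact isUnit_one_add_smul hr _

theorem smul_mem_homRad {A Q X : Type*} [CommRing A] [IsLocalRing A] [AddCommGroup Q]
    [Module A Q] [Module.Finite A Q] [AddCommGroup X] [Module A X] {r : A}
    (hr : r ∈ IsLocalRing.maximalIdeal A) (h : Q →ₗ[A] X) :
    toHomMod A Q (r • h) ∈ homRad A Q X := by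
  have := comp_mem_homRad (smul_mem_jacobson hr (1 : Module.End A Q)) h
  convert this using 2
  ext x
  simp

theorem toHomMod_surjective {A Q X : Type*} [Ring A] [AddCommGroup Q] [Module A Q]
    [AddCommGroup X] [Module A X] :
    Function.Surjective (toHomMod A Q : (Q →ₗ[A] X) →+ HomMod A Q X) :=
  fun h => ⟨ofHomMod A Q h, rfl⟩

theorem algebraMap_mem_maximalIdeal_completion {R : Type u} [CommRing R] [IsNoetherianRing R]
    [IsLocalRing R] {r : R} (hr : r ∈ IsLocalRing.maximalIdeal R) :
    algebraMap R (RHat R) r ∈ IsLocalRing.maximalIdeal (RHat R) := by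
  rw [AdicCompletion.maximalIdeal_eq_map]
  exact Ideal.mem_map_of_mem _ hr

section Comparison

variable {R : Type u} [CommRing R] [IsDomain R] [IsNoetherianRing R] [IsLocalRing R]
  {M : Type v} [AddCommGroup M] [Module R M] [Module.Finite R M]
  {X : Type w} [AddCommGroup X] [Module R X]

/-- Hom out of `M` commutes with completion, so the decomposition `R̂ = R + r R̂` passes to Hom
modules. -/
theorem exists_baseChange_add_smul (hdim : ringKrullDim R = 1) {r : R} (hr : r ≠ 0)
    (h : MHat R M →ₗ[RHat R] RHat R ⊗[R] X) :
    ∃ (h₀ : M →ₗ[R] X) (h' : MHat R M →ₗ[RHat R] RHat R ⊗[R] X),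
      h = h₀.baseChange (RHat R) + algebraMap R (RHat R) r • h' := by
  obtain ⟨h₀, k, hk⟩ := exists_add_smul_of_isBaseChange
    (isBaseChange_compRight (A := M) (TensorProduct.isBaseChange R X (RHat R)))
    (exists_add_smul_of_completion hdim hr)
    (h.restrictScalars R ∘ₗ TensorProduct.mk R (RHat R) M 1)
  refine ⟨h₀, k.liftBaseChange (RHat R), ?_⟩
  apply TensorProduct.AlgebraTensorModule.curry_injective
  ext m
  have := LinearMap.congr_fun hk m
  simpa using this

theorem endDense_of_finite (hdim : ringKrullDim R = 1) : EndDense R M := by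
  intro s
  obtain ⟨r, hrm, hr⟩ := exists_mem_maximalIdeal_ne_zero hdim
  obtain ⟨t, s', h⟩ := exists_baseChange_add_smul hdim hr s
  refine ⟨t, ?_⟩
  rw [h, add_sub_cancel_left]
  exact smul_mem_jacobson (algebraMap_mem_maximalIdeal_completion hrm) s'

theorem isUnit_add_smul {A Q : Type*} [CommRing A] [IsLocalRing A] [AddCommGroup Q]
    [Module A Q] [Module.Finite A Q] {r : A} (hr : r ∈ IsLocalRing.maximalIdeal A)
    {u : Module.End A Q} (hu : IsUnit u) (s : Module.End A Q) : IsUnit (u + r • s) := by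
  obtain ⟨u, rfl⟩ := hu
  have : (u : Module.End A Q) + r • s = u * (1 + r • ((↑u⁻¹ : Module.End A Q) * s)) := by
    rw [mul_add, mul_one, mul_smul_comm, ← mul_assoc, Units.mul_inv, one_mul]
  rw [this]
  exact u.isUnit.mul (isUnit_one_add_smul hr _)

/-- Surjectivity of `1 + s t` descends by faithful flatness. Conversely, an endomorphism of `M̂` is
a base change plus a multiple of `r`, and adding a multiple of `r` keeps a unit invertible. -/
theorem baseChange_mem_jacobson_iff (hdim : ringKrullDim R = 1) (t : Module.End R M) :
    t.baseChange (RHat R) ∈ Ring.jacobson (Module.End (RHat R) (MHat R M)) ↔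
      t ∈ Ring.jacobson (Module.End R M) := by
  have hbc : ∀ s : Module.End R M, (1 + s * t).baseChange (RHat R) =
      1 + s.baseChange (RHat R) * t.baseChange (RHat R) := fun s => by
    rw [LinearMap.baseChange_add, LinearMap.baseChange_mul, LinearMap.baseChange_one]
  rw [mem_jacobson_iff_isUnit, mem_jacobson_iff_isUnit]
  constructor
  · intro h s
    have h1 := h (s.baseChange (RHat R))
    rw [← hbc, Module.End.isUnit_iff] at h1
    have h2 : Function.Surjective (1 + s * t : Module.End R M) :=
      (Module.FaithfullyFlat.lTensor_surjective_iff_surjective R (RHat R) _).mp h1.2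
    exact (Module.End.isUnit_iff _).mpr
      ⟨OrzechProperty.injective_of_surjective_endomorphism _ h2, h2⟩
  · intro h y
    obtain ⟨r, hrm, hr⟩ := exists_mem_maximalIdeal_ne_zero hdim
    obtain ⟨s, y', rfl⟩ := exists_baseChange_add_smul hdim hr y
    have h1 : IsUnit ((1 + s * t).baseChange (RHat R)) :=
      (h s).map (Module.End.baseChangeHom R (RHat R) M)
    rw [hbc] at h1
    have h2 := isUnit_add_smul (algebraMap_mem_maximalIdeal_completion hrm) h1
      (y' * t.baseChange (RHat R))
    rwa [add_assoc, ← smul_mul_assoc, ← add_mul] at h2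

variable (R M X) in
/-- The map sending a homomorphism to the class of its base change. -/
def homToTop : HomMod R M X →ₗ[(Module.End R M)ᵐᵒᵖ] SimpleMod R M (RHat R ⊗[R] X) where
  toFun h := mkTop R M _ ((ofHomMod R M h).baseChange (RHat R))
  map_add' g h := by rw [map_add, LinearMap.baseChange_add, map_add]
  map_smul' c h := by
    obtain ⟨t, rfl⟩ : ∃ t, c = MulOpposite.op t := ⟨c.unop, rfl⟩
    rw [RingHom.id_apply, smul_mkTop, ← LinearMap.baseChange_comp]
    rfl

theorem homToTop_surjective (hdim : ringKrullDim R = 1) :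
    Function.Surjective (homToTop R M X) := by
  intro y
  obtain ⟨h, rfl⟩ := mkTop_surjective y
  obtain ⟨r, hrm, hr⟩ := exists_mem_maximalIdeal_ne_zero hdim
  obtain ⟨h₀, h', rfl⟩ := exists_baseChange_add_smul hdim hr h
  refine ⟨toHomMod R M h₀, ?_⟩
  rw [map_add, mkTop_eq_zero_iff.mpr
    (smul_mem_homRad (algebraMap_mem_maximalIdeal_completion hrm) h'), add_zero]
  rfl

theorem ker_homToTop (hdim : ringKrullDim R = 1) :
    LinearMap.ker (homToTop R M X) = homRad R M X := by
  obtain ⟨r, hrm, hr⟩ := exists_mem_maximalIdeal_ne_zero hdim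
  apply le_antisymm
  · intro h hh
    obtain ⟨h, rfl⟩ := toHomMod_surjective h
    have h1 : toHomMod (RHat R) (MHat R M) (h.baseChange (RHat R)) ∈
        homRad (RHat R) (MHat R M) (RHat R ⊗[R] X) := mkTop_eq_zero_iff.mp hh
    -- Modulo `r`, every radical map over the completion comes from a radical map over `R`.
    have key : ∀ z ∈ homRad (RHat R) (MHat R M) (RHat R ⊗[R] X), ∃ h₁ : M →ₗ[R] X,
        toHomMod R M h₁ ∈ homRad R M X ∧ ∃ z' : MHat R M →ₗ[RHat R] RHat R ⊗[R] X,
          ofHomMod _ _ z = h₁.baseChange (RHat R) + algebraMap R (RHat R) r • z' := by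
      intro z hz
      induction hz using Submodule.smul_induction_on' with
      | smul c hc n hn =>
        obtain ⟨j, rfl⟩ : ∃ s, c = MulOpposite.op s := ⟨c.unop, rfl⟩
        rw [op_mem_jacobson_iff] at hc
        obtain ⟨p, rfl⟩ := toHomMod_surjective n
        obtain ⟨p₀, p', rfl⟩ := exists_baseChange_add_smul hdim hr p
        obtain ⟨t, j', hj⟩ := exists_baseChange_add_smul hdim hr j
        have ht : t ∈ Ring.jacobson (Module.End R M) := by
          rw [← baseChange_mem_jacobson_iff hdim, eq_sub_of_add_eq hj.symm]
          exact sub_mem hc (smul_mem_jacobson (algebraMap_mem_maximalIdeal_completion hrm) j')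
        refine ⟨p₀ ∘ₗ t, comp_mem_homRad ht p₀, p₀.baseChange (RHat R) ∘ₗ j' + p' ∘ₗ j, ?_⟩
        rw [smul_toHomMod]
        change (p₀.baseChange (RHat R) + algebraMap R (RHat R) r • p') ∘ₗ j = _
        rw [LinearMap.add_comp, LinearMap.smul_comp, smul_add, LinearMap.baseChange_comp,
          ← add_assoc]
        congr 1
        conv_lhs => rw [hj]
        rw [LinearMap.comp_add, LinearMap.comp_smul]
      | add x hx y hy ihx ihy =>
        obtain ⟨h₁, hh₁, z₁, e₁⟩ := ihx
        obtain ⟨h₂, hh₂, z₂, e₂⟩ := ihy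
        refine ⟨h₁ + h₂, ?_, z₁ + z₂, ?_⟩
        · rw [map_add]; exact add_mem hh₁ hh₂
        · rw [map_add, e₁, e₂, LinearMap.baseChange_add, smul_add]; abel
    obtain ⟨h₁, hh₁, z', hz'⟩ := key _ h1
    -- Divisibility of `h - h₁` by `r` holds after completion, hence before it.
    obtain ⟨k, hk⟩ := mem_range_of_isBaseChange (j := LinearMap.compRight R
        (TensorProduct.mk R (RHat R) X 1) (M := M))
      (LinearMap.lsmul R (M →ₗ[R] X) r)
      (LinearMap.lsmul (RHat R) (M →ₗ[R] RHat R ⊗[R] X) (algebraMap R (RHat R) r))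
      (isBaseChange_compRight (TensorProduct.isBaseChange R X (RHat R)))
      (isBaseChange_compRight (TensorProduct.isBaseChange R X (RHat R)))
      (fun g => by ext m; simp [TensorProduct.smul_tmul']) (w := h - h₁)
      ⟨z'.restrictScalars R ∘ₗ TensorProduct.mk R (RHat R) M 1, by
        refine LinearMap.ext fun m => ?_
        have := LinearMap.congr_fun hz' (1 ⊗ₜ m)
        have h2 : (1 : RHat R) ⊗ₜ[R] h m = 1 ⊗ₜ h₁ m + algebraMap R (RHat R) r • z' (1 ⊗ₜ m) :=
          this
        simp [TensorProduct.tmul_sub, h2]⟩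
    have h3 : h = h₁ + r • k := by
      have : r • k = h - h₁ := hk
      rw [this, add_sub_cancel]
    rw [h3, map_add]
    exact add_mem hh₁ (smul_mem_homRad hrm k)
  · refine Submodule.smul_le.mpr fun c hc n _ => ?_
    obtain ⟨j, rfl⟩ : ∃ s, c = MulOpposite.op s := ⟨c.unop, rfl⟩
    rw [op_mem_jacobson_iff, ← baseChange_mem_jacobson_iff hdim] at hc
    obtain ⟨p, rfl⟩ := toHomMod_surjective n
    rw [LinearMap.mem_ker, smul_toHomMod]
    refine mkTop_eq_zero_iff.mpr ?_
    change toHomMod _ _ ((p ∘ₗ j).baseChange (RHat R)) ∈ _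
    rw [LinearMap.baseChange_comp]
    exact comp_mem_homRad hc _

/-- The radical factor of `Hom_R(M, X)` agrees with that of its base change to the completion. -/
theorem nonempty_homTop_linearEquiv (hdim : ringKrullDim R = 1) :
    Nonempty (HomTop R M X ≃ₗ[(Module.End R M)ᵐᵒᵖ] SimpleMod R M (RHat R ⊗[R] X)) :=
  ⟨(Submodule.quotEquivOfEq _ _ (ker_homToTop hdim).symm).trans
    ((homToTop R M X).quotKerEquivOfSurjective (homToTop_surjective hdim))⟩

end Comparison

/-! ### Extending homomorphisms up to denominators -/

theorem isField_localization_of_mem_minimalPrimes {B : Type*} [CommRing B] [IsReduced B]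
    {P : Ideal B} [P.IsPrime] (hP : P ∈ minimalPrimes B) : IsField (Localization.AtPrime P) := by
  have : Ring.KrullDimLE 0 (Localization.AtPrime P) := .of_isLocalization _ hP _
  have : IsReduced (Localization.AtPrime P) :=
    isReduced_localizationPreserves P.primeCompl (Localization.AtPrime P) ‹_›
  exact Ring.KrullDimLE.isField_of_isReduced

/-- A finitely generated submodule is a retract locally at a prime whose local ring is a field. -/
theorem exists_smul_retraction {B C : Type*} [CommRing B] [IsNoetherianRing B] [AddCommGroup C]
    [Module B C] [Module.Finite B C] (P : Ideal B) [P.IsPrime]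
    (hP : IsField (Localization.AtPrime P)) (Y : Submodule B C) :
    ∃ b ∉ P, ∃ ρ : C →ₗ[B] Y, ∀ y : Y, ρ y = b • y := by
  have := Module.finitePresentation_of_finite B C
  let K := Localization.AtPrime P
  let _ : Field K := hP.toField
  let mC := TensorProduct.mk B K C 1
  let mY := TensorProduct.mk B K Y 1
  have hmY : IsLocalizedModule P.primeCompl mY := inferInstance
  have hinj : Function.Injective (Y.subtype.baseChange K) :=
    Module.Flat.lTensor_preserves_injective_linearMap (M := K) Y.subtype Subtype.val_injective
  obtain ⟨g, hg⟩ := (Y.subtype.baseChange K).exists_leftInverse_of_injective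
    (LinearMap.ker_eq_bot.mpr hinj)
  -- Denominators are cleared twice: `s` turns the splitting over the field into a map `C → Y`, and
  -- `t` turns equality after localization into equality.
  obtain ⟨h, s, hs⟩ := Module.FinitePresentation.exists_lift_of_isLocalizedModule P.primeCompl mY
    (g.restrictScalars B ∘ₗ mC)
  obtain ⟨t, ht⟩ := Module.Finite.exists_smul_of_comp_eq_of_isLocalizedModule P.primeCompl mY
    (h ∘ₗ Y.subtype) ((s : B) • LinearMap.id) (by
      refine LinearMap.ext fun y => ?_
      have h1 := LinearMap.congr_fun hs y
      have h2 : g (1 ⊗ₜ[B] (y : C)) = 1 ⊗ₜ[B] y := LinearMap.congr_fun hg (1 ⊗ₜ y)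
      change mY (h y) = s.1 • g (1 ⊗ₜ[B] (y : C)) at h1
      rw [h2] at h1
      change mY (h y) = mY (s.1 • y)
      rw [h1, map_smul]
      rfl)
  refine ⟨t * s, (t * s).2, (t : B) • h, fun y => ?_⟩
  have h1 := LinearMap.congr_fun ht y
  rw [mul_smul]
  exact h1

/-- The image of a submodule in a base change generates its base change. -/
theorem isBaseChange_codRestrict {R B X N : Type*} [CommRing R] [CommRing B] [Algebra R B]
    [Module.Flat R B] [AddCommGroup X] [Module R X] [AddCommGroup N] [Module R N] [Module B N]
    [IsScalarTower R B N] {ε : X →ₗ[R] N} (hε : IsBaseChange B ε) (A : Submodule R X)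
    {C : Type*} [AddCommGroup C] [Module B C] [Module R C] [IsScalarTower R B C]
    (ι : C →ₗ[B] N) (κ : N →ₗ[B] C) (hAC : ∀ x ∈ A, ι (κ (ε x)) = ε x)
    (Y : Submodule B C) (hY : Y = Submodule.span B ((fun x => κ (ε x)) '' A))
    (j : A →ₗ[R] Y) (hj : ∀ a : A, (j a : C) = κ (ε a)) : IsBaseChange B j := by
  have hval : ∀ z : B ⊗[R] A, (((j.liftBaseChange B z : Y)) : C) =
      κ (hε.equiv (A.subtype.lTensor B z)) := by
    intro z
    induction z with
    | zero => simp
    | add x y hx hy => simp only [map_add, Submodule.coe_add, hx, hy]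
    | tmul b a => simp [IsBaseChange.equiv_tmul, hj]
  have hret : ∀ z : B ⊗[R] A, ι (κ (hε.equiv (A.subtype.lTensor B z))) =
      hε.equiv (A.subtype.lTensor B z) := by
    intro z
    induction z with
    | zero => simp
    | add x y hx hy => simp only [map_add, hx, hy]
    | tmul b a => simp [IsBaseChange.equiv_tmul, hAC]
  refine IsBaseChange.of_equiv (LinearEquiv.ofBijective (j.liftBaseChange B) ⟨?_, ?_⟩)
    (fun a => by change j.liftBaseChange B (1 ⊗ₜ a) = _; simp)
  · rw [injective_iff_map_eq_zero]
    intro z hz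
    have h1 : hε.equiv (A.subtype.lTensor B z) = 0 := by
      rw [← hret, ← hval, hz]; simp
    rw [LinearEquiv.map_eq_zero_iff] at h1
    exact (injective_iff_map_eq_zero _).mp (Module.Flat.lTensor_preserves_injective_linearMap
      (M := B) A.subtype Subtype.val_injective) z h1
  · rw [← LinearMap.range_eq_top, eq_top_iff]
    rintro ⟨y, hy⟩ -
    have hy' := hy
    rw [hY] at hy'
    suffices y ∈ (LinearMap.range (j.liftBaseChange B)).map Y.subtype by
      obtain ⟨y', h1, h2⟩ := this
      have : y' = ⟨y, hy⟩ := Subtype.ext h2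
      exact this ▸ h1
    refine Submodule.span_le.mpr ?_ hy'
    rintro _ ⟨a, ha, rfl⟩
    exact ⟨j ⟨a, ha⟩, ⟨1 ⊗ₜ ⟨a, ha⟩, by simp⟩, hj ⟨a, ha⟩⟩

section Extension

variable {R : Type u} [CommRing R] [IsDomain R] [IsNoetherianRing R] [IsLocalRing R]
  [IsReduced (RHat R)]

/-- The scalars `b` for which `b • id` on `Y` extends to `C` form an ideal. At each minimal prime
the local ring is a field and `Y` splits off, so the ideal lies in no minimal prime. -/
theorem exists_pow_smul_extension (hdim : ringKrullDim R = 1) {r : R}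
    (hrm : r ∈ IsLocalRing.maximalIdeal R) (hr : r ≠ 0) {C : Type*} [AddCommGroup C]
    [Module (RHat R) C] [Module.Finite (RHat R) C] (Y : Submodule (RHat R) C) :
    ∃ (t : ℕ) (ρ : C →ₗ[RHat R] Y), ∀ y : Y, ρ y = algebraMap R (RHat R) r ^ t • y := by
  have := isNoetherianRing_completion hdim
  let I : Ideal (RHat R) :=
    { carrier := {b | ∃ ρ : C →ₗ[RHat R] Y, ∀ y : Y, ρ y = b • y}
      zero_mem' := ⟨0, fun y => by simp⟩
      add_mem' := by
        rintro a b ⟨ρ, hρ⟩ ⟨ρ', hρ'⟩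
        exact ⟨ρ + ρ', fun y => by rw [LinearMap.add_apply, hρ, hρ', add_smul]⟩
      smul_mem' := by
        rintro c a ⟨ρ, hρ⟩
        exact ⟨c • ρ, fun y => by rw [LinearMap.smul_apply, hρ, smul_smul, smul_eq_mul]⟩ }
  exact exists_pow_mem_of_forall_not_le hdim hrm hr I fun P hP hle => by
    have hPp : P.IsPrime := hP.1.1
    obtain ⟨b, hb, hρ⟩ :=
      exists_smul_retraction P (isField_localization_of_mem_minimalPrimes hP) Y
    exact hb (hle hρ)

/-- Inside `C` the submodule generated by `A` is its base change, so `ψ` extends to it, and `r ^ t`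
carries the extension to `C` and then to `N`. The exponent depends on `A` but not on `ψ`. -/
theorem exists_pow_smul_hom_extension (hdim : ringKrullDim R = 1) {r : R}
    (hrm : r ∈ IsLocalRing.maximalIdeal R) (hr : r ≠ 0) {X N C Gc : Type*} [AddCommGroup X]
    [Module R X] [AddCommGroup N] [Module R N] [Module (RHat R) N] [IsScalarTower R (RHat R) N]
    {ε : X →ₗ[R] N} (hε : IsBaseChange (RHat R) ε) (A : Submodule R X)
    [AddCommGroup C] [Module (RHat R) C] [Module.Finite (RHat R) C]
    (ι : C →ₗ[RHat R] N) (κ : N →ₗ[RHat R] C) (hAC : ∀ x ∈ A, ι (κ (ε x)) = ε x)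
    [AddCommGroup Gc] [Module R Gc] [Module (RHat R) Gc] [IsScalarTower R (RHat R) Gc] :
    ∃ t : ℕ, ∀ ψ : A →ₗ[R] Gc, ∃ Ψ : N →ₗ[RHat R] Gc, ∀ a : A, Ψ (ε a) = r ^ t • ψ a := by
  let _ : Module R C := Module.compHom C (algebraMap R (RHat R))
  have : IsScalarTower R (RHat R) C := IsScalarTower.of_algebraMap_smul fun _ _ => rfl
  let Y : Submodule (RHat R) C := Submodule.span (RHat R) ((fun x => κ (ε x)) '' A)
  let j : A →ₗ[R] Y := LinearMap.codRestrict (Y.restrictScalars R)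
    (κ.restrictScalars R ∘ₗ ε ∘ₗ A.subtype) fun a => Submodule.subset_span ⟨a, a.2, rfl⟩
  have hj := isBaseChange_codRestrict hε A ι κ hAC Y rfl j fun _ => rfl
  obtain ⟨t, ρ, hρ⟩ := exists_pow_smul_extension hdim hrm hr Y
  refine ⟨t, fun ψ => ⟨hj.lift ψ ∘ₗ ρ ∘ₗ κ, fun a => ?_⟩⟩
  have h1 : ρ (κ (ε a)) = algebraMap R (RHat R) r ^ t • j a := hρ (j a)
  rw [LinearMap.comp_apply, LinearMap.comp_apply, h1, map_smul, hj.lift_eq, ← map_pow,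
    algebraMap_smul]

end Extension

/-! ### Lattices in modules of constant rank -/

section Patching

variable {B : Type u} [CommRing B]

theorem algebraMap_localization_eq_zero [IsReduced B] {P : Ideal B} [P.IsPrime] (hP : P ∈ minimalPrimes B)
    {b : B} (hb : b ∈ P) : algebraMap B (Localization.AtPrime P) b = 0 := by
  by_contra h
  let _ := (isField_localization_of_mem_minimalPrimes hP).toField
  exact (IsLocalization.AtPrime.isUnit_to_map_iff (Localization.AtPrime P) P b).mp
    (Ne.isUnit h) hb

theorem mem_of_algebraMap_localization_eq_zero {P : Ideal B} [P.IsPrime]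
    {b : B} (hb : algebraMap B (Localization.AtPrime P) b = 0) : b ∈ P := by
  by_contra h
  have := (IsLocalization.AtPrime.isUnit_to_map_iff (Localization.AtPrime P) P b).mpr h
  rw [hb] at this
  exact not_isUnit_zero this

theorem exists_mem_forall_ne_notMem [IsNoetherianRing B] (P : minimalPrimes B) :
    ∃ e : B, e ∉ P.1 ∧ ∀ Q : minimalPrimes B, Q ≠ P → e ∈ Q.1 := by
  classical
  have := (minimalPrimes.finite_of_isNoetherianRing B).fintype
  have hP : P.1.IsPrime := P.2.1.1
  have h1 : ∀ Q : minimalPrimes B, ∃ e : B, e ∉ P.1 ∧ (Q ≠ P → e ∈ Q.1) := by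
    intro Q
    by_cases hQ : Q = P
    · exact ⟨1, (Ideal.ne_top_iff_one _).mp hP.ne_top, fun h => absurd hQ h⟩
    · have : ¬ Q.1 ≤ P.1 := fun hle =>
        hQ (Subtype.ext (le_antisymm hle (P.2.2 ⟨Q.2.1.1, bot_le⟩ hle)))
      obtain ⟨e, he, he'⟩ := Set.not_subset.mp this
      exact ⟨e, he', fun _ => he⟩
  choose e he he' using h1
  refine ⟨∏ Q, e Q, fun h => ?_, fun Q hQ => ?_⟩
  · obtain ⟨Q, -, hQ⟩ := (Ideal.IsPrime.prod_mem_iff (hp := hP)).mp h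
    exact he Q hQ
  · rw [← Finset.mul_prod_erase _ _ (Finset.mem_univ Q)]
    exact Ideal.mul_mem_right _ _ (he' Q hQ)

theorem exists_smul_eq_of_mem_span_localization {N : Type*} [AddCommGroup N] [Module B N]
    (P : Ideal B) [P.IsPrime] (W : Submodule B N) {z : Localization.AtPrime P ⊗[B] N}
    (hz : z ∈ Submodule.span (Localization.AtPrime P)
      (TensorProduct.mk B (Localization.AtPrime P) N 1 '' W)) :
    ∃ b ∉ P, ∃ w ∈ W, b • z = 1 ⊗ₜ w := by
  have hone : (1 : B) ∉ P := (Ideal.ne_top_iff_one _).mp (Ideal.IsPrime.ne_top ‹_›)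
  induction hz using Submodule.span_induction with
  | mem z hz =>
    obtain ⟨w, hw, rfl⟩ := hz
    exact ⟨1, hone, w, hw, one_smul _ _⟩
  | zero => exact ⟨1, hone, 0, zero_mem _, by simp⟩
  | add x y _ _ hx hy =>
    obtain ⟨b, hb, w, hw, e⟩ := hx
    obtain ⟨b', hb', w', hw', e'⟩ := hy
    refine ⟨b * b', fun h => (Ideal.IsPrime.mem_or_mem ‹_› h).elim hb hb', b' • w + b • w',
      add_mem (W.smul_mem _ hw) (W.smul_mem _ hw'), ?_⟩
    rw [smul_add, mul_smul b b' y, e', mul_comm, mul_smul, e, TensorProduct.tmul_add,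
      TensorProduct.tmul_smul, TensorProduct.tmul_smul]
  | smul a x _ hx =>
    obtain ⟨b, hb, w, hw, e⟩ := hx
    obtain ⟨⟨c, s⟩, hs⟩ := IsLocalization.surj P.primeCompl a
    refine ⟨s * b, fun h => (Ideal.IsPrime.mem_or_mem ‹_› h).elim s.2 hb, c • w,
      W.smul_mem _ hw, ?_⟩
    have h1 : (s : B) • a = algebraMap B _ c := by rw [← hs, Algebra.smul_def, mul_comm]
    rw [mul_smul, smul_comm b a x, e, ← smul_assoc, h1, algebraMap_smul, TensorProduct.tmul_smul]

/-- A countably generated module of constant rank contains a free submodule which is locally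
the whole module at the minimal primes. -/
theorem exists_linearIndependent_of_rank_eq [IsNoetherianRing B] [IsReduced B] [Nontrivial B]
    {N : Type w'} [AddCommGroup N]
    [Module B N] (hN : IsCountablyGenerated B N)
    (hrank : ∀ (P Q : Ideal B) [P.IsPrime] [Q.IsPrime], P ∈ minimalPrimes B →
      Q ∈ minimalPrimes B →
      Cardinal.toENat (Module.rank (Localization.AtPrime P) (Localization.AtPrime P ⊗[B] N)) =
        Cardinal.toENat (Module.rank (Localization.AtPrime Q) (Localization.AtPrime Q ⊗[B] N))) :
    ∃ (κ : Type (max u w')) (v : κ → N), LinearIndependent B v ∧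
      ∀ n, ∀ P ∈ minimalPrimes B, ∃ b ∉ P, b • n ∈ Submodule.span B (Set.range v) := by
  classical
  have := (minimalPrimes.finite_of_isNoetherianRing B).fintype
  obtain ⟨S, hS, hStop⟩ := hN
  have hprime : ∀ P : minimalPrimes B, P.1.IsPrime := fun P => P.2.1.1
  let K : minimalPrimes B → Type u := fun P => Localization.AtPrime P.1
  let _ : ∀ P, Field (K P) := fun P =>
    (isField_localization_of_mem_minimalPrimes P.2).toField
  have hspan : ∀ P : minimalPrimes B,
      ⊤ ≤ Submodule.span (K P) (TensorProduct.mk B (K P) N 1 '' S) := by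
    intro P
    have h1 : (Submodule.span B S).baseChange (K P) = ⊤ := by
      rw [hStop, Submodule.baseChange_top]
    rw [Submodule.baseChange_span] at h1
    exact h1.ge
  let b : ∀ P, Module.Basis _ (K P) (K P ⊗[B] N) := fun P => Module.Basis.ofSpan (hspan P)
  have hb : ∀ P i, ∃ n : N, 1 ⊗ₜ n = b P i := fun P i => by
    obtain ⟨n, -, h⟩ := Module.Basis.ofSpan_subset (hspan P) ⟨i, rfl⟩
    exact ⟨n, h⟩
  choose n hn using hb
  obtain ⟨P₀⟩ : Nonempty (minimalPrimes B) := by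
    obtain ⟨P, hP⟩ := Ideal.nonempty_minimalPrimes (I := (⊥ : Ideal B)) bot_ne_top
    exact ⟨⟨P, hP⟩⟩
  -- Extended natural numbers cannot separate infinite cardinals; countability upgrades equality of
  -- ranks to a bijection between bases.
  have hcount : ∀ P, Module.rank (K P) (K P ⊗[B] N) ≤ Cardinal.aleph0 := by
    intro P
    have h1 := rank_span_le (R := K P) (TensorProduct.mk B (K P) N 1 '' S)
    rw [top_le_iff.mp (hspan P), rank_top] at h1
    exact h1.trans (Cardinal.le_aleph0_iff_set_countable.mpr (hS.image _))
  have hequiv : ∀ P, Nonempty (_ ≃ _) := fun P => Cardinal.eq.mp <|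
    ((b P₀).mk_eq_rank''.trans (Cardinal.toENat_injOn (hcount P₀) (hcount P)
      (hrank P₀.1 P.1 P₀.2 P.2))).trans (b P).mk_eq_rank''.symm
  let σ := fun P => (hequiv P).some
  choose e he he' using exists_mem_forall_ne_notMem (B := B)
  -- As `e P` vanishes at every other minimal prime and is a unit at `P`, the family `v` becomes at
  -- each `P` a unit rescaling of the chosen basis there.
  let v := fun t => ∑ P, e P • n P (σ P t)
  have hunit : ∀ Q : minimalPrimes B, IsUnit (algebraMap B (K Q) (e Q)) := fun Q =>
    (IsLocalization.AtPrime.isUnit_to_map_iff (Localization.AtPrime Q.1) Q.1 _).mpr (he Q)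
  have hv : ∀ Q t, (1 : K Q) ⊗ₜ[B] v t = algebraMap B (K Q) (e Q) • b Q (σ Q t) := by
    intro Q t
    have h1 : ∀ P, (1 : K Q) ⊗ₜ[B] (e P • n P (σ P t)) =
        algebraMap B (K Q) (e P) • (1 : K Q) ⊗ₜ[B] n P (σ P t) := fun P => by
      rw [TensorProduct.tmul_smul, algebraMap_smul]
    rw [TensorProduct.tmul_sum, Finset.sum_eq_single Q]
    · rw [h1, hn]
    · intro P _ hPQ
      rw [h1, algebraMap_localization_eq_zero Q.2 (he' P Q hPQ.symm), zero_smul]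
    · exact fun h => absurd (Finset.mem_univ _) h
  let bv : ∀ Q, Module.Basis _ (K Q) (K Q ⊗[B] N) := fun Q =>
    ((b Q).reindex (σ Q).symm).isUnitSMul (w := fun _ => algebraMap B (K Q) (e Q))
      fun _ => hunit Q
  have hbv : ∀ Q t, bv Q t = 1 ⊗ₜ v t := by
    intro Q t
    rw [hv, Module.Basis.isUnitSMul_apply, Module.Basis.reindex_apply, Equiv.symm_symm]
  refine ⟨_, v, ?_, ?_⟩
  · rw [linearIndependent_iff]
    intro c hc
    ext t
    -- Coefficients of a relation lie in every minimal prime, and these intersect in zero because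
    -- `B` is reduced.
    have hmem : ∀ Q : minimalPrimes B, c t ∈ Q.1 := by
      intro Q
      have h1 : ∑ i ∈ c.support, algebraMap B (K Q) (c i) • bv Q i = 0 := by
        have h2 : (1 : K Q) ⊗ₜ[B] Finsupp.linearCombination B v c = 0 := by
          rw [hc, TensorProduct.tmul_zero]
        rw [Finsupp.linearCombination_apply, Finsupp.sum, TensorProduct.tmul_sum] at h2
        rw [← h2]
        refine Finset.sum_congr rfl fun i _ => ?_
        rw [hbv, TensorProduct.tmul_smul, algebraMap_smul]
      by_cases ht : t ∈ c.support
      · exact mem_of_algebraMap_localization_eq_zero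
          (linearIndependent_iff'.mp (bv Q).linearIndependent _ _ h1 t ht)
      · rw [Finsupp.notMem_support_iff.mp ht]
        exact zero_mem _
    have h2 : c t ∈ sInf (minimalPrimes B) := Ideal.mem_sInf.mpr fun {Q} hQ => hmem ⟨Q, hQ⟩
    have h3 : sInf (minimalPrimes B) = ⊥ := by
      have := Ideal.sInf_minimalPrimes (I := (⊥ : Ideal B))
      rw [Ideal.radical_bot_of_isReduced] at this
      exact this
    rw [h3] at h2
    exact h2
  · intro x P hP
    let Q : minimalPrimes B := ⟨P, hP⟩
    have : P.IsPrime := hP.1.1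
    have h1 : (1 : K Q) ⊗ₜ[B] x ∈ Submodule.span (K Q)
        (TensorProduct.mk B (K Q) N 1 '' (Submodule.span B (Set.range v))) := by
      have h2 : (1 : K Q) ⊗ₜ[B] x ∈ Submodule.span (K Q) (Set.range (bv Q)) := by
        rw [(bv Q).span_eq]; trivial
      refine Submodule.span_mono ?_ h2
      rintro _ ⟨t, rfl⟩
      exact ⟨v t, Submodule.subset_span ⟨t, rfl⟩, (hbv Q t).symm⟩
    obtain ⟨c, hc, y, hy, e⟩ := exists_smul_eq_of_mem_span_localization P _ h1
    have h3 : TensorProduct.mk B (Localization.AtPrime P) N 1 (c • x) =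
        TensorProduct.mk B (Localization.AtPrime P) N 1 y := by
      rw [map_smul]; exact e
    obtain ⟨d, hd⟩ := IsLocalizedModule.exists_of_eq (S := P.primeCompl) h3
    refine ⟨d * c, fun h => (Ideal.IsPrime.mem_or_mem ‹_› h).elim d.2 hc, ?_⟩
    rw [mul_smul]
    have hd' : (d : B) • c • x = (d : B) • y := hd
    rw [hd']
    exact Submodule.smul_mem _ _ hy

end Patching

/-- Countably many generators of `N` involve only countably many elements of `X`; the submodule
these span has full base change, so it is `X` by faithful flatness. -/
theorem isCountablyGenerated_of_isBaseChange {R : Type u} [CommRing R] [IsNoetherianRing R]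
    [IsLocalRing R] {N : Type w'} [AddCommGroup N] [Module R N] [Module (RHat R) N]
    [IsScalarTower R (RHat R) N] {X : Type*} [AddCommGroup X] [Module R X]
    {ε : X →ₗ[R] N} (hε : IsBaseChange (RHat R) ε) (hN : IsCountablyGenerated (RHat R) N) :
    IsCountablyGenerated R X := by
  obtain ⟨S, hS, hStop⟩ := hN
  have h1 : ∀ n : N, ∃ T : Finset X, n ∈ Submodule.span (RHat R) (ε '' T) := by
    classical
    intro n
    induction n using hε.inductionOn with
    | zero => exact ⟨∅, zero_mem _⟩
    | tmul x => exact ⟨{x}, Submodule.subset_span ⟨x, by simp, rfl⟩⟩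
    | smul b n ih =>
      obtain ⟨T, hT⟩ := ih
      exact ⟨T, Submodule.smul_mem _ _ hT⟩
    | add m n hm hn =>
      obtain ⟨T, hT⟩ := hm
      obtain ⟨T', hT'⟩ := hn
      refine ⟨T ∪ T', add_mem (Submodule.span_mono (Set.image_mono ?_) hT)
        (Submodule.span_mono (Set.image_mono ?_) hT')⟩ <;> simp
  choose T hT using h1
  refine ⟨⋃ n ∈ S, (T n : Set X), hS.biUnion fun n _ => (T n).countable_toSet, ?_⟩
  set A := Submodule.span R (⋃ n ∈ S, (T n : Set X))
  have hsurj : Function.Surjective (A.subtype.lTensor (RHat R)) := by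
    have h2 : Function.Surjective ((ε ∘ₗ A.subtype).liftBaseChange (RHat R)) := by
      rw [← LinearMap.range_eq_top, eq_top_iff, ← hStop, Submodule.span_le]
      intro n hn
      refine Submodule.span_le.mpr ?_ (hT n)
      rintro _ ⟨x, hx, rfl⟩
      exact ⟨1 ⊗ₜ ⟨x, Submodule.subset_span (Set.mem_biUnion hn hx)⟩, by simp⟩
    have h3 : ∀ z, (ε ∘ₗ A.subtype).liftBaseChange (RHat R) z =
        hε.equiv (A.subtype.lTensor (RHat R) z) := by
      intro z
      induction z with
      | zero => simp
      | add x y hx hy => simp only [map_add, hx, hy]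
      | tmul b x => simp [IsBaseChange.equiv_tmul]
    intro y
    obtain ⟨z, hz⟩ := h2 (hε.equiv y)
    exact ⟨z, hε.equiv.injective (by rw [← h3, hz])⟩
  have := (Module.FaithfullyFlat.lTensor_surjective_iff_surjective R (RHat R) _).mp hsurj
  rw [← LinearMap.range_eq_top, Submodule.range_subtype] at this
  exact this

section Lattice

variable {R : Type u} [CommRing R] [IsDomain R] [IsNoetherianRing R] [IsLocalRing R]
  {N : Type w'} [AddCommGroup N] [Module R N] [Module (RHat R) N] [IsScalarTower R (RHat R) N]

variable (R) in
/-- The elements which have a nonzero multiple in the span of a family. -/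
def saturatedSpan {κ : Type*} (v : κ → N) : Submodule R N where
  carrier := {x | ∃ r : R, r ≠ 0 ∧ r • x ∈ Submodule.span R (Set.range v)}
  zero_mem' := ⟨1, one_ne_zero, by simp⟩
  add_mem' := by
    rintro x y ⟨a, ha, hx⟩ ⟨b, hb, hy⟩
    refine ⟨a * b, mul_ne_zero ha hb, ?_⟩
    rw [smul_add, mul_smul a b y, mul_comm, mul_smul b a x]
    exact add_mem (Submodule.smul_mem _ _ hx) (Submodule.smul_mem _ _ hy)
  smul_mem' := by
    rintro c x ⟨a, ha, hx⟩
    exact ⟨a, ha, by rw [smul_comm]; exact Submodule.smul_mem _ _ hx⟩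

/-- Injectivity: a nonzero multiple of any tensor is a combination of the `v t`, where independence
applies, and torsion-freeness removes the multiple. Surjectivity: a power of `r` carries each
element of `N` into the `R̂`-span of `v`. -/
theorem isBaseChange_saturatedSpan (hdim : ringKrullDim R = 1)
    (htf : ∀ (r : R) (x : N), r ≠ 0 → r • x = 0 → x = 0) {κ : Type*} {v : κ → N}
    (hv : LinearIndependent (RHat R) v)
    (hloc : ∀ n, ∀ P ∈ minimalPrimes (RHat R), ∃ b ∉ P,
      b • n ∈ Submodule.span (RHat R) (Set.range v)) :
    IsBaseChange (RHat R) (saturatedSpan R v).subtype := by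
  have hvX : ∀ t, v t ∈ saturatedSpan R v := fun t =>
    ⟨1, one_ne_zero, by rw [one_smul]; exact Submodule.subset_span ⟨t, rfl⟩⟩
  let X := saturatedSpan R v
  refine IsBaseChange.of_equiv (LinearEquiv.ofBijective (X.subtype.liftBaseChange (RHat R))
    ⟨?_, ?_⟩) (fun a => by
      change X.subtype.liftBaseChange (RHat R) (1 ⊗ₜ a) = _; simp)
  · rw [injective_iff_map_eq_zero]
    intro z hz
    have h1 : ∀ z : RHat R ⊗[R] X, ∃ (ρ : R) (c : κ →₀ RHat R), ρ ≠ 0 ∧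
        ρ • z = c.sum fun t b => b ⊗ₜ (⟨v t, hvX t⟩ : X) := by
      intro z
      induction z with
      | zero => exact ⟨1, 0, one_ne_zero, by simp⟩
      | add x y hx hy =>
        obtain ⟨ρ, c, hρ, e⟩ := hx
        obtain ⟨ρ', c', hρ', e'⟩ := hy
        refine ⟨ρ * ρ', ρ' • c + ρ • c', mul_ne_zero hρ hρ', ?_⟩
        rw [Finsupp.sum_add_index' (by simp) (by simp [TensorProduct.add_tmul]), smul_add,
          mul_smul ρ ρ' y, e', mul_comm, mul_smul, e, Finsupp.smul_sum, Finsupp.smul_sum,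
          Finsupp.sum_smul_index' (by simp), Finsupp.sum_smul_index' (by simp)]
        rfl
      | tmul b x =>
        obtain ⟨ρ, hρ, hx⟩ := x.2
        obtain ⟨c, hc⟩ := (Finsupp.mem_span_range_iff_exists_finsupp).mp hx
        refine ⟨ρ, c.mapRange (fun a => a • b) (zero_smul _ _), hρ, ?_⟩
        rw [Finsupp.sum_mapRange_index (by simp)]
        have h2 : ρ • x = c.sum fun t a => a • (⟨v t, hvX t⟩ : X) := by
          apply Subtype.ext
          rw [Finsupp.sum, Submodule.coe_sum]
          exact hc.symm
        rw [← TensorProduct.tmul_smul, h2, Finsupp.sum, TensorProduct.tmul_sum]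
        refine Finset.sum_congr rfl fun t _ => ?_
        rw [TensorProduct.tmul_smul, TensorProduct.smul_tmul']
    obtain ⟨ρ, c, hρ, e⟩ := h1 z
    have h2 : Finsupp.linearCombination (RHat R) v c = 0 := by
      have h3 : X.subtype.liftBaseChange (RHat R) (ρ • z) = 0 := by
        rw [← algebraMap_smul (RHat R), map_smul, hz, smul_zero]
      rw [e, Finsupp.sum, map_sum] at h3
      rw [← h3]
      refine Finset.sum_congr rfl fun t _ => ?_
      simp
    rw [linearIndependent_iff.mp hv c h2, Finsupp.sum_zero_index] at e
    have hinj : Function.Injective (LinearMap.lsmul R X ρ) := by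
      rw [injective_iff_map_eq_zero]
      intro x hx
      exact Subtype.ext (htf ρ x hρ (congrArg Subtype.val hx))
    have h4 := Module.Flat.lTensor_preserves_injective_linearMap (M := RHat R) _ hinj
    refine (injective_iff_map_eq_zero _).mp h4 z ?_
    rw [← e]
    clear hz e
    induction z with
    | zero => simp
    | add x y hx hy => rw [map_add, smul_add, hx, hy]
    | tmul b x => simp
  · intro n
    obtain ⟨r, hrm, hr⟩ := exists_mem_maximalIdeal_ne_zero hdim
    let W := Submodule.span (RHat R) (Set.range v)
    let I : Ideal (RHat R) := W.comap (LinearMap.toSpanSingleton (RHat R) N n)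
    obtain ⟨k, hk⟩ := exists_pow_mem_of_forall_not_le hdim hrm hr I fun P hP hle => by
      obtain ⟨b, hb, hbn⟩ := hloc n P hP
      exact hb (hle hbn)
    have hk' : r ^ k • n ∈ W := by
      have : algebraMap R (RHat R) r ^ k • n ∈ W := hk
      rwa [← map_pow, algebraMap_smul] at this
    obtain ⟨c, hc⟩ := (Finsupp.mem_span_range_iff_exists_finsupp).mp hk'
    -- Splitting each coefficient as `ρ + r ^ k b'` leaves, after subtracting the `b'` part, an
    -- element whose `r ^ k`-multiple lies in the `R`-span of `v`, hence an element of `X`.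
    choose ρ b' hb using fun b => exists_add_smul_of_completion hdim (pow_ne_zero k hr) b
    rw [← LinearMap.mem_range]
    have hX : ∀ x ∈ X, x ∈ LinearMap.range (X.subtype.liftBaseChange (RHat R)) := fun x hx =>
      ⟨1 ⊗ₜ ⟨x, hx⟩, by simp⟩
    have h1 : n - ∑ t ∈ c.support, b' (c t) • v t ∈ X := by
      refine ⟨r ^ k, pow_ne_zero k hr, ?_⟩
      have : r ^ k • (n - ∑ t ∈ c.support, b' (c t) • v t) =
          ∑ t ∈ c.support, ρ (c t) • v t := by
        rw [smul_sub, ← hc, Finsupp.sum, Finset.smul_sum, ← Finset.sum_sub_distrib]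
        refine Finset.sum_congr rfl fun t _ => ?_
        conv_lhs => rw [hb (c t)]
        rw [add_smul, algebraMap_smul, smul_assoc, ← hb (c t), add_sub_cancel_right]
      rw [this]
      exact sum_mem fun t _ => Submodule.smul_mem _ _ (Submodule.subset_span ⟨t, rfl⟩)
    have h2 : n = (n - ∑ t ∈ c.support, b' (c t) • v t) + ∑ t ∈ c.support, b' (c t) • v t := by
      abel
    rw [h2]
    exact add_mem (hX _ h1) (sum_mem fun t _ => Submodule.smul_mem _ _ (hX _ (hvX t)))

/-- Every torsion-free module of constant rank over the completion that is countably generated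
comes from the base. -/
theorem exists_isBaseChange_of_rank_eq [IsReduced (RHat R)] (hdim : ringKrullDim R = 1)
    (htf : ∀ (r : R) (x : N), r ≠ 0 → r • x = 0 → x = 0)
    (hN : IsCountablyGenerated (RHat R) N)
    (hrank : ∀ (P Q : Ideal (RHat R)) [P.IsPrime] [Q.IsPrime], P ∈ minimalPrimes (RHat R) →
      Q ∈ minimalPrimes (RHat R) →
      Cardinal.toENat (Module.rank (Localization.AtPrime P) (Localization.AtPrime P ⊗[RHat R] N)) =
        Cardinal.toENat
          (Module.rank (Localization.AtPrime Q) (Localization.AtPrime Q ⊗[RHat R] N))) :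
    ∃ X : Submodule R N, IsCountablyGenerated R X ∧ IsBaseChange (RHat R) X.subtype := by
  have := isNoetherianRing_completion hdim
  obtain ⟨κ, v, hv, hloc⟩ := exists_linearIndependent_of_rank_eq hN hrank
  have h := isBaseChange_saturatedSpan hdim htf hv hloc
  exact ⟨_, isCountablyGenerated_of_isBaseChange h hN, h⟩

end Lattice

/-! ### Countably generated modules whose base change is a direct sum of summands -/

/-- Every finite subset lies in a direct summand which is a retract of a finite power of `Q`. -/
def IsLocallyRetract (A Q N : Type*) [Ring A] [AddCommGroup Q] [Module A Q] [AddCommGroup N]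
    [Module A N] : Prop :=
  ∀ S : Finset N, ∃ (C : Submodule A N) (π : N →ₗ[A] C) (k : ℕ) (a : C →ₗ[A] (Fin k → Q))
    (b : (Fin k → Q) →ₗ[A] C), π ∘ₗ C.subtype = LinearMap.id ∧ b ∘ₗ a = LinearMap.id ∧
      ∀ x ∈ S, x ∈ C

theorem isLocallyRetract_dfinsupp {A Q : Type*} [Ring A] [AddCommGroup Q] [Module A Q]
    {Λ : Type*} {Y : Λ → Type*} [∀ a, AddCommGroup (Y a)] [∀ a, Module A (Y a)]
    (σ : ∀ a, Y a →ₗ[A] Q) (τ : ∀ a, Q →ₗ[A] Y a) (hτσ : ∀ a, τ a ∘ₗ σ a = LinearMap.id) :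
    IsLocallyRetract A Q (Π₀ a, Y a) := by
  classical
  intro S
  obtain ⟨F, hF⟩ := exists_finset_eq_sum_single S fun x : Π₀ a, Y a => x
  let C : Submodule A (Π₀ a, Y a) :=
    { carrier := {x | ∀ a ∉ F, x a = 0}
      zero_mem' := fun a _ => rfl
      add_mem' := fun {x y} hx hy a ha => by rw [DFinsupp.add_apply, hx a ha, hy a ha, add_zero]
      smul_mem' := fun c x hx a ha => by rw [DFinsupp.smul_apply, hx a ha, smul_zero] }
  have hC : ∀ x : Π₀ a, Y a, (∑ t ∈ F, (DFinsupp.single t (x t) : Π₀ a, Y a)) ∈ C := by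
    intro x
    refine sum_mem fun t ht a ha => ?_
    exact DFinsupp.single_eq_of_ne fun h => ha (h ▸ ht)
  have hCsum : ∀ x ∈ C, (∑ t ∈ F, (DFinsupp.single t (x t) : Π₀ a, Y a)) = x := by
    intro x hx
    ext a
    rw [DFinsupp.finsetSum_apply]
    by_cases ha : a ∈ F
    · rw [Finset.sum_eq_single a (fun t _ h => DFinsupp.single_eq_of_ne h.symm)
        (fun h => absurd ha h), DFinsupp.single_eq_same]
    · rw [hx a ha]
      exact Finset.sum_eq_zero fun t ht => DFinsupp.single_eq_of_ne fun h => ha (h ▸ ht)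
  let π₀ : (Π₀ a, Y a) →ₗ[A] Π₀ a, Y a := ∑ t ∈ F, DFinsupp.lsingle t ∘ₗ DFinsupp.lapply t
  have hπ₀ : ∀ x, π₀ x = ∑ t ∈ F, (DFinsupp.single t (x t) : Π₀ a, Y a) := fun x => by
    simp [π₀]
  let π : (Π₀ a, Y a) →ₗ[A] C := π₀.codRestrict C fun x => by rw [hπ₀]; exact hC x
  let φ := F.equivFin
  let a : C →ₗ[A] (Fin F.card → Q) :=
    LinearMap.pi fun j => σ (φ.symm j) ∘ₗ DFinsupp.lapply (φ.symm j).1 ∘ₗ C.subtype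
  let b : (Fin F.card → Q) →ₗ[A] C :=
    π ∘ₗ ∑ t : F, DFinsupp.lsingle (t : Λ) ∘ₗ τ t ∘ₗ LinearMap.proj (φ t)
  refine ⟨C, π, F.card, a, b, ?_, ?_, fun x hx => ?_⟩
  · ext1 x
    exact Subtype.ext ((hπ₀ x).trans (hCsum x x.2))
  · ext1 x
    refine Subtype.ext ?_
    have h1 : (∑ t : F, DFinsupp.lsingle (t : Λ) ∘ₗ τ t ∘ₗ LinearMap.proj (φ t) :
        (Fin F.card → Q) →ₗ[A] Π₀ a, Y a) (a x) = x := by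
      rw [LinearMap.sum_apply]
      conv_rhs => rw [← hCsum x x.2, ← Finset.sum_coe_sort]
      refine Finset.sum_congr rfl fun t _ => ?_
      have h2 : a x (φ t) = σ t (x.1 t) := by
        change σ (φ.symm (φ t)) (x.1 (φ.symm (φ t))) = _
        rw [φ.symm_apply_apply]
      have h3 : τ t (σ t (x.1 t)) = x.1 t := LinearMap.congr_fun (hτσ t) _
      simp only [LinearMap.comp_apply, LinearMap.proj_apply, h2, h3]
      rfl
    change π₀ _ = _
    rw [h1, hπ₀, hCsum x x.2]
    rfl
  · have := hF x hx
    rw [this]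
    exact hC x

section Summand

variable {R : Type u} [CommRing R] [IsDomain R] [IsNoetherianRing R] [IsLocalRing R]
  [IsReduced (RHat R)] {M : Type v} [AddCommGroup M] [Module R M] [Module.Finite R M]

theorem exists_retract_finsupp (hdim : ringKrullDim R = 1) {X N : Type*} [AddCommGroup X]
    [Module R X] [AddCommGroup N] [Module R N] [Module (RHat R) N] [IsScalarTower R (RHat R) N]
    {ε : X →ₗ[R] N} (hε : IsBaseChange (RHat R) ε) (hX : IsCountablyGenerated R X)
    (hN : IsLocallyRetract (RHat R) (MHat R M) N) :
    ∃ (k : ℕ → ℕ) (e : X →ₗ[R] ((Σ n, Fin (k n)) →₀ M))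
      (p : ((Σ n, Fin (k n)) →₀ M) →ₗ[R] X), p ∘ₗ e = LinearMap.id := by
  classical
  have := isNoetherianRing_completion hdim
  obtain ⟨r, hrm, hr⟩ := exists_mem_maximalIdeal_ne_zero hdim
  have hsub : ∀ A : Submodule R X, A.FG → ∃ (C : Submodule (RHat R) N) (π : N →ₗ[RHat R] C)
      (k : ℕ) (a : C →ₗ[RHat R] (Fin k → MHat R M)) (b : (Fin k → MHat R M) →ₗ[RHat R] C),
      π ∘ₗ C.subtype = LinearMap.id ∧ b ∘ₗ a = LinearMap.id ∧ ∀ x ∈ A, ε x ∈ C := by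
    rintro A ⟨S, rfl⟩
    obtain ⟨C, π, k, a, b, h1, h2, h3⟩ := hN (S.image ε)
    refine ⟨C, π, k, a, b, h1, h2, fun x hx => ?_⟩
    suffices Submodule.span R (S : Set X) ≤ (C.restrictScalars R).comap ε from this hx
    exact Submodule.span_le.mpr fun y hy => h3 _ (Finset.mem_image_of_mem _ hy)
  refine exists_retract_of_locally_split hX fun S => ?_
  obtain ⟨C, π, k, a, b, h1, h2, h3⟩ := hsub _ ⟨S, rfl⟩
  have hCfin : Module.Finite (RHat R) C :=
    Module.Finite.of_surjective b fun x => ⟨a x, LinearMap.congr_fun h2 x⟩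
  have hγ := (TensorProduct.isBaseChange R M (RHat R)).finitePow (Fin k)
  obtain ⟨s, hs⟩ := exists_approx_hom hγ hX (r := r)
    (fun t β => exists_add_smul_of_completion hdim (pow_ne_zero t hr) β)
    (fun A hA => by
      obtain ⟨D, π', k', a', b', h1', h2', h3'⟩ := hsub A hA
      have : Module.Finite (RHat R) D :=
        Module.Finite.of_surjective b' fun x => ⟨a' x, LinearMap.congr_fun h2' x⟩
      exact exists_pow_smul_hom_extension hdim hrm hr hε A D.subtype π' fun x hx =>
        congrArg Subtype.val (LinearMap.congr_fun h1' ⟨ε x, h3' x hx⟩))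
    (a ∘ₗ π)
  obtain ⟨p, hp⟩ := exists_local_splitting hε (algebraMap_mem_maximalIdeal_completion hrm)
    C.subtype π h1 a b h2 hs (A := Submodule.span R S) ⟨S, rfl⟩ fun x hx => by
      rw [Submodule.range_subtype]; exact h3 x hx
  exact ⟨k, s, p, fun x hx => hp x (Submodule.subset_span hx)⟩

end Summand

/-! ### Ranks at the minimal primes -/

theorem toENat_mk_sigma {s : ℕ} (A : Fin s → Type*) :
    Cardinal.toENat (Cardinal.mk (Σ i, A i)) = ∑ i, Cardinal.toENat (Cardinal.mk (A i)) := by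
  change ENat.card (Σ i, A i) = ∑ i, ENat.card (A i)
  by_cases h : ∀ i, Finite (A i)
  · simp only [ENat.card_eq_coe_natCard, Nat.card_sigma, Nat.cast_sum]
  · push Not at h
    obtain ⟨i, hi⟩ := h
    have : Infinite (Σ i, A i) :=
      Infinite.of_injective (Sigma.mk i) sigma_mk_injective
    rw [ENat.card_eq_top_of_infinite, eq_comm, ENat.sum_eq_top]
    exact ⟨i, Finset.mem_univ _, ENat.card_eq_top_of_infinite⟩

/-- Grouping a family of finite sets according to a colouring. -/
def sigmaFiberProdEquiv {Λ : Type*} {s : ℕ} (c : Λ → Fin s) (d : Fin s → ℕ) :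
    (Σ a, Fin (d (c a))) ≃ Σ i, {a // c a = i} × Fin (d i) where
  toFun x := ⟨c x.1, ⟨x.1, rfl⟩, x.2⟩
  invFun y := ⟨y.2.1.1, y.2.1.2.symm ▸ y.2.2⟩
  left_inv _ := rfl
  right_inv := by rintro ⟨i, ⟨a, rfl⟩, k⟩; rfl

theorem toENat_rank_tensorProduct_dfinsupp {B K : Type*} [CommRing B] [Field K] [Algebra B K]
    {s : ℕ} {L : Fin s → Type*} [∀ i, AddCommGroup (L i)] [∀ i, Module B (L i)]
    [∀ i, Module.Finite B (L i)] {Λ : Type*} (c : Λ → Fin s) :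
    Cardinal.toENat (Module.rank K (K ⊗[B] (Π₀ a, L (c a)))) =
      ∑ i, (Module.finrank K (K ⊗[B] L i) : ℕ∞) *
        Cardinal.toENat (Cardinal.mk {a // c a = i}) := by
  classical
  have b : Module.Basis (Σ a, Fin (Module.finrank K (K ⊗[B] L (c a)))) K
      (Π₀ a, K ⊗[B] L (c a)) := DFinsupp.basis fun a => Module.finBasis K (K ⊗[B] L (c a))
  have e : (K ⊗[B] (Π₀ a, L (c a))) ≃ₗ[K] Π₀ a, K ⊗[B] L (c a) :=
    TensorProduct.directSumRight B K K fun a => L (c a)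
  have h := congrArg Cardinal.toENat (b.map e.symm).mk_eq_rank
  rw [Cardinal.toENat_lift, Cardinal.toENat_lift] at h
  rw [← h, Cardinal.toENat_congr (sigmaFiberProdEquiv c fun i => Module.finrank K (K ⊗[B] L i)),
    toENat_mk_sigma]
  refine Finset.sum_congr rfl fun i _ => ?_
  simp [mul_comm]

theorem toENat_rank_le_of_lTensor_injective {B K : Type*} [CommRing B] [Field K] [Algebra B K]
    {X : Type*} {Y : Type*} [AddCommGroup X] [Module B X] [AddCommGroup Y] [Module B Y]
    (f : X →ₗ[B] Y) (hf : Function.Injective (f.lTensor K)) :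
    Cardinal.toENat (Module.rank K (K ⊗[B] X)) ≤ Cardinal.toENat (Module.rank K (K ⊗[B] Y)) := by
  have h := LinearMap.lift_rank_le_of_injective (f.baseChange K) hf
  have h1 := OrderHomClass.mono Cardinal.toENat h
  rwa [Cardinal.toENat_lift, Cardinal.toENat_lift] at h1

section Rank

variable {R : Type u} [CommRing R] [IsDomain R] [IsNoetherianRing R] [IsLocalRing R]

theorem toENat_rank_eq_of_simpleMod_equiv (hdim : ringKrullDim R = 1) {M : Type v}
    [AddCommGroup M] [Module R M] [Module.Finite R M]
    {X Y : Type*} [AddCommGroup X] [Module (RHat R) X] [AddCommGroup Y] [Module (RHat R) Y]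
    {ι κ : Type*} (hX : IsSummandOfCopies (RHat R) (MHat R M) X ι)
    (hY : IsSummandOfCopies (RHat R) (MHat R M) Y κ)
    (θ : SimpleMod R M X ≃ₗ[(Module.End R M)ᵐᵒᵖ] SimpleMod R M Y)
    {K : Type w} [Field K] [Algebra (RHat R) K] :
    Cardinal.toENat (Module.rank K (K ⊗[RHat R] X)) =
      Cardinal.toENat (Module.rank K (K ⊗[RHat R] Y)) := by
  have hd := endDense_of_finite (M := M) hdim
  obtain ⟨f, hf⟩ := exists_lTensor_injective.{u, v, w} hd hX hY θ
  obtain ⟨g, hg⟩ := exists_lTensor_injective.{u, v, w} hd hY hX θ.symm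
  exact le_antisymm (toENat_rank_le_of_lTensor_injective f (hf K))
    (toENat_rank_le_of_lTensor_injective g (hg K))

/-- By flatness nonzero elements of `R` are nonzerodivisors of the completion, so they avoid `P`.
Thus `R` embeds in the field at `P`, and the rank of `X` survives the base change. -/
theorem toENat_rank_baseChange [IsReduced (RHat R)] {P : Ideal (RHat R)} [P.IsPrime]
    (hP : P ∈ minimalPrimes (RHat R)) (X : Type w) [AddCommGroup X] [Module R X] :
    Cardinal.toENat (Module.rank (Localization.AtPrime P)
      (Localization.AtPrime P ⊗[RHat R] (RHat R ⊗[R] X))) =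
      Cardinal.toENat (Module.rank R X) := by
  let K := Localization.AtPrime P
  let _ : Field K := (isField_localization_of_mem_minimalPrimes hP).toField
  have hinj : Function.Injective (algebraMap R K) := by
    rw [injective_iff_map_eq_zero]
    intro r hr
    by_contra hr0
    rw [IsScalarTower.algebraMap_apply R (RHat R) K] at hr
    have h1 := mem_of_algebraMap_localization_eq_zero hr
    refine notMem_nonZeroDivisors_of_mem_mem_minimalPrimes h1 hP ?_
    have h3 := Module.Flat.isSMulRegular_of_nonZeroDivisors (M := RHat R)
      (mem_nonZeroDivisors_of_ne_zero hr0)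
    rw [mem_nonZeroDivisors_iff_right]
    intro b hb
    apply h3
    simp only [smul_zero]
    rw [Algebra.smul_def, mul_comm, hb]
  have : FaithfulSMul R K := (faithfulSMul_iff_algebraMap_injective R K).mpr hinj
  have bc := (TensorProduct.isBaseChange R X (RHat R)).comp
    (TensorProduct.isBaseChange (RHat R) (RHat R ⊗[R] X) K)
  have h := congrArg Cardinal.toENat bc.lift_rank_eq
  rwa [Cardinal.toENat_lift, Cardinal.toENat_lift] at h

end Rank

/-! ### The image of the dimension vector map -/

theorem toENat_mk_lt (x : ℕ∞) : Cardinal.toENat (Cardinal.mk {k : ℕ // (k : ℕ∞) < x}) = x := by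
  change ENat.card {k : ℕ // (k : ℕ∞) < x} = x
  induction x using ENat.recTopCoe with
  | top =>
    have : Infinite {k : ℕ // (k : ℕ∞) < ⊤} :=
      Infinite.of_injective (fun k : ℕ => ⟨k, ENat.natCast_lt_top k⟩) fun a b h =>
        congrArg Subtype.val h
    exact ENat.card_eq_top_of_infinite
  | coe n =>
    have e : {k : ℕ // (k : ℕ∞) < n} ≃ Fin n :=
      (Equiv.subtypeEquivRight fun k => Nat.cast_lt).trans Fin.equivSubtype.symm
    rw [ENat.card_congr e]
    simp

theorem isCountablyGenerated_dfinsupp {A : Type*} [Ring A] {Λ : Type*} [Countable Λ]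
    {Y : Λ → Type*} [∀ a, AddCommGroup (Y a)] [∀ a, Module A (Y a)]
    [∀ a, Module.Finite A (Y a)] : IsCountablyGenerated A (Π₀ a, Y a) := by
  classical
  choose T hT using fun a => (Module.Finite.fg_top : (⊤ : Submodule A (Y a)).FG)
  refine ⟨⋃ a, (DFinsupp.lsingle (R := A) (M := Y) a) '' T a,
    Set.countable_iUnion fun a => (T a).countable_toSet.image _, ?_⟩
  rw [Submodule.span_iUnion, ← DFinsupp.iSup_range_lsingle]
  refine iSup_congr fun a => ?_
  rw [Submodule.span_image, hT, Submodule.map_top]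

theorem IsCountablyGenerated.of_linearEquiv {A X Y : Type*} [Ring A] [AddCommGroup X] [Module A X]
    [AddCommGroup Y] [Module A Y] (e : X ≃ₗ[A] Y) (h : IsCountablyGenerated A X) :
    IsCountablyGenerated A Y := by
  obtain ⟨t, ht, htop⟩ := h
  refine ⟨e.toLinearMap '' t, ht.image _, ?_⟩
  rw [Submodule.span_image, htop, Submodule.map_top, LinearEquiv.range]

section

variable {R : Type u} [CommRing R] [IsLocalRing R] {M : Type v} [AddCommGroup M] [Module R M]

theorem nonempty_simpleMod_congr {X Y : Type*} [AddCommGroup X] [Module (RHat R) X]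
    [AddCommGroup Y] [Module (RHat R) Y] (e : X ≃ₗ[RHat R] Y) :
    Nonempty (SimpleMod R M X ≃ₗ[(Module.End R M)ᵐᵒᵖ] SimpleMod R M Y) := by
  refine ⟨LinearEquiv.ofLinearMap (topMap R M e.toLinearMap) (topMap R M e.symm.toLinearMap) ?_ ?_⟩
  · rw [← topMap_comp]
    ext x
    obtain ⟨h, rfl⟩ := mkTop_surjective x
    rw [topMap_mkTop, LinearEquiv.comp_coe, LinearEquiv.symm_trans_self]
    rfl
  · rw [← topMap_comp]
    ext x
    obtain ⟨h, rfl⟩ := mkTop_surjective x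
    rw [topMap_mkTop, LinearEquiv.comp_coe, LinearEquiv.self_trans_symm]
    rfl

theorem isSummandOfCopies_baseChange {X : Type*} [AddCommGroup X] [Module R X] {ι : Type*}
    {e : X →ₗ[R] (ι →₀ M)} {p : (ι →₀ M) →ₗ[R] X} (h : p ∘ₗ e = LinearMap.id) :
    IsSummandOfCopies (RHat R) (MHat R M) (RHat R ⊗[R] X) ι := by
  classical
  let E : (RHat R ⊗[R] (ι →₀ M)) ≃ₗ[RHat R] Π₀ _ : ι, MHat R M :=
    (TensorProduct.finsuppRight R (RHat R) (RHat R) M ι).trans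
      (finsuppLequivDFinsupp (RHat R))
  refine ⟨E.toLinearMap ∘ₗ e.baseChange (RHat R), p.baseChange (RHat R) ∘ₗ E.symm.toLinearMap, ?_⟩
  refine LinearMap.ext fun z => ?_
  change p.baseChange (RHat R) (E.symm (E (e.baseChange (RHat R) z))) = z
  rw [E.symm_apply_apply, ← LinearMap.comp_apply, ← LinearMap.baseChange_comp, h,
    LinearMap.baseChange_id]
  rfl

end

theorem toENat_rank_dfinsupp {R : Type u} [CommRing R] [IsLocalRing R] [IsReduced (RHat R)]
    {s : ℕ} {L : Fin s → Type w} [∀ i, AddCommGroup (L i)] [∀ i, Module (RHat R) (L i)]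
    [∀ i, Module.Finite (RHat R) (L i)]
    {P : Ideal (RHat R)} [P.IsPrime] (hP : P ∈ minimalPrimes (RHat R)) {Λ : Type*}
    (c : Λ → Fin s) :
    Cardinal.toENat (Module.rank (Localization.AtPrime P)
      (Localization.AtPrime P ⊗[RHat R] (Π₀ a, L (c a)))) =
      ∑ i, (rankAt P (L i) : ℕ∞) * Cardinal.toENat (Cardinal.mk {a // c a = i}) := by
  let _ : Field (Localization.AtPrime P) := (isField_localization_of_mem_minimalPrimes hP).toField
  exact toENat_rank_tensorProduct_dfinsupp c

/-! ### Multiplicities as dimension vectors, and the two implications. -/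

section Main

variable {R : Type u} [CommRing R] [IsDomain R] [IsNoetherianRing R] [IsLocalRing R]
  {M : Type v} [AddCommGroup M] [Module R M] [Module.Finite R M]
  {s : ℕ} {L : Fin s → Type w} [∀ i, AddCommGroup (L i)] [∀ i, Module (RHat R) (L i)]

/-- The `V_i` are pairwise non-isomorphic because an isomorphism of tops would lift to one of the `L
i`. -/
theorem homDim_simpleMod_eq (hdim : ringKrullDim R = 1)
    [∀ i, IsLocalRing (Module.End (RHat R) (L i))]
    (hnoniso : ∀ i j, i ≠ j → IsEmpty (L i ≃ₗ[RHat R] L j))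
    {σ : ∀ i, L i →ₗ[RHat R] MHat R M} {τ : ∀ i, MHat R M →ₗ[RHat R] L i}
    (hτσ : ∀ i, τ i ∘ₗ σ i = LinearMap.id) {Λ : Type*} (c : Λ → Fin s)
    {W : Type*} [AddCommGroup W] [Module (Module.End R M)ᵐᵒᵖ W]
    (e : W ≃ₗ[(Module.End R M)ᵐᵒᵖ] Π₀ a, SimpleMod R M (L (c a))) (i : Fin s) :
    homDim (Module.End R M)ᵐᵒᵖ (SimpleMod R M (L i)) W =
      Cardinal.toENat (Cardinal.mk {a // c a = i}) := by
  have hd := endDense_of_finite (M := M) hdim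
  have hs : ∀ i, IsSimpleModule (Module.End R M)ᵐᵒᵖ (SimpleMod R M (L i)) := fun i =>
    isSimpleModule_simpleMod hd (hτσ i)
  rw [homDim_of_linearEquiv_dfinsupp e]
  refine Cardinal.toENat_congr (Equiv.subtypeEquivRight fun a => ⟨?_, ?_⟩)
  · rintro ⟨θ⟩
    by_contra hne
    obtain ⟨f⟩ := nonempty_linearEquiv_of_simpleMod hd (hτσ i) (hτσ (c a)) θ
    exact (hnoniso i (c a) fun h => hne h.symm).false f
  · rintro rfl
    exact ⟨LinearEquiv.refl _ _⟩

/-- Dimension vectors satisfy the rank condition. -/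
theorem sum_rankAt_mul_dimVec [IsReduced (RHat R)] (hdim : ringKrullDim R = 1)
    [∀ i, Module.Finite (RHat R) (L i)] [∀ i, IsLocalRing (Module.End (RHat R) (L i))]
    (hnoniso : ∀ i j, i ≠ j → IsEmpty (L i ≃ₗ[RHat R] L j))
    {σ : ∀ i, L i →ₗ[RHat R] MHat R M} {τ : ∀ i, MHat R M →ₗ[RHat R] L i}
    (hτσ : ∀ i, τ i ∘ₗ σ i = LinearMap.id) {κ : Type*} [Fintype κ] (col : κ → Fin s)
    (σ' : ∀ k, L (col k) →ₗ[RHat R] MHat R M) (τ' : ∀ k, MHat R M →ₗ[RHat R] L (col k))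
    (hστ : ∑ k, σ' k ∘ₗ τ' k = LinearMap.id) {X : Type v} [AddCommGroup X] [Module R X]
    (hX : InAdd R M X) {P : Ideal (RHat R)} [P.IsPrime] (hP : P ∈ minimalPrimes (RHat R)) :
    ∑ i, (rankAt P (L i) : ℕ∞) * dimVec R M L X i = Cardinal.toENat (Module.rank R X) := by
  have hd := endDense_of_finite (M := M) hdim
  have hs : ∀ i, IsSimpleModule (Module.End R M)ᵐᵒᵖ (SimpleMod R M (L i)) := fun i =>
    isSimpleModule_simpleMod hd (hτσ i)
  obtain ⟨Λ, c, ⟨θ⟩⟩ := exists_simpleMod_linearEquiv hs col σ' τ' hστ (RHat R ⊗[R] X)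
  obtain ⟨θ'⟩ := nonempty_homTop_linearEquiv (M := M) (X := X) hdim
  obtain ⟨θ''⟩ := nonempty_simpleMod_dfinsupp (R := R) (M := M) (Y := fun a => L (c a))
  obtain ⟨ι, e, p, hpe⟩ := hX
  let _ : Field (Localization.AtPrime P) := (isField_localization_of_mem_minimalPrimes hP).toField
  have h1 := toENat_rank_eq_of_simpleMod_equiv hdim (isSummandOfCopies_baseChange hpe)
    (IsSummandOfCopies.dfinsupp (fun a => σ (c a)) (fun a => τ (c a)) fun a => hτσ (c a))
    (θ.trans θ''.symm) (K := Localization.AtPrime P)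
  rw [← toENat_rank_baseChange hP X]
  refine Eq.trans ?_ h1.symm
  refine Eq.trans ?_ (toENat_rank_dfinsupp hP c).symm
  refine Finset.sum_congr rfl fun i _ => ?_
  congr 1
  exact homDim_simpleMod_eq hdim hnoniso hτσ c (θ'.trans θ) i

/-- The rank condition is sufficient for being a dimension vector. -/
theorem exists_dimVec_eq [IsReduced (RHat R)] (hdim : ringKrullDim R = 1)
    [Module.IsTorsionFree R M]
    [∀ i, Module.Finite (RHat R) (L i)] [∀ i, IsLocalRing (Module.End (RHat R) (L i))]
    (hnoniso : ∀ i j, i ≠ j → IsEmpty (L i ≃ₗ[RHat R] L j))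
    {σ : ∀ i, L i →ₗ[RHat R] MHat R M} {τ : ∀ i, MHat R M →ₗ[RHat R] L i}
    (hτσ : ∀ i, τ i ∘ₗ σ i = LinearMap.id) (x : Fin s → ℕ∞)
    (hx : ∀ (P Q : Ideal (RHat R)) [P.IsPrime] [Q.IsPrime], P ∈ minimalPrimes (RHat R) →
      Q ∈ minimalPrimes (RHat R) → ∑ i, (rankAt P (L i) : ℕ∞) * x i =
        ∑ i, (rankAt Q (L i) : ℕ∞) * x i) :
    ∃ X : ModuleCat.{v} R, IsCountablyGenerated R X ∧ InAdd R M X ∧ dimVec R M L X = x := by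
  -- A countable index set with `x i` points of colour `i`, where infinity means countably many.
  let Λ : Type := Σ i, {k : ℕ // (k : ℕ∞) < x i}
  let c : Λ → Fin s := Sigma.fst
  have hc : ∀ i, Cardinal.toENat (Cardinal.mk {a // c a = i}) = x i := by
    intro i
    rw [Cardinal.toENat_congr (Equiv.sigmaSubtype i)]
    exact toENat_mk_lt (x i)
  let N : Type w := Π₀ a : Λ, L (c a)
  let _ : Module R N := Module.compHom N (algebraMap R (RHat R))
  have : IsScalarTower R (RHat R) N := IsScalarTower.of_algebraMap_smul fun _ _ => rfl
  have htf : ∀ (r : R) (y : N), r ≠ 0 → r • y = 0 → y = 0 := by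
    intro r y hr hy
    have hinj : Function.Injective (LinearMap.lsmul R M r) := by
      rw [injective_iff_map_eq_zero]
      exact fun m hm => (smul_eq_zero.mp hm).resolve_left hr
    have hinj' := Module.Flat.lTensor_preserves_injective_linearMap (M := RHat R) _ hinj
    have hl : ∀ z : MHat R M, (LinearMap.lsmul R M r).lTensor (RHat R) z =
        algebraMap R (RHat R) r • z := by
      intro z
      rw [algebraMap_smul]
      induction z using TensorProduct.induction_on with
      | zero => simp
      | add x y hx hy => rw [map_add, smul_add, hx, hy]
      | tmul b x => simp
    refine DFinsupp.ext fun a => ?_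
    have h1 : algebraMap R (RHat R) r • y a = 0 := DFunLike.congr_fun hy a
    have h2 : σ (c a) (y a) = 0 := by
      refine (injective_iff_map_eq_zero _).mp hinj' _ ?_
      rw [hl, ← map_smul, h1, map_zero]
    have h3 : τ (c a) (σ (c a) (y a)) = y a := LinearMap.congr_fun (hτσ (c a)) _
    rw [← h3, h2, map_zero]
    rfl
  obtain ⟨X, hXc, hXb⟩ := exists_isBaseChange_of_rank_eq (R := R) (N := N) hdim htf
    isCountablyGenerated_dfinsupp fun P Q _ _ hP hQ => by
      rw [toENat_rank_dfinsupp hP c, toENat_rank_dfinsupp hQ c]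
      simp only [hc]
      exact hx P Q hP hQ
  obtain ⟨k, e, p, hpe⟩ := exists_retract_finsupp (M := M) hdim hXb hXc
    (isLocallyRetract_dfinsupp (fun a => σ (c a)) (fun a => τ (c a)) fun a => hτσ (c a))
  have hpe' : ∀ y, p (e y) = y := fun y => LinearMap.congr_fun hpe y
  -- `X` lives in the universe of the `L i`; its image in a direct sum of copies of `M` is an
  -- isomorphic module in the universe of `M`.
  let E : X ≃ₗ[R] LinearMap.range e :=
    LinearEquiv.ofInjective e (Function.LeftInverse.injective hpe')
  refine ⟨ModuleCat.of R (LinearMap.range e), hXc.of_linearEquiv E, ?_, ?_⟩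
  · let U : ((Σ n, Fin (k n)) →₀ M) ≃ₗ[R] (ULift.{v} (Σ n, Fin (k n)) →₀ M) :=
      Finsupp.domLCongr Equiv.ulift.symm
    refine ⟨ULift.{v} (Σ n, Fin (k n)), U.toLinearMap ∘ₗ (LinearMap.range e).subtype,
      E.toLinearMap ∘ₗ p ∘ₗ U.symm.toLinearMap, ?_⟩
    refine LinearMap.ext fun y => ?_
    obtain ⟨y, rfl⟩ := E.surjective y
    change E (p (U.symm (U (e y)))) = E y
    rw [U.symm_apply_apply, hpe']
  · funext i
    obtain ⟨θ₁⟩ := nonempty_homTop_linearEquiv (M := M) (X := LinearMap.range e) hdim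
    obtain ⟨θ₂⟩ := nonempty_simpleMod_congr (M := M)
      ((E.symm.baseChange R (RHat R) _ _).trans hXb.equiv)
    obtain ⟨θ₃⟩ := nonempty_simpleMod_dfinsupp (R := R) (M := M) (Y := fun a => L (c a))
    rw [← hc i]
    exact homDim_simpleMod_eq hdim hnoniso hτσ c ((θ₁.trans θ₂).trans θ₃) i

end Main

end LocalAdd

end

/-! ### Assembly from the given decomposition of the completion of `M`. -/

theorem mainTheorem6 {R : Type u} [CommRing R] [IsDomain R] [IsNoetherianRing R] [IsLocalRing R]
    (hdim : ringKrullDim R = 1) (hred : IsReduced (LocalAdd.RHat R))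
    {M : Type v} [AddCommGroup M] [Module R M] [Module.Finite R M] [Module.IsTorsionFree R M]
    {s : ℕ} (L : Fin s → Type w) [∀ i, AddCommGroup (L i)] [∀ i, Module (LocalAdd.RHat R) (L i)]
    (hindec : ∀ i, LocalAdd.IsIndecomposable (LocalAdd.RHat R) (L i))
    (hnoniso : ∀ i j, i ≠ j → IsEmpty (L i ≃ₗ[LocalAdd.RHat R] L j))
    (n : Fin s → ℕ) (hn : ∀ i, 0 < n i)
    (hdecomp : Nonempty
      (LocalAdd.MHat R M ≃ₗ[LocalAdd.RHat R] ((i : Fin s) → Fin (n i) → L i)))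
    (x : Fin s → ℕ∞) :
    x ∈ Set.range (LocalAdd.DMap R M L) ↔
      ∀ (P Q : Ideal (LocalAdd.RHat R)) [P.IsPrime] [Q.IsPrime],
        P ∈ minimalPrimes (LocalAdd.RHat R) → Q ∈ minimalPrimes (LocalAdd.RHat R) →
          ∑ i, (LocalAdd.rankAt P (L i) : ℕ∞) * x i =
            ∑ i, (LocalAdd.rankAt Q (L i) : ℕ∞) * x i := by
  classical
  have hnoeth := LocalAdd.isNoetherianRing_completion hdim
  obtain ⟨E⟩ := hdecomp
  let σ' : ∀ k : (Σ i, Fin (n i)), L k.1 →ₗ[LocalAdd.RHat R] LocalAdd.MHat R M := fun k =>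
    E.symm.toLinearMap ∘ₗ
      LinearMap.single (LocalAdd.RHat R) (fun i => Fin (n i) → L i) k.1 ∘ₗ
        LinearMap.single (LocalAdd.RHat R) (fun _ => L k.1) k.2
  let τ' : ∀ k : (Σ i, Fin (n i)), LocalAdd.MHat R M →ₗ[LocalAdd.RHat R] L k.1 := fun k =>
    LinearMap.proj k.2 ∘ₗ
      LinearMap.proj (R := LocalAdd.RHat R) (φ := fun i => Fin (n i) → L i) k.1 ∘ₗ E.toLinearMap
  have hτσ' : ∀ k, τ' k ∘ₗ σ' k = LinearMap.id := by
    intro k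
    refine LinearMap.ext fun y => ?_
    simp [σ', τ']
  have hστ' : ∑ k, σ' k ∘ₗ τ' k = LinearMap.id := by
    refine LinearMap.ext fun y => E.injective ?_
    rw [LinearMap.sum_apply, map_sum, Fintype.sum_sigma]
    have h1 : ∀ i, (∑ j, E ((σ' ⟨i, j⟩ ∘ₗ τ' ⟨i, j⟩) y)) =
        Pi.single (M := fun i => Fin (n i) → L i) i (E y i) := by
      intro i
      have h2 : ∑ j, Pi.single (M := fun _ => L i) j (E y i j) = E y i := Finset.univ_sum_single _
      rw [← h2, ← LinearMap.single_apply (LocalAdd.RHat R), map_sum]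
      exact Finset.sum_congr rfl fun j _ => E.apply_symm_apply _
    rw [Finset.sum_congr rfl fun i _ => h1 i]
    exact Finset.univ_sum_single _
  -- Positivity of `n i` provides a copy number `0`, which exhibits every `L i` as a retract of
  -- `M̂`.
  let σ := fun i => σ' ⟨i, ⟨0, hn i⟩⟩
  let τ := fun i => τ' ⟨i, ⟨0, hn i⟩⟩
  have hτσ : ∀ i, τ i ∘ₗ σ i = LinearMap.id := fun i => hτσ' _
  have hfin : ∀ i, Module.Finite (LocalAdd.RHat R) (L i) := fun i =>
    Module.Finite.of_surjective (τ i) fun y => ⟨σ i y, LinearMap.congr_fun (hτσ i) y⟩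
  have hlocal : ∀ i, IsLocalRing (Module.End (LocalAdd.RHat R) (L i)) := fun i =>
    LocalAdd.isLocalRing_end_of_isIndecomposable (hindec i)
  constructor
  · rintro ⟨X, rfl⟩ P Q _ _ hP hQ
    obtain ⟨⟨X, -, hX⟩, rfl⟩ := Quotient.exists_rep X
    exact (LocalAdd.sum_rankAt_mul_dimVec hdim hnoniso hτσ Sigma.fst σ' τ' hστ' hX hP).trans
      (LocalAdd.sum_rankAt_mul_dimVec hdim hnoniso hτσ Sigma.fst σ' τ' hστ' hX hQ).symm
  · intro hx
    obtain ⟨X, hXc, hXa, hXx⟩ := LocalAdd.exists_dimVec_eq hdim hnoniso hτσ x hx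
    exact ⟨Quotient.mk _ ⟨X, hXc, hXa⟩, hXx⟩
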